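/- Let $(\mathcal M,g_{ab})$ be a stationary axisymmetric spacetime with timelike Killing vector $\xi^a$, $\lambda=-\xi^a\xi_a$, twist $\omega$ (with $\nabla_a\omega=\epsilon_{abcd}\xi^b\nabla^c\xi^d$), metric $h_{ab}=\lambda g_{ab}+\xi_a\xi_b$ on the 3-manifold $V$ of trajectories, and potential $\phi=\frac{\lambda^2+\omega^2-1}{4\lambda}+i\frac{\omega}{2\lambda}$. Suppose that $V$ is asymptotically flat: there are $\widetilde V=V\cup\{\Lambda\}$ and $\hat\Omega$, positive on $V$, such that $\hat h_{ab}=\hat\Omega^2h_{ab}$ is a smooth metric on $\widetilde V$ and, at $\Lambda$, $\hat\Omega=0$, $\hat D_a\hat\Omega=0$, $\hat D_a\hat D_b\hat\Omega=2\hat h_{ab}$. Suppose moreover that, near $\Lambda$, in cylindrical coordinates centred at $\Lambda=\{\tilde z=\tilde\rho=0\}$, $$\hat h=\tilde\rho^2e^{-2\beta}\,d\varphi^2+d\tilde\rho^2+d\tilde z^2,\qquad \beta=\beta(\tilde z,\tilde\rho),$$ and that $\beta$ and $\hat\phi=\phi/\sqrt{\hat\Omega}$ are (real-)analytic in a neighbourhood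 of $\Lambda$. For an axisymmetric function $g(\tilde z,\tilde\rho)$, analytic near the origin and extended evenly to $\tilde\rho<0$, let $g_L(r)=g(r,-ir)$, defined for small real $r$ through the complexified power series; $g_L$ is real if $g$ is. Let $C\in\mathbb R$. Then there is a smooth axisymmetric real function $\kappa$ on $\widetilde V$, analytic near $\Lambda$, with $\kappa(\Lambda)=0$ and, for all small $r$, $$\kappa_L(r)=-\ln\Bigl(1-r\int_0^r\frac{e^{2\beta_L(s)}-1}{s^2}\,ds-rC\Bigr)+\beta_L(r).$$ For every such $\kappa$, put $\tilde h=e^{2\kappa}\hat h$, $\tilde\phi=e^{-\kappa/2}\hat\phi$. Then: 1. $M(r):=\beta_L''-(\beta_L')^2+\frac2r\beta_L'-\kappa_L''+(\kappa_L')^2=0$ for all small $r\neq0$. 2. $\rho(r)=re^{\kappa_L(r)-\beta_L(r)}$ has near $0$ a local inverse $r(\rho)$ with $r(0)=0$, and $$y(\rho)=\tilde\phi_L(r(\rho))=e^{-\kappa_L(r(\rho))/2}\,\hat\phi_L(r(\rho))$$ is a complex-valued function analytic near $\rho=0$. 3. Let $P=\tilde\phi$ and $$P_{a_1\ldots a_n}=C\bigl[\tilde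 D_{a_1}P_{a_2\ldots a_n}-\tfrac{(n-1)(2n-3)}2\widetilde R_{a_1a_2}P_{a_3\ldots a_n}\bigr],$$ where $\tilde D$ and $\widetilde R_{ab}$ are the Levi-Civita connection and the Ricci tensor of $\tilde h$ and $C[\,\cdot\,]$ is the totally symmetric trace-free part with respect to $\tilde h$. Then for each $n\ge0$ there is exactly one number $m_n\in\mathbb C$ (the $n$-th multipole moment) with $P_{a_1\ldots a_n}(\Lambda)=m_n\,C[z_{a_1}\cdots z_{a_n}]$, where $z_a=(d\tilde z)_a$, and $$m_n=\frac{d^ny}{d\rho^n}(0).$$ -/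

import Mathlib

open Filter Topology
open scoped ContDiff

namespace Multipole

noncomputable section

/-! ### Tensor calculus in a coordinate chart -/

/-- Points of a `d`-dimensional coordinate chart. -/
abbrev Chart (d : ℕ) : Type := Fin d → ℝ

/-- The components of a (semi-)Riemannian metric in a chart. -/
abbrev MetricField (d : ℕ) : Type := Chart d → Matrix (Fin d) (Fin d) ℝ

/-- A complex covariant tensor of rank `n` on a `d`-dimensional space, by its components. -/
abbrev Tensor (d n : ℕ) : Type := (Fin n → Fin d) → ℂ

/-- The partial derivative `∂_i f`. -/
def pd {d : ℕ} {F : Type*} [NormedAddCommGroup F] [NormedSpace ℝ F]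
    (i : Fin d) (f : Chart d → F) (x : Chart d) : F :=
  fderiv ℝ f x (Pi.single i 1)

/-- The Christoffel symbols `Γ^k_{ij}` of the Levi-Civita connection. -/
def christoffel {d : ℕ} (h : MetricField d) (x : Chart d) (k i j : Fin d) : ℝ :=
  (1 / 2) * ∑ l, (h x)⁻¹ k l *
    (pd i (fun y => h y l j) x + pd j (fun y => h y l i) x - pd l (fun y => h y i j) x)

/-- The Ricci tensor
`R_{ij} = ∂_k Γ^k_{ij} - ∂_j Γ^k_{ik} + Γ^k_{kl} Γ^l_{ij} - Γ^k_{jl} Γ^l_{ik}`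
(positive on round spheres). -/
def ricci {d : ℕ} (h : MetricField d) (x : Chart d) (i j : Fin d) : ℝ :=
  ∑ k, (pd k (fun y => christoffel h y k i j) x - pd j (fun y => christoffel h y k i k) x)
    + ∑ k, ∑ l, (christoffel h x k k l * christoffel h x l i j
        - christoffel h x k j l * christoffel h x l i k)

/-- The covariant derivative `D_{i₀} T_{i₁ … iₙ}` of a covariant tensor field; the derivative
index comes first. -/
def covDeriv {d n : ℕ} (h : MetricField d) (T : Chart d → Tensor d n) (x : Chart d) :
    Tensor d (n + 1) := fun i =>
  pd (i 0) (fun y => T y (Fin.tail i)) x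
    - ∑ k : Fin n, ∑ l : Fin d,
        (christoffel h x l (i 0) (Fin.tail i k) : ℂ) * T x (Function.update (Fin.tail i) k l)

/-- The covariant Hessian `D_i D_j f` of a real function. -/
def covHessian {d : ℕ} (h : MetricField d) (f : Chart d → ℝ) (x : Chart d) (i j : Fin d) : ℝ :=
  pd i (fun y => pd j f y) x - ∑ k, christoffel h x k i j * pd k f x

/-- The covariant derivative `∇_c X^a` of a vector field. -/
def covDerivVec {d : ℕ} (h : MetricField d) (X : Chart d → (Fin d → ℝ)) (x : Chart d)
    (c a : Fin d) : ℝ :=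
  pd c (fun y => X y a) x + ∑ e, christoffel h x a c e * X x e

/-- `X` satisfies Killing's equation `∇_c X_a + ∇_a X_c = 0` on `s`. -/
def IsKillingOn {d : ℕ} (h : MetricField d) (X : Chart d → (Fin d → ℝ)) (s : Set (Chart d)) :
    Prop :=
  ∀ x ∈ s, ∀ c a : Fin d,
    ∑ e, (h x a e * covDerivVec h X x c e + h x c e * covDerivVec h X x a e) = 0

/-! ### The totally symmetric trace-free part of a tensor -/

/-- Totally symmetric and trace-free (with respect to the metric `h`) tensors. -/
def IsSTF {d n : ℕ} (h : Matrix (Fin d) (Fin d) ℝ) (T : Tensor d n) : Prop :=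
  (∀ (σ : Equiv.Perm (Fin n)) (i : Fin n → Fin d), T (i ∘ σ) = T i) ∧
  (∀ (p q : Fin n), p ≠ q → ∀ i : Fin n → Fin d,
    ∑ a, ∑ b, ((h⁻¹ a b : ℝ) : ℂ) * T (Function.update (Function.update i p a) q b) = 0)

/-- The full contraction `h^{a₁b₁} ⋯ h^{aₙbₙ} S_{a₁…aₙ} T_{b₁…bₙ}`. -/
def fullContraction {d n : ℕ} (h : Matrix (Fin d) (Fin d) ℝ) (S T : Tensor d n) : ℂ :=
  ∑ a : Fin n → Fin d, ∑ b : Fin n → Fin d,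
    (∏ k, ((h⁻¹ (a k) (b k) : ℝ) : ℂ)) * S a * T b

/-- `S` is the totally symmetric trace-free part of `T`: it is symmetric and trace-free, and
what was removed, `T - S`, is orthogonal to all symmetric trace-free tensors. -/
def IsSTFPart {d n : ℕ} (h : Matrix (Fin d) (Fin d) ℝ) (T S : Tensor d n) : Prop :=
  IsSTF h S ∧ ∀ W : Tensor d n, IsSTF h W → fullContraction h (T - S) W = 0

open Classical in
/-- `C[T]`, the totally symmetric trace-free part. For a positive definite `h` there is exactly
one `S` with `IsSTFPart h T S`, the orthogonal projection of `T`. -/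
def stfPart {d n : ℕ} (h : Matrix (Fin d) (Fin d) ℝ) (T : Tensor d n) : Tensor d n :=
  if hS : ∃ S, IsSTFPart h T S then hS.choose else 0

/-! ### The Geroch–Hansen recursion -/

/-- The tensors `P, P_{a₁}, P_{a₁a₂}, …` of a potential `φ` on a Riemannian 3-manifold:
`P_{a₁…aₙ} = C[D_{a₁} P_{a₂…aₙ} - (n-1)(2n-3)/2 · R_{a₁a₂} P_{a₃…aₙ}]`. -/
def multipoleTensor (h : MetricField 3) (φ : Chart 3 → ℂ) : (n : ℕ) → Chart 3 → Tensor 3 n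
  | 0 => fun x _ => φ x
  | 1 => fun x => stfPart (h x) (covDeriv h (multipoleTensor h φ 0) x)
  | n + 2 => fun x => stfPart (h x) (fun i =>
      covDeriv h (multipoleTensor h φ (n + 1)) x i
        - (((n : ℂ) + 1) * (2 * (n : ℂ) + 1) / 2) * (ricci h x (i 0) (i 1) : ℂ)
          * multipoleTensor h φ n x (fun k => i k.succ.succ))

/-- The tensor `z_{a₁} ⋯ z_{aₙ}`, where `z = dz` is the covector along the symmetry axis. -/
def axisPower (n : ℕ) : Tensor 3 n := fun i => ∏ k, if i k = 2 then (1 : ℂ) else 0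

/-- `m` is the `n`-th multipole moment: `P_{a₁…aₙ}(Λ) = m C[z_{a₁} ⋯ z_{aₙ}]`, with `Λ` the
origin of the chart. -/
def IsMultipoleMoment (h : MetricField 3) (φ : Chart 3 → ℂ) (n : ℕ) (m : ℂ) : Prop :=
  multipoleTensor h φ n 0 = m • stfPart (h 0) (axisPower n)

/-! ### Stationary axisymmetric asymptotically flat spacetimes

The coordinates are `(t, x, y, z)`, indexed `0, 1, 2, 3` on the spacetime, and `(x, y, z)`,
indexed `0, 1, 2`, on the 3-manifold of trajectories. They are compactified coordinates:
the point at infinity `Λ` is the origin `x = y = z = 0`, and the axis is `x = y = 0`. -/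

/-- The trajectory through a spacetime point. -/
def spatial (p : Chart 4) : Chart 3 := fun i => p i.succ

/-- The point at time `0` on a trajectory. -/
def atTimeZero (x : Chart 3) : Chart 4 := Fin.cons 0 x

/-- The rotation by the angle `α` about the `z`-axis. -/
def rotation (α : ℝ) : Matrix (Fin 3) (Fin 3) ℝ :=
  !![Real.cos α, -Real.sin α, 0; Real.sin α, Real.cos α, 0; 0, 0, 1]

/-- The same rotation acting on the spacetime. -/
def rotation4 (α : ℝ) : Matrix (Fin 4) (Fin 4) ℝ :=
  !![1, 0, 0, 0; 0, Real.cos α, -Real.sin α, 0; 0, Real.sin α, Real.cos α, 0; 0, 0, 0, 1]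

/-- Invariance of a function under rotations about the `z`-axis. -/
def IsAxisymmetricOn {F : Type*} (U : Set (Chart 3)) (f : Chart 3 → F) : Prop :=
  ∀ (α : ℝ), ∀ x ∈ U, f ((rotation α).mulVec x) = f x

/-- The signature `(-,+,+,+)`. -/
def IsLorentzian (A : Matrix (Fin 4) (Fin 4) ℝ) : Prop :=
  A.IsSymm ∧ ∃ B : Matrix (Fin 4) (Fin 4) ℝ, IsUnit B.det ∧
    B.transpose * A * B = Matrix.diagonal ![-1, 1, 1, 1]

/-- The components `ε_{abcd}` of the volume form of the spacetime metric. -/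
def volumeForm (g : MetricField 4) (p : Chart 4) (a b c d : Fin 4) : ℝ :=
  Real.sqrt |(g p).det| *
    (Matrix.of fun k l : Fin 4 => if ![a, b, c, d] k = l then (1 : ℝ) else 0).det

/-- The vector field `ξ = ∂/∂t`. -/
def timeField : Chart 4 → (Fin 4 → ℝ) := fun _ => Pi.single 0 1

/-- The region `ℝ × (U ∖ {Λ})`. -/
def spacetimeRegion (U : Set (Chart 3)) : Set (Chart 4) :=
  {p | spatial p ∈ U ∧ spatial p ≠ 0}

/-- A stationary axisymmetric spacetime near infinity, on `ℝ × (U ∖ {Λ})`, with timelike Killing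
vector `ξ = ∂/∂t`, together with its twist `ω`. -/
structure StationaryAxisymmetricSpacetime where
  /-- the 3-manifold of trajectories with the point `Λ = 0` added -/
  U : Set (Chart 3)
  isOpen_U : IsOpen U
  zero_mem : (0 : Chart 3) ∈ U
  rotation_mem : ∀ (α : ℝ), ∀ x ∈ U, (rotation α).mulVec x ∈ U
  /-- the spacetime metric -/
  g : MetricField 4
  smooth_g : ∀ a b, ContDiffOn ℝ ∞ (fun p => g p a b) (spacetimeRegion U)
  lorentzian : ∀ p ∈ spacetimeRegion U, IsLorentzian (g p)
  killing : IsKillingOn g timeField (spacetimeRegion U)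
  timelike : ∀ p ∈ spacetimeRegion U, g p 0 0 < 0
  /-- the rotations about the axis are isometries -/
  axisymmetric : ∀ (α : ℝ), ∀ p ∈ spacetimeRegion U,
    (rotation4 α).transpose * g ((rotation4 α).mulVec p) * rotation4 α = g p
  /-- the twist, a function on the manifold of trajectories -/
  twist : Chart 3 → ℝ
  smooth_twist : ContDiffOn ℝ ∞ twist (U \ {0})
  /-- `∇_a ω = ε_{abcd} ξ^b ∇^c ξ^d` -/
  twist_eq : ∀ p ∈ spacetimeRegion U, ∀ a : Fin 4,
    pd a (fun q => twist (spatial q)) p =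
      ∑ b, ∑ c, ∑ d, volumeForm g p a b c d * timeField p b *
        ∑ e, (g p)⁻¹ c e * covDerivVec g timeField p e d
  twist_axisymmetric : IsAxisymmetricOn (U \ {0}) twist

namespace StationaryAxisymmetricSpacetime

variable (S : StationaryAxisymmetricSpacetime)

/-- `λ = -ξ^a ξ_a`. -/
def lam (x : Chart 3) : ℝ := -S.g (atTimeZero x) 0 0

/-- The metric `h_{ab} = λ g_{ab} + ξ_a ξ_b` on the 3-manifold of trajectories. -/
def h : MetricField 3 := fun x => Matrix.of fun i j =>
  S.lam x * S.g (atTimeZero x) i.succ j.succ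
    + S.g (atTimeZero x) i.succ 0 * S.g (atTimeZero x) j.succ 0

/-- The potential `φ = φ_M + i φ_J`, with `φ_M = (λ² + ω² - 1) / (4λ)`, `φ_J = ω / (2λ)`. -/
def potential (x : Chart 3) : ℂ :=
  (((S.lam x ^ 2 + S.twist x ^ 2 - 1) / (4 * S.lam x) : ℝ) : ℂ)
    + Complex.I * ((S.twist x / (2 * S.lam x) : ℝ) : ℂ)

end StationaryAxisymmetricSpacetime

/-- The Cartesian components, off the axis `x = y = 0`, of the metric
`ρ² e^{-2β} dφ² + dρ² + dz²`, where `x = ρ cos φ`, `y = ρ sin φ`; they follow from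
`dρ² + ρ² dφ² = dx² + dy²` and `ρ² dφ² = (x dy - y dx)² / (x² + y²)`. -/
def cylindricalMetric (β : Chart 3 → ℝ) : MetricField 3 := fun x => Matrix.of fun i j =>
  (if i = j then 1 else 0)
    + (Real.exp (-2 * β x) - 1) * (![-x 1, x 0, 0] i * ![-x 1, x 0, 0] j) / (x 0 ^ 2 + x 1 ^ 2)

/-- An asymptotically flat conformal completion `ĥ = Ω² h` of the manifold of trajectories, by
the point `Λ = 0`, in which `ĥ = ρ² e^{-2β} dφ² + dρ² + dz²`; together with the rescaled
potential `φ / √Ω`, which is required to have a value at `Λ` (its regularity there is a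
separate hypothesis). -/
structure AxialCompletion (S : StationaryAxisymmetricSpacetime) where
  Ω : Chart 3 → ℝ
  smooth_Ω : ContDiffOn ℝ 2 Ω S.U
  Ω_pos : ∀ x ∈ S.U, x ≠ 0 → 0 < Ω x
  hhat : MetricField 3
  smooth_hhat : ∀ i j, ContDiffOn ℝ ∞ (fun x => hhat x i j) S.U
  posDef_hhat : ∀ x ∈ S.U, (hhat x).PosDef
  hhat_eq : ∀ x ∈ S.U, x ≠ 0 → hhat x = (Ω x ^ 2) • S.h x
  Ω_zero : Ω 0 = 0
  dΩ_zero : ∀ i, pd i Ω 0 = 0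
  hessΩ_zero : ∀ i j, covHessian hhat Ω 0 i j = 2 * hhat 0 i j
  β : Chart 3 → ℝ
  β_axisymmetric : IsAxisymmetricOn S.U β
  hhat_form : ∀ x ∈ S.U, x 0 ^ 2 + x 1 ^ 2 ≠ 0 → hhat x = cylindricalMetric β x
  phihat : Chart 3 → ℂ
  phihat_eq : ∀ x ∈ S.U, x ≠ 0 → phihat x = S.potential x / (Real.sqrt (Ω x) : ℂ)

/-! ### Leading order functions -/

/-- The restriction of a function to the plane `y = 0`, as a function of `(z, ρ)`. -/
def meridian {F : Type*} (f : Chart 3 → F) : ℝ × ℝ → F := fun p => f ![p.2, 0, p.1]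

/-- `G` is a holomorphic extension of `g` near the origin. -/
def IsComplexExtension (g : ℝ × ℝ → ℂ) (G : ℂ × ℂ → ℂ) : Prop :=
  AnalyticAt ℂ G 0 ∧ ∀ᶠ p in 𝓝 (0 : ℝ × ℝ), G ((p.1 : ℂ), (p.2 : ℂ)) = g p

open Classical in
/-- The leading order function `g_L(r) = g(r, -i r)` of a function `g(z, ρ)` that is analytic near
the origin. Its germ at `0` does not depend on the choice of the extension. -/
def leadingOrder (g : ℝ × ℝ → ℂ) (r : ℝ) : ℂ :=
  if hG : ∃ G, IsComplexExtension g G then hG.choose ((r : ℂ), -Complex.I * (r : ℂ)) else 0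

/-- `f_L` for a complex function on the 3-manifold. -/
def leadC (f : Chart 3 → ℂ) : ℝ → ℂ := leadingOrder (meridian f)

/-- `f_L` for a real axisymmetric function on the 3-manifold; the leading order function is then
real near `0`, since `f(z, ρ)` is even in `ρ`, and is regarded as a real function. -/
def leadR (f : Chart 3 → ℝ) : ℝ → ℝ := fun r => (leadC (fun x => (f x : ℂ)) r).re

/-! ### The choice of the conformal factor -/

/-- The functions `κ` allowed in a further conformal factor `e^κ`. -/
structure IsConformalExponent (U : Set (Chart 3)) (κ : Chart 3 → ℝ) : Prop where
  smooth : ContDiffOn ℝ ∞ κ U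
  axisymmetric : IsAxisymmetricOn U κ
  zero : κ 0 = 0
  analytic : AnalyticAt ℝ κ 0

/-- `κ_L(r) = -ln(1 - r ∫₀^r (e^{2β_L(s)} - 1)/s² ds - r C) + β_L(r)` near `r = 0`. -/
def IsSpecialExponent (β κ : Chart 3 → ℝ) (C : ℝ) : Prop :=
  ∀ᶠ r in 𝓝 (0 : ℝ), leadR κ r =
    -Real.log (1 - r * (∫ s in (0 : ℝ)..r, (Real.exp (2 * leadR β s) - 1) / s ^ 2) - r * C)
      + leadR β r

/-- `M(r) = β_L'' - (β_L')² + (2/r) β_L' - κ_L'' + (κ_L')²`, for `r ≠ 0`. -/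
def curvatureM (β κ : Chart 3 → ℝ) (r : ℝ) : ℝ :=
  deriv (deriv (leadR β)) r - (deriv (leadR β) r) ^ 2 + 2 / r * deriv (leadR β) r
    - deriv (deriv (leadR κ)) r + (deriv (leadR κ) r) ^ 2

/-- The radial parameter `ρ(r) = r e^{κ_L(r) - β_L(r)}`. -/
def radial (β κ : Chart 3 → ℝ) (r : ℝ) : ℝ := r * Real.exp (leadR κ r - leadR β r)

/-- `rr` is the function `r(ρ)` defined implicitly near `ρ = 0` by `ρ = f(r)`, `r(0) = 0`. -/
def IsLocalInverse (f rr : ℝ → ℝ) : Prop :=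
  rr 0 = 0 ∧ ContinuousAt rr 0 ∧ ∀ᶠ s in 𝓝 (0 : ℝ), f (rr s) = s

/-- The rescaled metric `e^{2κ} ĥ`. -/
def rescaledMetric (κ : Chart 3 → ℝ) (hhat : MetricField 3) : MetricField 3 :=
  fun x => Real.exp (2 * κ x) • hhat x

/-- The rescaled potential `e^{-κ/2} φ̂`. -/
def rescaledPotential (κ : Chart 3 → ℝ) (phihat : Chart 3 → ℂ) : Chart 3 → ℂ :=
  fun x => (Real.exp (-κ x / 2) : ℂ) * phihat x

/-- `y(ρ) = e^{-κ_L(r(ρ))/2} φ̂_L(r(ρ))`. -/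
def momentFunction (κ : Chart 3 → ℝ) (phihat : Chart 3 → ℂ) (rr : ℝ → ℝ) : ℝ → ℂ :=
  fun s => (Real.exp (-leadR κ (rr s) / 2) : ℂ) * leadC phihat (rr s)

end

end Multipole

open Multipole

/-! Write `η = ∂_z - i ∂_x`, with constant Cartesian components. It is tangent to the meridian plane
`y = 0` and null there for `h̃`, because on that plane `h̃` is diagonal with equal `x` and `z`
entries. Set `f_n = P_{a₁…aₙ} η^{a₁} ⋯ η^{aₙ}`.

The moment is `f_n(Λ)`. Rotations about the axis are isometries fixing `Λ`, so `P_{a₁…aₙ}(Λ)` is an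
axisymmetric symmetric trace-free tensor. Such tensors form a line (`axisymmetric_stf_eq_smul`)
spanned by `C[z ⋯ z]`, whose contraction with `η` is `1`.

Contraction with `η` makes the recursion scalar. It does not see `C[·]`, since the lowered `η ⊗ ⋯ ⊗
η` is itself symmetric and trace-free (`IsSTFPart.evalDiag_eq`). Moreover `Γ^l_{ij} η^i η^j = 2 (ηκ)
η^l`. So off the axis in the plane, `f_{n+1} = η f_n - 2n (ηκ) f_n - n(2n-1)/2 · Ric(η,η) f_{n-1}`,
where the last term is absent for `n = 0`.

Leading orders turn this into an ordinary differential recursion. The null line `r ↦ (r, -i r)` has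
tangent `(1, -i)`, so `g ↦ g_L` is multiplicative and carries `η g` to `(g_L)'`
(`IsLead.nullDeriv`). Explicit computation of the curvature shows that `Ric(η,η)_L` is `M`.

The formula for `κ_L` is the solution, with integration constant `C`, of `1 + r (κ_L' - β_L') =
e^{κ_L + β_L}`. Differentiating this equation gives `M = 0`; using it directly gives `dρ/dr =
e^{2κ_L}`. Hence `(f_{n+1})_L = (f_n)_L' - 2n κ_L' (f_n)_L` and `d/dρ = e^{-2κ_L} d/dr`. Induction
yields `y^{(n)} = e^{-2nκ_L} (f_n)_L` along `r = r(ρ)` (`iteratedDeriv_eventuallyEq`), and at `0`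
the exponential is `1`.

The rest is regularity across the axis. The cylindrical form of the metric is given only off the
axis, so `β` is shown to vanish on it and to be divisible by `x² + y²`. This provides an analytic
orthonormal frame, hence analytic tensors `P_{a₁…aₙ}`, and identities found off the axis extend by
density. -/

namespace Multipole

/-! ### Linear changes of frame of covariant tensors -/

section Pull

variable {d n : ℕ}

/-- Exchanging `a` with the `k`-th entry of `j` is an involution of the pairs `(j, a)`. This is how
a contracted index is moved from a tensor to a Christoffel symbol. -/
theorem sum_sum_update {ι α M : Type*} [Fintype ι] [DecidableEq ι] [Fintype α] [AddCommMonoid M]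
    (k : ι) (F : (ι → α) → α → M) :
    ∑ j : ι → α, ∑ a, F (Function.update j k a) (j k) = ∑ j : ι → α, ∑ a, F j a := by
  have hinv : Function.Involutive
      (fun q : (ι → α) × α => (Function.update q.1 k q.2, q.1 k)) := by
    rintro ⟨j, a⟩
    simp
  simp only [← Fintype.sum_prod_type']
  exact Equiv.sum_comp hinv.toPerm (fun q : (ι → α) × α => F q.1 q.2)

theorem sum_update_eq_card_smul {ι α M : Type*} [Fintype ι] [DecidableEq ι] [Fintype α]
    [AddCommMonoid M] (k : ι) (F : (ι → α) → M) :
    ∑ j : ι → α, ∑ a, F (Function.update j k a) = Fintype.card α • ∑ j : ι → α, F j := by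
  rw [sum_sum_update k (fun j _ => F j)]
  simp [Finset.smul_sum]

/-- The tensor `T` pulled back along the linear map with matrix `A`. -/
noncomputable def pull (A : Matrix (Fin d) (Fin d) ℂ) (T : Tensor d n) : Tensor d n :=
  fun i => ∑ j : Fin n → Fin d, (∏ k, A (j k) (i k)) * T j

/-- The contraction of all pairs of indices with the matrix `H`. -/
noncomputable def bil (H : Matrix (Fin d) (Fin d) ℂ) (S T : Tensor d n) : ℂ :=
  ∑ a : Fin n → Fin d, ∑ b : Fin n → Fin d, (∏ k, H (a k) (b k)) * S a * T b

theorem sum_prod_mul_prod {R : Type*} [CommSemiring R] (A B : Matrix (Fin d) (Fin d) R)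
    (l i : Fin n → Fin d) :
    ∑ j : Fin n → Fin d, (∏ k, A (l k) (j k)) * ∏ k, B (j k) (i k)
      = ∏ k, (A * B) (l k) (i k) := by
  simp only [Matrix.mul_apply, Finset.prod_univ_sum, Fintype.piFinset_univ,
    Finset.prod_mul_distrib]

theorem pull_pull (A B : Matrix (Fin d) (Fin d) ℂ) (T : Tensor d n) :
    pull B (pull A T) = pull (A * B) T := by
  funext i
  simp only [pull, Finset.mul_sum]
  rw [Finset.sum_comm]
  refine Finset.sum_congr rfl fun l _ => ?_
  rw [← sum_prod_mul_prod, Finset.sum_mul]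
  exact Finset.sum_congr rfl fun j _ => by ring

theorem pull_one (T : Tensor d n) : pull 1 T = T := by
  funext i
  have h : ∀ j : Fin n → Fin d,
      (∏ k, (1 : Matrix (Fin d) (Fin d) ℂ) (j k) (i k)) = if j = i then 1 else 0 := by
    intro j
    split_ifs with hj
    · subst hj
      simp
    · obtain ⟨k, hk⟩ := Function.ne_iff.1 hj
      exact Finset.prod_eq_zero (Finset.mem_univ k) (Matrix.one_apply_ne hk)
  simp [pull, h]

theorem pull_sub (A : Matrix (Fin d) (Fin d) ℂ) (S T : Tensor d n) :
    pull A (S - T) = pull A S - pull A T := by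
  funext i
  simp [pull, mul_sub, Finset.sum_sub_distrib]

theorem pull_smul (A : Matrix (Fin d) (Fin d) ℂ) (c : ℂ) (T : Tensor d n) :
    pull A (c • T) = c • pull A T := by
  funext i
  simp only [pull, Pi.smul_apply, smul_eq_mul, Finset.mul_sum]
  exact Finset.sum_congr rfl fun j _ => by ring

theorem bil_pull_right (H A : Matrix (Fin d) (Fin d) ℂ) (S T : Tensor d n) :
    bil H S (pull A T) = bil (H * A.transpose) S T := by
  simp only [bil, pull]
  refine Finset.sum_congr rfl fun a _ => ?_
  simp only [Finset.mul_sum]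
  rw [Finset.sum_comm]
  refine Finset.sum_congr rfl fun b _ => ?_
  rw [← sum_prod_mul_prod, Finset.sum_mul, Finset.sum_mul]
  refine Finset.sum_congr rfl fun c _ => ?_
  simp only [Matrix.transpose_apply]
  ring

theorem bil_comm (H : Matrix (Fin d) (Fin d) ℂ) (S T : Tensor d n) :
    bil H S T = bil H.transpose T S := by
  simp only [bil]
  rw [Finset.sum_comm]
  refine Finset.sum_congr rfl fun a _ => Finset.sum_congr rfl fun b _ => ?_
  simp only [Matrix.transpose_apply]
  ring

theorem bil_pull_left (H A : Matrix (Fin d) (Fin d) ℂ) (S T : Tensor d n) :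
    bil H (pull A S) T = bil (A * H) S T := by
  rw [bil_comm, bil_pull_right, bil_comm]
  simp

theorem fullContraction_eq_bil (h : Matrix (Fin d) (Fin d) ℝ) (S T : Tensor d n) :
    fullContraction h S T = bil (h⁻¹.map Complex.ofReal) S T := rfl

/-- Totally symmetric tensors that are trace-free with respect to the inverse metric `H`. -/
def IsSTFc (H : Matrix (Fin d) (Fin d) ℂ) (T : Tensor d n) : Prop :=
  (∀ (σ : Equiv.Perm (Fin n)) (i : Fin n → Fin d), T (i ∘ σ) = T i) ∧
  (∀ (p q : Fin n), p ≠ q → ∀ i : Fin n → Fin d,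
    ∑ a, ∑ b, H a b * T (Function.update (Function.update i p a) q b) = 0)

theorem isSTF_iff (h : Matrix (Fin d) (Fin d) ℝ) (T : Tensor d n) :
    IsSTF h T ↔ IsSTFc (h⁻¹.map Complex.ofReal) T := Iff.rfl

/-- Replacing the entries `p` and `q` by all values and then summing over every `j` counts each
multi-index `d²` times, and each inner sum is a trace. Dividing by `d²` needs `d ≠ 0`; for `d = 0`
there are no multi-indices, as `p` exists. -/
theorem sum_trace_eq_zero {H : Matrix (Fin d) (Fin d) ℂ} {T : Tensor d n} (hT : IsSTFc H T)
    {p q : Fin n} (hpq : p ≠ q) (C : (Fin n → Fin d) → ℂ)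
    (hC : ∀ j a b, C (Function.update (Function.update j p a) q b) = C j) :
    ∑ j, C j * H (j p) (j q) * T j = 0 := by
  rcases Nat.eq_zero_or_pos d with hd | hd
  · subst hd
    have : IsEmpty (Fin n → Fin 0) := ⟨fun f => (f p).elim0⟩
    simp
  have h := sum_update_eq_card_smul (M := ℂ) p
    (fun j : Fin n → Fin d => ∑ b, C (Function.update j q b) * H (Function.update j q b p)
      (Function.update j q b q) * T (Function.update j q b))
  rw [sum_update_eq_card_smul q (fun j : Fin n → Fin d => C j * H (j p) (j q) * T j)] at h
  have h0 : ∀ j : Fin n → Fin d, ∑ a, ∑ b,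
      C (Function.update (Function.update j p a) q b)
        * H (Function.update (Function.update j p a) q b p)
          (Function.update (Function.update j p a) q b q)
        * T (Function.update (Function.update j p a) q b) = 0 := by
    intro j
    have := hT.2 p q hpq j
    simp only [hC, Function.update_self, Function.update_of_ne hpq, mul_assoc,
      ← Finset.mul_sum, this, mul_zero]
  simp only [h0, Finset.sum_const_zero] at h
  have hd' : (d : ℂ) ≠ 0 := by exact_mod_cast hd.ne'
  simpa [hd'] using h.symm

theorem IsSTFc.pull {H : Matrix (Fin d) (Fin d) ℂ} {A : Matrix (Fin d) (Fin d) ℂ}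
    {T : Tensor d n} (hT : IsSTFc (A * H * A.transpose) T) : IsSTFc H (pull A T) := by
  refine ⟨fun σ i => ?_, fun p q hpq i => ?_⟩
  · simp only [Multipole.pull]
    rw [← Equiv.sum_comp (Equiv.arrowCongr σ.symm (Equiv.refl (Fin d))) _]
    refine Finset.sum_congr rfl fun j _ => ?_
    have h1 : (Equiv.arrowCongr σ.symm (Equiv.refl (Fin d))) j = j ∘ σ := rfl
    rw [h1, hT.1]
    congr 1
    exact Equiv.prod_comp σ (fun k => A (j k) (i k))
  · have hprod : ∀ (j : Fin n → Fin d) (a b : Fin d),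
        ∏ k, A (j k) (Function.update (Function.update i p a) q b k)
          = A (j p) a * A (j q) b *
            ∏ k ∈ (Finset.univ.erase q).erase p, A (j k) (i k) := by
      intro j a b
      rw [← Finset.mul_prod_erase _ _ (Finset.mem_univ q),
        ← Finset.mul_prod_erase (Finset.univ.erase q) _
          (Finset.mem_erase.2 ⟨hpq, Finset.mem_univ p⟩)]
      simp only [Function.update_self, Function.update_of_ne hpq]
      rw [← mul_assoc, mul_comm (A (j q) b)]
      congr 1
      refine Finset.prod_congr rfl fun k hk => ?_
      simp only [Finset.mem_erase] at hk
      rw [Function.update_of_ne hk.2.1, Function.update_of_ne hk.1]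
    have hexp : ∑ a, ∑ b, H a b * Multipole.pull A T (Function.update (Function.update i p a) q b)
        = ∑ j : Fin n → Fin d, (∏ k ∈ (Finset.univ.erase q).erase p, A (j k) (i k))
            * (A * H * A.transpose) (j p) (j q) * T j := by
      simp only [Multipole.pull, hprod, Matrix.mul_apply, Matrix.transpose_apply,
        Finset.mul_sum, Finset.sum_mul]
      rw [Finset.sum_comm]
      conv_lhs => enter [2, b]; rw [Finset.sum_comm]
      rw [Finset.sum_comm]
      refine Finset.sum_congr rfl fun j _ => Finset.sum_congr rfl fun b _ =>
        Finset.sum_congr rfl fun a _ => by ring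
    rw [hexp]
    refine sum_trace_eq_zero hT hpq _ fun j a b => ?_
    refine Finset.prod_congr rfl fun k hk => ?_
    simp only [Finset.mem_erase] at hk
    rw [Function.update_of_ne hk.2.1, Function.update_of_ne hk.1]

theorem map_ofReal_mul (A B : Matrix (Fin d) (Fin d) ℝ) :
    (A * B).map Complex.ofReal = A.map Complex.ofReal * B.map Complex.ofReal :=
  Matrix.map_mul (f := Complex.ofRealHom)

theorem map_ofReal_one : (1 : Matrix (Fin d) (Fin d) ℝ).map Complex.ofReal = 1 := by
  ext i j
  by_cases h : i = j <;> simp [Matrix.one_apply, h]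

theorem inv_congruence {h A : Matrix (Fin d) (Fin d) ℝ} (hA : IsUnit A.det) :
    A * (A.transpose * h * A)⁻¹ * A.transpose = h⁻¹ := by
  have hAt : IsUnit A.transpose.det := by rwa [Matrix.det_transpose]
  rw [Matrix.mul_inv_rev, Matrix.mul_inv_rev, ← mul_assoc, Matrix.mul_nonsing_inv _ hA, one_mul,
    mul_assoc, Matrix.nonsing_inv_mul _ hAt, mul_one]

theorem inv_congruence_map {h A : Matrix (Fin d) (Fin d) ℝ} (hA : IsUnit A.det) :
    A.map Complex.ofReal * (A.transpose * h * A)⁻¹.map Complex.ofReal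
      * (A.map Complex.ofReal).transpose = h⁻¹.map Complex.ofReal := by
  rw [← inv_congruence (h := h) hA, map_ofReal_mul, map_ofReal_mul, Matrix.transpose_map]

theorem IsSTF.pull {h A : Matrix (Fin d) (Fin d) ℝ} (hA : IsUnit A.det) {T : Tensor d n}
    (hT : IsSTF h T) : IsSTF (A.transpose * h * A) (Multipole.pull (A.map Complex.ofReal) T) := by
  rw [isSTF_iff] at hT ⊢
  rw [← inv_congruence_map hA] at hT
  exact hT.pull

theorem fullContraction_pull {h A : Matrix (Fin d) (Fin d) ℝ} (hA : IsUnit A.det)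
    (S T : Tensor d n) :
    fullContraction (A.transpose * h * A) (pull (A.map Complex.ofReal) S)
      (pull (A.map Complex.ofReal) T) = fullContraction h S T := by
  rw [fullContraction_eq_bil, fullContraction_eq_bil, bil_pull_right, bil_pull_left,
    ← mul_assoc, inv_congruence_map hA]

theorem map_mul_map_inv {A : Matrix (Fin d) (Fin d) ℝ} (hA : IsUnit A.det) :
    A.map Complex.ofReal * A⁻¹.map Complex.ofReal = 1 := by
  rw [← map_ofReal_mul, Matrix.mul_nonsing_inv _ hA, map_ofReal_one]

theorem map_inv_mul_map {A : Matrix (Fin d) (Fin d) ℝ} (hA : IsUnit A.det) :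
    A⁻¹.map Complex.ofReal * A.map Complex.ofReal = 1 := by
  rw [← map_ofReal_mul, Matrix.nonsing_inv_mul _ hA, map_ofReal_one]

theorem congruence_inv_congruence {h A : Matrix (Fin d) (Fin d) ℝ} (hA : IsUnit A.det) :
    (A⁻¹).transpose * (A.transpose * h * A) * A⁻¹ = h := by
  have hAt : IsUnit A.transpose.det := by rwa [Matrix.det_transpose]
  rw [mul_assoc, Matrix.mul_nonsing_inv_cancel_right _ _ hA, Matrix.transpose_nonsing_inv,
    Matrix.nonsing_inv_mul_cancel_left _ _ hAt]

theorem IsSTFPart.pull {h A : Matrix (Fin d) (Fin d) ℝ} (hA : IsUnit A.det) {S T : Tensor d n}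
    (hS : IsSTFPart h T S) :
    IsSTFPart (A.transpose * h * A) (Multipole.pull (A.map Complex.ofReal) T)
      (Multipole.pull (A.map Complex.ofReal) S) := by
  refine ⟨hS.1.pull hA, fun W hW => ?_⟩
  have hA' : IsUnit (A⁻¹).det := by
    rw [Matrix.det_nonsing_inv]
    exact (Ring.inverse_unit hA.unit) ▸ (hA.unit⁻¹).isUnit
  have hW' := hW.pull hA'
  rw [congruence_inv_congruence hA] at hW'
  have := hS.2 _ hW'
  rw [← fullContraction_pull hA, pull_sub, pull_pull, map_inv_mul_map hA, pull_one] at this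
  exact this

/-! ### Existence and uniqueness of the symmetric trace-free part -/

theorem bil_one (S T : Tensor d n) : bil 1 S T = ∑ a, S a * T a := by
  refine Finset.sum_congr rfl fun a _ => ?_
  have h : ∀ b : Fin n → Fin d,
      (∏ k, (1 : Matrix (Fin d) (Fin d) ℂ) (a k) (b k)) = if a = b then 1 else 0 := by
    intro j
    split_ifs with hj
    · subst hj
      simp
    · obtain ⟨k, hk⟩ := Function.ne_iff.1 hj
      exact Finset.prod_eq_zero (Finset.mem_univ k) (Matrix.one_apply_ne hk)
  simp [h]

theorem fullContraction_one (S T : Tensor d n) :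
    fullContraction 1 S T = ∑ a, S a * T a := by
  rw [fullContraction_eq_bil, inv_one, map_ofReal_one, bil_one]

/-- The space of symmetric trace-free tensors of the Euclidean metric. -/
noncomputable def stfSubmodule (d n : ℕ) : Submodule ℂ (EuclideanSpace ℂ (Fin n → Fin d)) where
  carrier := {T | IsSTF 1 T.ofLp}
  zero_mem' := by
    refine ⟨fun σ i => rfl, fun p q _ i => ?_⟩
    simp
  add_mem' := by
    intro S T hS hT
    refine ⟨fun σ i => ?_, fun p q hpq i => ?_⟩
    · have h1 := hS.1 σ i
      have h2 := hT.1 σ i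
      simp only [WithLp.ofLp_add, Pi.add_apply, h1, h2]
    · have h1 := hS.2 p q hpq i
      have h2 := hT.2 p q hpq i
      simp only [WithLp.ofLp_add, Pi.add_apply, mul_add, Finset.sum_add_distrib, h1, h2, add_zero]
  smul_mem' := by
    intro c T hT
    refine ⟨fun σ i => ?_, fun p q hpq i => ?_⟩
    · have h1 := hT.1 σ i
      simp only [WithLp.ofLp_smul, Pi.smul_apply, h1]
    · have h1 := hT.2 p q hpq i
      simp only [WithLp.ofLp_smul, Pi.smul_apply, smul_eq_mul, mul_left_comm _ c,
        ← Finset.mul_sum, h1, mul_zero]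

/-- The metric is real. Consequently orthogonality for the bilinear contraction and for the
Hermitian inner product agree on symmetric trace-free tensors. -/
theorem IsSTF.conj {h : Matrix (Fin d) (Fin d) ℝ} {T : Tensor d n} (hT : IsSTF h T) :
    IsSTF h (fun i => (starRingEnd ℂ) (T i)) := by
  refine ⟨fun σ i => by simp only [hT.1 σ i], fun p q hpq i => ?_⟩
  have := congrArg (starRingEnd ℂ) (hT.2 p q hpq i)
  simpa [map_sum] using this

/-- The symmetric trace-free part for the Euclidean metric, as a linear map. -/
noncomputable def stfOne (d n : ℕ) : Tensor d n →ₗ[ℂ] Tensor d n :=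
  (WithLp.linearEquiv 2 ℂ (Tensor d n)).toLinearMap ∘ₗ
    ((stfSubmodule d n).starProjection : _ →ₗ[ℂ] _) ∘ₗ
      (WithLp.linearEquiv 2 ℂ (Tensor d n)).symm.toLinearMap

/-- The Hermitian projection is tested against the conjugate of `W`, which turns the inner product
into the bilinear contraction with `W`. -/
theorem isSTFPart_stfOne (T : Tensor d n) : IsSTFPart 1 T (stfOne d n T) := by
  refine ⟨(stfSubmodule d n).starProjection_apply_mem (WithLp.toLp 2 T), fun W hW => ?_⟩
  have h := (stfSubmodule d n).starProjection_inner_eq_zero (WithLp.toLp 2 T)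
    (WithLp.toLp 2 (fun i => (starRingEnd ℂ) (W i))) hW.conj
  rw [fullContraction_one]
  rw [← inner_conj_symm, map_eq_zero, PiLp.inner_apply] at h
  rw [← h]
  refine Finset.sum_congr rfl fun i _ => ?_
  simp [stfOne]

theorem IsSTFPart.unique_one {T S S' : Tensor d n} (hS : IsSTFPart 1 T S)
    (hS' : IsSTFPart 1 T S') : S = S' := by
  have hm : IsSTF 1 (S - S') :=
    (stfSubmodule d n).sub_mem (x := WithLp.toLp 2 S) (y := WithLp.toLp 2 S') hS.1 hS'.1
  have h1 := hS.2 _ hm.conj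
  have h2 := hS'.2 _ hm.conj
  rw [fullContraction_one] at h1 h2
  -- The two orthogonality relations, tested on the conjugate of `S - S'`, differ by the squared
  -- Hermitian norm of `S - S'`.
  have h3 : ∑ a, ((‖(S - S') a‖ ^ 2 : ℝ) : ℂ) = 0 := by
    rw [← sub_self (0 : ℂ)]
    nth_rewrite 1 [← h2]
    rw [← h1, ← Finset.sum_sub_distrib]
    refine Finset.sum_congr rfl fun a _ => ?_
    rw [← Complex.normSq_eq_norm_sq, Complex.normSq_eq_conj_mul_self]
    simp only [Pi.sub_apply]
    ring
  rw [← Complex.ofReal_sum, Complex.ofReal_eq_zero,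
    Finset.sum_eq_zero_iff_of_nonneg (fun _ _ => by positivity)] at h3
  funext a
  have := h3 a (Finset.mem_univ a)
  simpa [sub_eq_zero] using this

/-- A matrix whose columns are an orthonormal frame of the metric `h`. -/
def IsFrame (h B : Matrix (Fin d) (Fin d) ℝ) : Prop :=
  IsUnit B.det ∧ B.transpose * h * B = 1

theorem IsFrame.isSTFPart {h B : Matrix (Fin d) (Fin d) ℝ} (hB : IsFrame h B) (T : Tensor d n) :
    IsSTFPart h T (pull (B⁻¹.map Complex.ofReal) (stfOne d n (pull (B.map Complex.ofReal) T))) := by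
  have hB' : IsUnit (B⁻¹).det := by
    rw [Matrix.det_nonsing_inv]
    exact (Ring.inverse_unit hB.1.unit) ▸ (hB.1.unit⁻¹).isUnit
  have := (isSTFPart_stfOne (pull (B.map Complex.ofReal) T)).pull hB'
  rwa [pull_pull, map_mul_map_inv hB.1, pull_one, ← hB.2, congruence_inv_congruence hB.1] at this

theorem IsFrame.unique {h B : Matrix (Fin d) (Fin d) ℝ} (hB : IsFrame h B) {T S S' : Tensor d n}
    (hS : IsSTFPart h T S) (hS' : IsSTFPart h T S') : S = S' := by
  have h1 := hS.pull hB.1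
  have h2 := hS'.pull hB.1
  rw [hB.2] at h1 h2
  have h3 := congrArg (pull (B⁻¹.map Complex.ofReal)) (h1.unique_one h2)
  simpa only [pull_pull, map_mul_map_inv hB.1, pull_one] using h3

theorem IsFrame.isSTFPart_stfPart {h B : Matrix (Fin d) (Fin d) ℝ} (hB : IsFrame h B)
    (T : Tensor d n) : IsSTFPart h T (stfPart h T) := by
  have h : ∃ S, IsSTFPart h T S := ⟨_, hB.isSTFPart T⟩
  rw [stfPart, dif_pos h]
  exact h.choose_spec

/-- This replaces the chosen value of `stfPart` by an expression polynomial in the entries of the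
frame and of its inverse and linear in `T`, from which analyticity can be read off. -/
theorem IsFrame.stfPart_eq {h B : Matrix (Fin d) (Fin d) ℝ} (hB : IsFrame h B) (T : Tensor d n) :
    stfPart h T = pull (B⁻¹.map Complex.ofReal) (stfOne d n (pull (B.map Complex.ofReal) T)) :=
  hB.unique (hB.isSTFPart_stfPart T) (hB.isSTFPart T)

/-- `A⁻¹ B` is an orthonormal frame of the pulled-back metric, so both sides are symmetric
trace-free parts of the same tensor and uniqueness applies. -/
theorem IsFrame.stfPart_pull {h B A : Matrix (Fin d) (Fin d) ℝ} (hB : IsFrame h B)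
    (hA : IsUnit A.det) (T : Tensor d n) :
    stfPart (A.transpose * h * A) (pull (A.map Complex.ofReal) T)
      = pull (A.map Complex.ofReal) (stfPart h T) := by
  have hA' : IsUnit (A⁻¹).det := by
    rw [Matrix.det_nonsing_inv]
    exact (Ring.inverse_unit hA.unit) ▸ (hA.unit⁻¹).isUnit
  have hF : IsFrame (A.transpose * h * A) (A⁻¹ * B) := by
    refine ⟨by rw [Matrix.det_mul]; exact hA'.mul hB.1, ?_⟩
    rw [Matrix.transpose_mul, ← mul_assoc, mul_assoc B.transpose, mul_assoc B.transpose,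
      congruence_inv_congruence hA, hB.2]
  exact hF.unique (hF.isSTFPart_stfPart _) ((hB.isSTFPart_stfPart T).pull hA)

/-! ### Contraction with a null vector -/

/-- The contraction `T_{a₁…aₙ} η^{a₁} ⋯ η^{aₙ}`. -/
noncomputable def evalDiag (η : Fin d → ℂ) (T : Tensor d n) : ℂ :=
  ∑ i : Fin n → Fin d, (∏ k, η (i k)) * T i

/-- Lower the index of `η` to get `low`. Since `η` is null, `low ⊗ ⋯ ⊗ low` is symmetric and
trace-free, hence an admissible test tensor. The full contraction of any `X` with it is the
evaluation of `X` on `η`, so `T - S` evaluates to zero. -/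
theorem IsSTFPart.evalDiag_eq {h : Matrix (Fin d) (Fin d) ℝ} (hdet : IsUnit h.det)
    {η : Fin d → ℂ} (hη : ∑ a, ∑ b, (h a b : ℂ) * η a * η b = 0)
    {S T : Tensor d n} (hS : IsSTFPart h T S) : evalDiag η S = evalDiag η T := by
  set low : Fin d → ℂ := fun b => ∑ c, (h b c : ℂ) * η c with hlow
  have hraise : ∀ a, ∑ b, (h⁻¹ a b : ℂ) * low b = η a := by
    intro a
    have h1 : (h⁻¹.map Complex.ofReal).mulVec ((h.map Complex.ofReal).mulVec η) = η := by
      rw [Matrix.mulVec_mulVec, map_inv_mul_map hdet, Matrix.one_mulVec]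
    exact congrFun h1 a
  have hW : IsSTF h (fun b : Fin n → Fin d => ∏ k, low (b k)) := by
    refine ⟨fun σ i => ?_, fun p q hpq i => ?_⟩
    · exact Equiv.prod_comp σ (fun k => low (i k))
    · have hprod : ∀ a b : Fin d,
          ∏ k, low (Function.update (Function.update i p a) q b k)
            = low a * low b * ∏ k ∈ (Finset.univ.erase q).erase p, low (i k) := by
        intro a b
        rw [← Finset.mul_prod_erase _ _ (Finset.mem_univ q),
          ← Finset.mul_prod_erase (Finset.univ.erase q) _
            (Finset.mem_erase.2 ⟨hpq, Finset.mem_univ p⟩)]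
        simp only [Function.update_self, Function.update_of_ne hpq]
        rw [← mul_assoc, mul_comm (low b)]
        congr 1
        refine Finset.prod_congr rfl fun k hk => ?_
        simp only [Finset.mem_erase] at hk
        rw [Function.update_of_ne hk.2.1, Function.update_of_ne hk.1]
      have h2 : ∑ a, ∑ b, (h⁻¹ a b : ℂ) * (low a * low b) = 0 := by
        have h3 : ∀ a, ∑ b, (h⁻¹ a b : ℂ) * (low a * low b) = low a * η a := by
          intro a
          rw [← hraise a, Finset.mul_sum]
          exact Finset.sum_congr rfl fun b _ => by ring
        rw [← hη, Finset.sum_congr rfl fun a _ => h3 a]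
        refine Finset.sum_congr rfl fun a _ => ?_
        rw [hlow, Finset.sum_mul]
        exact Finset.sum_congr rfl fun b _ => by ring
      simp only [hprod, ← mul_assoc, ← Finset.sum_mul]
      simp only [← mul_assoc] at h2
      rw [h2, zero_mul]
  have h4 := hS.2 _ hW
  have h5 : ∀ X : Tensor d n,
      fullContraction h X (fun b : Fin n → Fin d => ∏ k, low (b k)) = evalDiag η X := by
    intro X
    refine Finset.sum_congr rfl fun a _ => ?_
    simp only [← hraise, Finset.prod_univ_sum, Fintype.piFinset_univ, Finset.prod_mul_distrib,
      Finset.sum_mul]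
    exact Finset.sum_congr rfl fun b _ => by ring
  rw [h5] at h4
  simp only [evalDiag, Pi.sub_apply, mul_sub, Finset.sum_sub_distrib, sub_eq_zero] at h4
  exact h4.symm

end Pull

/-! ### Axisymmetric symmetric trace-free tensors -/

section Axisymmetric

variable {n : ℕ}

/-- The null vector `∂_z - i ∂_x`. -/
noncomputable def nullDir : Fin 3 → ℂ := ![-Complex.I, 0, 1]

/-- The columns are the frame `∂_x + i ∂_y`, `∂_x - i ∂_y`, `∂_z`. -/
noncomputable def spinFrame : Matrix (Fin 3) (Fin 3) ℂ :=
  !![1, 1, 0; Complex.I, -Complex.I, 0; 0, 0, 1]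

/-- The inverse of `spinFrame`. -/
noncomputable def spinCoframe : Matrix (Fin 3) (Fin 3) ℂ :=
  !![1 / 2, -Complex.I / 2, 0; 1 / 2, Complex.I / 2, 0; 0, 0, 1]

/-- The inverse metric in the frame `spinFrame`. -/
noncomputable def spinMetric : Matrix (Fin 3) (Fin 3) ℂ :=
  !![0, 1 / 2, 0; 1 / 2, 0, 0; 0, 0, 1]

theorem spinFrame_mul_spinCoframe : spinFrame * spinCoframe = 1 := by
  ext i j
  fin_cases i <;> fin_cases j <;>
    simp [spinFrame, spinCoframe, Matrix.mul_apply, Fin.sum_univ_three] <;> ring_nf <;> simp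

theorem spinFrame_spinMetric : spinFrame * spinMetric * spinFrame.transpose = 1 := by
  ext i j
  fin_cases i <;> fin_cases j <;>
    simp [spinFrame, spinMetric, Matrix.mul_apply, Fin.sum_univ_three, Matrix.transpose_apply] <;>
    ring_nf <;> simp

/-- The frame diagonalises all rotations at once: its columns are eigenvectors of weights `-1`, `1`
and `0`. -/
theorem rotation_mul_spinFrame (α : ℝ) :
    (rotation α).map Complex.ofReal * spinFrame = spinFrame *
      Matrix.diagonal ![Complex.exp (-(α * Complex.I)), Complex.exp (α * Complex.I), 1] := by
  have h1 : Complex.exp (α * Complex.I) = Real.cos α + Real.sin α * Complex.I := by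
    rw [Complex.exp_mul_I, Complex.ofReal_cos, Complex.ofReal_sin]
  have h2 : Complex.exp (-(α * Complex.I)) = Real.cos α - Real.sin α * Complex.I := by
    rw [← neg_mul, Complex.exp_mul_I, Complex.cos_neg, Complex.sin_neg, Complex.ofReal_cos,
      Complex.ofReal_sin]
    ring
  rw [h1, h2]
  ext i j
  rw [Matrix.mul_diagonal]
  fin_cases i <;> fin_cases j <;>
    simp [spinFrame, rotation, Matrix.mul_apply, Fin.sum_univ_three] <;> ring_nf <;>
    simp

theorem rotation_mul_transpose (α : ℝ) : (rotation α).transpose * rotation α = 1 := by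
  have h := Real.sin_sq_add_cos_sq α
  ext i j
  fin_cases i <;> fin_cases j <;>
    simp [rotation, Matrix.mul_apply, Fin.sum_univ_three, Matrix.transpose_apply] <;>
    linarith

theorem isUnit_det_rotation (α : ℝ) : IsUnit (rotation α).det := by
  have h := congrArg Matrix.det (rotation_mul_transpose α)
  rw [Matrix.det_mul, Matrix.det_one] at h
  exact IsUnit.of_mul_eq_one_right _ h

theorem pull_diagonal (D : Fin 3 → ℂ) (T : Tensor 3 n) (i : Fin n → Fin 3) :
    pull (Matrix.diagonal D) T i = (∏ k, D (i k)) * T i := by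
  rw [pull, Finset.sum_eq_single i]
  · simp
  · intro j _ hj
    obtain ⟨k, hk⟩ := Function.ne_iff.1 hj
    have h : ∏ k, Matrix.diagonal D (j k) (i k) = 0 :=
      Finset.prod_eq_zero (Finset.mem_univ k) (Matrix.diagonal_apply_ne _ hk)
    rw [h, zero_mul]
  · simp

theorem prod_spin (i : Fin n → Fin 3) (u : ℂ) :
    ∏ k, (![Complex.exp (-u), Complex.exp u, 1] : Fin 3 → ℂ) (i k)
      = Complex.exp (u * ((Finset.univ.filter fun k => i k = 1).card
          - (Finset.univ.filter fun k => i k = 0).card)) := by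
  have h : ∀ a : Fin 3, (![Complex.exp (-u), Complex.exp u, 1] : Fin 3 → ℂ) a
      = Complex.exp (u * ((if a = 1 then 1 else 0) - (if a = 0 then 1 else 0))) := by
    intro a
    fin_cases a <;> simp
  simp only [h, ← Complex.exp_sum, ← Finset.mul_sum, Finset.sum_sub_distrib, Finset.sum_boole]

theorem eq_zero_of_spin_ne {T : Tensor 3 n}
    (hT : ∀ α : ℝ, pull (Matrix.diagonal
      ![Complex.exp (-(α * Complex.I)), Complex.exp (α * Complex.I), 1]) T = T)
    (i : Fin n → Fin 3)
    (hi : (Finset.univ.filter fun k => i k = 1).card ≠ (Finset.univ.filter fun k => i k = 0).card) :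
    T i = 0 := by
  set a := (Finset.univ.filter fun k => i k = 1).card with ha
  set b := (Finset.univ.filter fun k => i k = 0).card with hb
  have hab : ((a : ℂ) - b) ≠ 0 := by
    rw [sub_ne_zero]
    exact_mod_cast hi
  -- Rotation by `α` multiplies this component by `e^{iα(a - b)}`. The angle is chosen so that the
  -- factor is `-1`, which forces the component to vanish.
  have h := congrFun (hT (Real.pi / ((a : ℝ) - b))) i
  rw [pull_diagonal, prod_spin, ← ha, ← hb] at h
  have he : ((Real.pi / ((a : ℝ) - b) : ℝ) : ℂ) * Complex.I * ((a : ℂ) - b)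
      = Real.pi * Complex.I := by
    push_cast
    field_simp
  rw [he, Complex.exp_pi_mul_I] at h
  have h2 : (2 : ℂ) * T i = 0 := by linear_combination -h
  simpa using h2

/-- In this frame the inverse metric pairs the index `0` with `1` and `2` with itself. The two mixed
terms, each of weight `1/2`, are equal by symmetry, so a pair `(0, 1)` can be traded for `(2, 2)` at
the cost of a sign. -/
theorem spin_trace {T : Tensor 3 n} (hT : IsSTFc spinMetric T) {p q : Fin n} (hpq : p ≠ q)
    {i : Fin n → Fin 3} (hp : i p = 0) (hq : i q = 1) :
    T i = -T (Function.update (Function.update i p 2) q 2) := by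
  have h := hT.2 p q hpq i
  simp [Fin.sum_univ_three, spinMetric] at h
  have h1 : Function.update (Function.update i p 0) q 1 = i := by
    rw [← hp, ← hq, Function.update_eq_self, Function.update_eq_self]
  have h2 : Function.update (Function.update i p 1) q 0 = i ∘ Equiv.swap p q := by
    funext k
    rcases eq_or_ne k q with rfl | hkq
    · simp [hp]
    rcases eq_or_ne k p with rfl | hkp
    · simp [hq, hkq]
    · simp [hkq, hkp, Equiv.swap_apply_of_ne_of_ne]
  rw [h1, h2, hT.1] at h
  linear_combination h

/-- Rotation invariance leaves only components with as many indices `0` as `1`. Trading such pairs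
for `(2, 2)` by the trace condition reduces every one of them, by induction on the number of zeros,
to the component along the axis. -/
theorem eq_zero_of_axisymmetric_spin {T : Tensor 3 n} (hT : IsSTFc spinMetric T)
    (hrot : ∀ α : ℝ, pull (Matrix.diagonal
      ![Complex.exp (-(α * Complex.I)), Complex.exp (α * Complex.I), 1]) T = T)
    (hz : T (fun _ => 2) = 0) : T = 0 := by
  have key : ∀ (m : ℕ) (i : Fin n → Fin 3),
      (Finset.univ.filter fun k => i k = 0).card = m → T i = 0 := by
    intro m
    induction m with
    | zero =>
      intro i hi
      by_cases h1 : (Finset.univ.filter fun k => i k = 1).card = 0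
      · rw [Finset.card_eq_zero, Finset.filter_eq_empty_iff] at hi h1
        have : i = fun _ => 2 := by
          funext k
          have h2 := hi (Finset.mem_univ k)
          have h3 := h1 (Finset.mem_univ k)
          generalize i k = a at h2 h3
          fin_cases a <;> simp_all
        rw [this, hz]
      · exact eq_zero_of_spin_ne hrot i (by rw [hi]; exact h1)
    | succ m ih =>
      intro i hi
      by_cases h1 : (Finset.univ.filter fun k => i k = 1).card = m + 1
      · obtain ⟨p, hp⟩ := Finset.card_pos.1 (by rw [hi]; omega :
          0 < (Finset.univ.filter fun k => i k = 0).card)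
        obtain ⟨q, hq⟩ := Finset.card_pos.1 (by rw [h1]; omega :
          0 < (Finset.univ.filter fun k => i k = 1).card)
        have hp' : i p = 0 := by simpa using hp
        have hq' : i q = 1 := by simpa using hq
        have hpq : p ≠ q := by
          rintro rfl
          rw [hp'] at hq'
          exact absurd hq' (by decide)
        rw [spin_trace hT hpq hp' hq', ih, neg_zero]
        have : (Finset.univ.filter fun k => Function.update (Function.update i p 2) q 2 k = 0)
            = (Finset.univ.filter fun k => i k = 0).erase p := by
          ext k
          rcases eq_or_ne k q with rfl | hkq
          · simp [hq']
          rcases eq_or_ne k p with rfl | hkp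
          · simp [hkq]
          · simp [hkq, hkp]
        rw [this, Finset.card_erase_of_mem hp, hi]
        rfl
      · exact eq_zero_of_spin_ne hrot i (by rw [hi]; exact h1)
  funext i
  exact key _ i rfl

theorem pull_spinFrame_eq_zero {T : Tensor 3 n} (h : pull spinFrame T = 0) : T = 0 := by
  have h1 := congrArg (pull spinCoframe) h
  rw [pull_pull, spinFrame_mul_spinCoframe, pull_one] at h1
  rw [h1]
  funext i
  simp [pull]

theorem axisymmetric_stf_eq_zero {T : Tensor 3 n} (hT : IsSTF 1 T)
    (hrot : ∀ α : ℝ, pull ((rotation α).map Complex.ofReal) T = T)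
    (hz : pull spinFrame T (fun _ => 2) = 0) : T = 0 := by
  refine pull_spinFrame_eq_zero (eq_zero_of_axisymmetric_spin ?_ (fun α => ?_) hz)
  · rw [isSTF_iff, inv_one, map_ofReal_one, ← spinFrame_spinMetric] at hT
    exact hT.pull
  · rw [pull_pull, ← rotation_mul_spinFrame, ← pull_pull, hrot]

/-- Axisymmetric symmetric trace-free tensors are proportional to each other. -/
theorem axisymmetric_stf_eq_smul {P E : Tensor 3 n} (hP : IsSTF 1 P) (hE : IsSTF 1 E)
    (hProt : ∀ α : ℝ, pull ((rotation α).map Complex.ofReal) P = P)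
    (hErot : ∀ α : ℝ, pull ((rotation α).map Complex.ofReal) E = E)
    (hE1 : evalDiag nullDir E = 1) : P = evalDiag nullDir P • E := by
  -- If the axis component of `E` vanished, then `E = 0`, contrary to its normalisation on
  -- `nullDir`. It can therefore serve as a denominator.
  have hz : pull spinFrame E (fun _ => 2) ≠ 0 := by
    intro h
    rw [axisymmetric_stf_eq_zero hE hErot h] at hE1
    simp [evalDiag] at hE1
  set c := pull spinFrame P (fun _ => 2) / pull spinFrame E (fun _ => 2) with hc
  have hPc : P = c • E := by
    rw [← sub_eq_zero]
    refine axisymmetric_stf_eq_zero ?_ (fun α => ?_) ?_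
    · exact (stfSubmodule 3 n).sub_mem (x := WithLp.toLp 2 P) (y := WithLp.toLp 2 (c • E)) hP
        ((stfSubmodule 3 n).smul_mem c (x := WithLp.toLp 2 E) hE)
    · rw [pull_sub, pull_smul, hProt, hErot]
    · rw [pull_sub, pull_smul, Pi.sub_apply, Pi.smul_apply, smul_eq_mul, hc, div_mul_cancel₀ _ hz,
        sub_self]
  have hcP : evalDiag nullDir P = c := by
    rw [hPc]
    have : evalDiag nullDir (c • E) = c * evalDiag nullDir E := by
      simp only [evalDiag, Finset.mul_sum, Pi.smul_apply, smul_eq_mul]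
      exact Finset.sum_congr rfl fun _ _ => by ring
    rw [this, hE1, mul_one]
  rw [hcP]
  exact hPc

theorem isFrame_one : IsFrame (1 : Matrix (Fin 3) (Fin 3) ℝ) 1 := by
  refine ⟨by simp, by simp⟩

theorem pull_rotation_axisPower (α : ℝ) :
    pull ((rotation α).map Complex.ofReal) (axisPower n) = axisPower n := by
  funext i
  have h : ∀ a : Fin 3, ∑ b : Fin 3, (rotation α).map Complex.ofReal b a *
      (if b = 2 then (1 : ℂ) else 0) = if a = 2 then 1 else 0 := by
    intro a
    fin_cases a <;> simp [rotation]
  have h2 : axisPower n i = ∏ k, ∑ b : Fin 3, (rotation α).map Complex.ofReal b (i k) *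
      (if b = 2 then (1 : ℂ) else 0) := Finset.prod_congr rfl fun k _ => (h (i k)).symm
  rw [h2, Finset.prod_univ_sum, Fintype.piFinset_univ]
  simp only [pull, axisPower, ← Finset.prod_mul_distrib]

theorem pull_rotation_stfPart_axisPower (α : ℝ) :
    pull ((rotation α).map Complex.ofReal) (stfPart 1 (axisPower n)) = stfPart 1 (axisPower n) := by
  rw [← isFrame_one.stfPart_pull (isUnit_det_rotation α), mul_one, rotation_mul_transpose,
    pull_rotation_axisPower]

theorem evalDiag_nullDir_axisPower : evalDiag nullDir (axisPower n) = 1 := by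
  have h : ∑ b : Fin 3, nullDir b * (if b = 2 then (1 : ℂ) else 0) = 1 := by
    simp [nullDir]
  simp only [evalDiag, axisPower, ← Finset.prod_mul_distrib]
  rw [← Fintype.piFinset_univ, ← Finset.prod_univ_sum (fun _ => Finset.univ)
    (fun (_ : Fin n) b => nullDir b * (if b = 2 then (1 : ℂ) else 0))]
  rw [h, Finset.prod_const_one]

theorem evalDiag_nullDir_stfPart_axisPower :
    evalDiag nullDir (stfPart 1 (axisPower n)) = 1 := by
  rw [(isFrame_one.isSTFPart_stfPart (axisPower n)).evalDiag_eq (by simp),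
    evalDiag_nullDir_axisPower]
  simp [Fin.sum_univ_three, nullDir, Matrix.one_apply]

/-- The moment is read off by contracting with the null vector. -/
theorem eq_smul_stfPart_axisPower_iff {P : Tensor 3 n} (hP : IsSTF 1 P)
    (hrot : ∀ α : ℝ, pull ((rotation α).map Complex.ofReal) P = P) (m : ℂ) :
    P = m • stfPart 1 (axisPower n) ↔ m = evalDiag nullDir P := by
  have hE := evalDiag_nullDir_stfPart_axisPower (n := n)
  have hPE := axisymmetric_stf_eq_smul hP (isFrame_one.isSTFPart_stfPart (axisPower n)).1 hrot
    pull_rotation_stfPart_axisPower hE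
  constructor
  · intro h
    rw [h]
    simp only [evalDiag, Pi.smul_apply, smul_eq_mul, mul_left_comm _ m, ← Finset.mul_sum]
    rw [← evalDiag, hE, mul_one]
  · rintro rfl
    exact hPE

end Axisymmetric

/-! ### Complexification of real analytic functions of two variables -/

section Complexification

/-- The coordinates of `ℂ × ℂ`. -/
noncomputable def coordCLM : Bool → (ℂ × ℂ →L[ℂ] ℂ)
  | false => ContinuousLinearMap.fst ℂ ℂ ℂ
  | true => ContinuousLinearMap.snd ℂ ℂ ℂ

/-- The standard basis of `ℝ × ℝ`. -/
def realBasis : Bool → ℝ × ℝ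
  | false => (1, 0)
  | true => (0, 1)

/-- The complex multilinear series with the same coefficients as a real one. -/
noncomputable def complexifySeries (p : FormalMultilinearSeries ℝ (ℝ × ℝ) ℂ) :
    FormalMultilinearSeries ℂ (ℂ × ℂ) ℂ := fun n =>
  ∑ s : Fin n → Bool, p n (fun k => realBasis (s k)) •
    (ContinuousMultilinearMap.mkPiAlgebra ℂ (Fin n) ℂ).compContinuousLinearMap
      (fun k => coordCLM (s k))

theorem norm_coordCLM_le (b : Bool) : ‖coordCLM b‖ ≤ 1 := by
  cases b
  · exact ContinuousLinearMap.norm_fst_le ..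
  · exact ContinuousLinearMap.norm_snd_le ..

theorem norm_realBasis (b : Bool) : ‖realBasis b‖ = 1 := by
  cases b <;> simp [realBasis, Prod.norm_def]

theorem norm_complexifySeries_le (p : FormalMultilinearSeries ℝ (ℝ × ℝ) ℂ) (n : ℕ) :
    ‖complexifySeries p n‖ ≤ 2 ^ n * ‖p n‖ := by
  have h : ∀ s : Fin n → Bool, ‖p n (fun k => realBasis (s k)) •
      (ContinuousMultilinearMap.mkPiAlgebra ℂ (Fin n) ℂ).compContinuousLinearMap
        (fun k => coordCLM (s k))‖ ≤ ‖p n‖ := by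
    intro s
    rw [norm_smul]
    have h1 : ‖p n (fun k => realBasis (s k))‖ ≤ ‖p n‖ := by
      simpa [norm_realBasis] using (p n).le_opNorm (fun k => realBasis (s k))
    have h2 : ‖(ContinuousMultilinearMap.mkPiAlgebra ℂ (Fin n) ℂ).compContinuousLinearMap
        (fun k => coordCLM (s k))‖ ≤ 1 := by
      refine (ContinuousMultilinearMap.norm_compContinuousLinearMap_le _ _).trans ?_
      rw [ContinuousMultilinearMap.norm_mkPiAlgebra, one_mul]
      exact Finset.prod_le_one (fun _ _ => norm_nonneg _) (fun k _ => norm_coordCLM_le _)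
    calc _ ≤ ‖p n‖ * 1 := mul_le_mul h1 h2 (norm_nonneg _) (norm_nonneg _)
      _ = ‖p n‖ := mul_one _
  refine (norm_sum_le_of_le _ (fun s _ => h s)).trans ?_
  simp

/-- The `2 ^ n` words in two basis vectors enlarge the `n`-th norm by at most `2 ^ n`. This costs no
more than half of the radius. -/
theorem complexifySeries_radius_pos {p : FormalMultilinearSeries ℝ (ℝ × ℝ) ℂ}
    (hp : 0 < p.radius) : 0 < (complexifySeries p).radius := by
  obtain ⟨r, hr0, hr⟩ := ENNReal.lt_iff_exists_nnreal_btwn.1 hp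
  obtain ⟨C, -, hC⟩ := p.norm_mul_pow_le_of_lt_radius hr
  have hr0' : 0 < r := by exact_mod_cast hr0
  have h := (complexifySeries p).le_radius_of_bound C (r := r / 2) fun n => by
    refine le_trans ?_ (hC n)
    calc ‖complexifySeries p n‖ * ((r / 2 : NNReal) : ℝ) ^ n
        ≤ 2 ^ n * ‖p n‖ * ((r / 2 : NNReal) : ℝ) ^ n := by
          gcongr
          exact norm_complexifySeries_le p n
      _ = ‖p n‖ * (r : ℝ) ^ n := by
          push_cast
          rw [div_pow]
          field_simp
  refine lt_of_lt_of_le ?_ h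
  exact_mod_cast half_pos hr0'

theorem complexifySeries_apply_ofReal (p : FormalMultilinearSeries ℝ (ℝ × ℝ) ℂ) (n : ℕ)
    (v : ℝ × ℝ) :
    complexifySeries p n (fun _ => ((v.1 : ℂ), (v.2 : ℂ))) = p n (fun _ => v) := by
  have hv : v = ∑ b : Bool, (if b then v.2 else v.1) • realBasis b := by
    simp [realBasis]
  have h2 : p n (fun _ => v) = ∑ s : Fin n → Bool,
      p n (fun k => (if s k then v.2 else v.1) • realBasis (s k)) := by
    conv_lhs => rw [hv]
    exact (p n).map_sum (fun (_ : Fin n) (b : Bool) => (if b then v.2 else v.1) • realBasis b)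
  rw [h2, complexifySeries, sum_apply]
  refine Finset.sum_congr rfl fun s _ => ?_
  rw [ContinuousMultilinearMap.map_smul_univ]
  simp only [smul_apply,
    ContinuousMultilinearMap.compContinuousLinearMap_apply,
    ContinuousMultilinearMap.mkPiAlgebra_apply, smul_eq_mul, Complex.real_smul, Complex.ofReal_prod]
  rw [mul_comm]
  congr 1
  refine Finset.prod_congr rfl fun k _ => ?_
  cases s k <;> simp [coordCLM]

theorem exists_isComplexExtension {g : ℝ × ℝ → ℂ} (hg : AnalyticAt ℝ g 0) :
    ∃ G, IsComplexExtension g G := by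
  obtain ⟨p, hp⟩ := hg
  have hq := (complexifySeries p).hasFPowerSeriesOnBall (complexifySeries_radius_pos hp.radius_pos)
  refine ⟨(complexifySeries p).sum, hq.analyticAt, ?_⟩
  filter_upwards [hp.eventually_hasSum] with v hv
  rw [zero_add] at hv
  rw [← hv.tsum_eq]
  exact tsum_congr fun n => complexifySeries_apply_ofReal p n v

theorem eqOn_zero_of_real {f : ℂ → ℂ} {ε : ℝ} (hf : DifferentiableOn ℂ f (Metric.ball 0 ε))
    (h0 : ∀ x : ℝ, (x : ℂ) ∈ Metric.ball (0 : ℂ) ε → f x = 0) :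
    ∀ z ∈ Metric.ball (0 : ℂ) ε, f z = 0 := by
  intro z hz
  have hε : 0 < ε := Metric.pos_of_mem_ball hz
  have han := hf.analyticOnNhd Metric.isOpen_ball
  refine han.eqOn_zero_of_preconnected_of_frequently_eq_zero (z₀ := 0)
    (convex_ball _ _).isPreconnected (Metric.mem_ball_self hε) ?_ hz
  have ht : Tendsto (fun x : ℝ => (x : ℂ)) (𝓝[≠] 0) (𝓝[≠] 0) := by
    refine tendsto_nhdsWithin_iff.2 ⟨?_, ?_⟩
    · exact (Complex.continuous_ofReal.tendsto' 0 0 (by simp)).mono_left nhdsWithin_le_nhds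
    · filter_upwards [self_mem_nhdsWithin] with x hx
      simpa using hx
  refine ht.frequently (Eventually.frequently ?_)
  have h1 : ∀ᶠ x : ℝ in 𝓝[≠] 0, (x : ℂ) ∈ Metric.ball (0 : ℂ) ε :=
    (ht.mono_right nhdsWithin_le_nhds).eventually (Metric.ball_mem_nhds _ hε)
  filter_upwards [h1] with x hx using h0 x hx

/-- A separately holomorphic function that vanishes at the real points vanishes. -/
theorem eq_zero_of_real_prod {D : ℂ × ℂ → ℂ} {ε : ℝ}
    (h1 : ∀ w ∈ Metric.ball (0 : ℂ) ε, DifferentiableOn ℂ (fun z => D (z, w)) (Metric.ball 0 ε))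
    (h2 : ∀ z ∈ Metric.ball (0 : ℂ) ε, DifferentiableOn ℂ (fun w => D (z, w)) (Metric.ball 0 ε))
    (h0 : ∀ x y : ℝ, (x : ℂ) ∈ Metric.ball (0 : ℂ) ε → (y : ℂ) ∈ Metric.ball (0 : ℂ) ε →
      D (x, y) = 0) {z w : ℂ} (hz : z ∈ Metric.ball (0 : ℂ) ε) (hw : w ∈ Metric.ball (0 : ℂ) ε) :
    D (z, w) = 0 := by
  refine eqOn_zero_of_real (h2 z hz) (fun y hy => ?_) w hw
  exact eqOn_zero_of_real (h1 y hy) (fun x hx => h0 x y hx hy) z hz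

theorem exists_ball_of_analyticAt {G : ℂ × ℂ → ℂ} (hG : AnalyticAt ℂ G 0) {P : ℝ × ℝ → Prop}
    (hP : ∀ᶠ p in 𝓝 (0 : ℝ × ℝ), P p) : ∃ ε > 0,
      (∀ z ∈ Metric.ball (0 : ℂ) ε, ∀ w ∈ Metric.ball (0 : ℂ) ε, DifferentiableAt ℂ G (z, w)) ∧
      (∀ x y : ℝ, (x : ℂ) ∈ Metric.ball (0 : ℂ) ε → (y : ℂ) ∈ Metric.ball (0 : ℂ) ε →
        P (x, y)) := by
  obtain ⟨ε₁, hε₁, h1⟩ := Metric.eventually_nhds_iff_ball.1 hG.eventually_analyticAt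
  obtain ⟨ε₂, hε₂, h2⟩ := Metric.eventually_nhds_iff_ball.1 hP
  refine ⟨min ε₁ ε₂, lt_min hε₁ hε₂, fun z hz w hw => ?_, fun x y hx hy => ?_⟩
  · refine (h1 (z, w) ?_).differentiableAt
    simp only [mem_ball_zero_iff, Prod.norm_def, lt_min_iff, sup_lt_iff] at hz hw ⊢
    exact ⟨hz.1, hw.1⟩
  · refine h2 (x, y) ?_
    simp only [mem_ball_zero_iff, Prod.norm_def, lt_min_iff, sup_lt_iff, Complex.norm_real]
      at hx hy ⊢
    exact ⟨hx.2, hy.2⟩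

theorem eventually_mem_ball_prod {ε : ℝ} (hε : 0 < ε) :
    ∀ᶠ q : ℂ × ℂ in 𝓝 0, q.1 ∈ Metric.ball (0 : ℂ) ε ∧ q.2 ∈ Metric.ball (0 : ℂ) ε := by
  filter_upwards [Metric.ball_mem_nhds (0 : ℂ × ℂ) hε] with q hq
  simpa [mem_ball_zero_iff, Prod.norm_def] using hq

theorem IsComplexExtension.eventuallyEq {g : ℝ × ℝ → ℂ} {G G' : ℂ × ℂ → ℂ}
    (h : IsComplexExtension g G) (h' : IsComplexExtension g G') : G =ᶠ[𝓝 0] G' := by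
  obtain ⟨ε, hε, hd, hz⟩ := exists_ball_of_analyticAt (h.1.sub h'.1)
    (h.2.and h'.2)
  filter_upwards [eventually_mem_ball_prod hε] with q hq
  have h3 := eq_zero_of_real_prod (D := G - G') (ε := ε)
    (fun w hw z hz => ((hd z hz w hw).comp z (by fun_prop :
      DifferentiableAt ℂ (fun z => (z, w)) z)).differentiableWithinAt)
    (fun z hz w hw => ((hd z hz w hw).comp w (by fun_prop :
      DifferentiableAt ℂ (fun w => (z, w)) w)).differentiableWithinAt)
    (fun x y hx hy => by
      have := hz x y hx hy
      simp [this.1, this.2]) hq.1 hq.2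
  simpa [sub_eq_zero] using h3

end Complexification

/-! ### Leading order functions -/

section Lead

/-- `ℓ` agrees near `0` with the leading order function `r ↦ g(r, -i r)` of `g`. -/
def IsLead (g : ℝ × ℝ → ℂ) (ℓ : ℝ → ℂ) : Prop :=
  ∃ G, IsComplexExtension g G ∧ ∀ᶠ r in 𝓝 (0 : ℝ), ℓ r = G ((r : ℂ), -Complex.I * (r : ℂ))

theorem tendsto_nullLine :
    Tendsto (fun r : ℝ => ((r : ℂ), -Complex.I * (r : ℂ))) (𝓝 0) (𝓝 (0 : ℂ × ℂ)) := by
  have : Continuous (fun r : ℝ => ((r : ℂ), -Complex.I * (r : ℂ))) := by fun_prop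
  exact this.tendsto' 0 0 (by simp)

theorem IsLead.unique {g : ℝ × ℝ → ℂ} {ℓ ℓ' : ℝ → ℂ} (h : IsLead g ℓ) (h' : IsLead g ℓ') :
    ℓ =ᶠ[𝓝 0] ℓ' := by
  obtain ⟨G, hG, hl⟩ := h
  obtain ⟨G', hG', hl'⟩ := h'
  filter_upwards [hl, hl', tendsto_nullLine.eventually (hG.eventuallyEq hG')] with r h1 h2 h3
  rw [h1, h2, h3]

theorem isLead_leadingOrder {g : ℝ × ℝ → ℂ} (hg : AnalyticAt ℝ g 0) :
    IsLead g (leadingOrder g) := by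
  have h := exists_isComplexExtension hg
  refine ⟨h.choose, h.choose_spec, Eventually.of_forall fun r => ?_⟩
  rw [leadingOrder, dif_pos h]

theorem IsLead.congr_left {g g' : ℝ × ℝ → ℂ} {ℓ : ℝ → ℂ} (h : IsLead g ℓ) (hg : g =ᶠ[𝓝 0] g') :
    IsLead g' ℓ := by
  obtain ⟨G, hG, hl⟩ := h
  refine ⟨G, ⟨hG.1, ?_⟩, hl⟩
  filter_upwards [hG.2, hg] with p h1 h2
  rw [h1, h2]

theorem IsLead.add {g g' : ℝ × ℝ → ℂ} {ℓ ℓ' : ℝ → ℂ} (h : IsLead g ℓ) (h' : IsLead g' ℓ') :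
    IsLead (fun p => g p + g' p) (fun r => ℓ r + ℓ' r) := by
  obtain ⟨G, hG, hl⟩ := h
  obtain ⟨G', hG', hl'⟩ := h'
  refine ⟨fun p => G p + G' p, ⟨hG.1.add hG'.1, ?_⟩, ?_⟩
  · filter_upwards [hG.2, hG'.2] with p h1 h2
    rw [h1, h2]
  · filter_upwards [hl, hl'] with r h1 h2
    rw [h1, h2]

theorem IsLead.mul {g g' : ℝ × ℝ → ℂ} {ℓ ℓ' : ℝ → ℂ} (h : IsLead g ℓ) (h' : IsLead g' ℓ') :
    IsLead (fun p => g p * g' p) (fun r => ℓ r * ℓ' r) := by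
  obtain ⟨G, hG, hl⟩ := h
  obtain ⟨G', hG', hl'⟩ := h'
  refine ⟨fun p => G p * G' p, ⟨hG.1.mul hG'.1, ?_⟩, ?_⟩
  · filter_upwards [hG.2, hG'.2] with p h1 h2
    rw [h1, h2]
  · filter_upwards [hl, hl'] with r h1 h2
    rw [h1, h2]

theorem isLead_const (c : ℂ) : IsLead (fun _ => c) (fun _ => c) :=
  ⟨fun _ => c, ⟨analyticAt_const, Eventually.of_forall fun _ => rfl⟩,
    Eventually.of_forall fun _ => rfl⟩

theorem IsLead.const_mul {g : ℝ × ℝ → ℂ} {ℓ : ℝ → ℂ} (c : ℂ) (h : IsLead g ℓ) :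
    IsLead (fun p => c * g p) (fun r => c * ℓ r) := (isLead_const c).mul h

theorem IsLead.sub {g g' : ℝ × ℝ → ℂ} {ℓ ℓ' : ℝ → ℂ} (h : IsLead g ℓ) (h' : IsLead g' ℓ') :
    IsLead (fun p => g p - g' p) (fun r => ℓ r - ℓ' r) := by
  simpa [sub_eq_add_neg] using h.add (h'.const_mul (-1))

theorem IsLead.cexp {g : ℝ × ℝ → ℂ} {ℓ : ℝ → ℂ} (h : IsLead g ℓ) :
    IsLead (fun p => Complex.exp (g p)) (fun r => Complex.exp (ℓ r)) := by
  obtain ⟨G, hG, hl⟩ := h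
  refine ⟨fun p => Complex.exp (G p), ⟨hG.1.cexp', ?_⟩, ?_⟩
  · filter_upwards [hG.2] with p h1
    rw [h1]
  · filter_upwards [hl] with r h1
    rw [h1]

theorem isLead_snd : IsLead (fun p => (p.2 : ℂ)) (fun r => -Complex.I * (r : ℂ)) :=
  ⟨fun q => q.2, ⟨analyticAt_snd, Eventually.of_forall fun _ => rfl⟩,
    Eventually.of_forall fun _ => rfl⟩

theorem IsLead.analyticAt {g : ℝ × ℝ → ℂ} {ℓ : ℝ → ℂ} (h : IsLead g ℓ) : AnalyticAt ℝ ℓ 0 := by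
  obtain ⟨G, hG, hl⟩ := h
  have h1 : AnalyticAt ℝ G (((0 : ℝ) : ℂ), -Complex.I * ((0 : ℝ) : ℂ)) := by
    have h0 : (((0 : ℝ) : ℂ), -Complex.I * ((0 : ℝ) : ℂ)) = (0 : ℂ × ℂ) := by simp
    rw [h0]
    exact hG.1.restrictScalars (𝕜 := ℝ)
  have h2 : AnalyticAt ℝ (fun r : ℝ => ((r : ℂ), -Complex.I * (r : ℂ))) 0 :=
    (Complex.ofRealCLM.analyticAt 0).prod (analyticAt_const.mul (Complex.ofRealCLM.analyticAt 0))
  exact (AnalyticAt.comp (g := G) (f := fun r : ℝ => ((r : ℂ), -Complex.I * (r : ℂ)))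
    h1 h2).congr (hl.mono fun r hr => hr.symm)

theorem IsLead.apply_zero {g : ℝ × ℝ → ℂ} {ℓ : ℝ → ℂ} (h : IsLead g ℓ) : ℓ 0 = g 0 := by
  obtain ⟨G, hG, hl⟩ := h
  have h1 := hl.self_of_nhds
  have h2 := hG.2.self_of_nhds
  simp only [Complex.ofReal_zero, mul_zero] at h1
  rw [h1, ← h2]
  simp

/-- The derivative along the null direction `∂_z - i ∂_ρ`. -/
noncomputable def nullDeriv (g : ℝ × ℝ → ℂ) (p : ℝ × ℝ) : ℂ :=
  fderiv ℝ g p (1, 0) - Complex.I * fderiv ℝ g p (0, 1)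

theorem hasFDerivAt_ofReal_prod (p : ℝ × ℝ) :
    HasFDerivAt (fun q : ℝ × ℝ => ((q.1 : ℂ), (q.2 : ℂ)))
      ((Complex.ofRealCLM.comp (ContinuousLinearMap.fst ℝ ℝ ℝ)).prod
        (Complex.ofRealCLM.comp (ContinuousLinearMap.snd ℝ ℝ ℝ))) p :=
  ((Complex.ofRealCLM.comp (ContinuousLinearMap.fst ℝ ℝ ℝ)).prod
        (Complex.ofRealCLM.comp (ContinuousLinearMap.snd ℝ ℝ ℝ))).hasFDerivAt

theorem tendsto_ofReal_prod :
    Tendsto (fun q : ℝ × ℝ => ((q.1 : ℂ), (q.2 : ℂ))) (𝓝 0) (𝓝 0) := by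
  have : Continuous (fun q : ℝ × ℝ => ((q.1 : ℂ), (q.2 : ℂ))) := by fun_prop
  exact this.tendsto' 0 0 (by simp)

/-- The real partial derivatives of `g` extend to the complex ones of `G`, and the line `r ↦ (r, -i
r)` has tangent `(1, -i)`. By the chain rule, `∂_z - i ∂_ρ` becomes `d/dr` on leading orders. -/
theorem IsLead.nullDeriv {g : ℝ × ℝ → ℂ} {ℓ : ℝ → ℂ} (h : IsLead g ℓ) :
    IsLead (nullDeriv g) (deriv ℓ) := by
  obtain ⟨G, hG, hl⟩ := h
  have hGd := hG.1.eventually_analyticAt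
  refine ⟨fun q => fderiv ℂ G q (1, 0) - Complex.I * fderiv ℂ G q (0, 1), ⟨?_, ?_⟩, ?_⟩
  · have h1 := hG.1.fderiv
    have h2 : ∀ v : ℂ × ℂ, AnalyticAt ℂ (fun q => fderiv ℂ G q v) 0 := fun v =>
      ((ContinuousLinearMap.apply ℂ ℂ v).analyticAt _).comp h1
    exact (h2 _).sub (analyticAt_const.mul (h2 _))
  · filter_upwards [hG.2.eventually_nhds, tendsto_ofReal_prod.eventually hGd] with p h1 h2
    have h3 : HasFDerivAt g _ p :=
      ((h2.differentiableAt.hasFDerivAt.restrictScalars ℝ).comp p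
        (hasFDerivAt_ofReal_prod p)).congr_of_eventuallyEq (h1.mono fun q hq => hq.symm)
    rw [Multipole.nullDeriv, h3.fderiv]
    simp
  · filter_upwards [hl.eventually_nhds, tendsto_nullLine.eventually hGd] with r h1 h2
    have h3 : HasDerivAt (fun r : ℝ => ((r : ℂ), -Complex.I * (r : ℂ)))
        ((1 : ℂ), -Complex.I * 1) r :=
      (Complex.ofRealCLM.hasDerivAt).prodMk ((Complex.ofRealCLM.hasDerivAt).const_mul _)
    have h4 : HasDerivAt ℓ _ r :=
      ((h2.differentiableAt.hasFDerivAt.restrictScalars ℝ).comp_hasDerivAt r h3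
        ).congr_of_eventuallyEq h1
    rw [h4.deriv]
    have h5 : ((1 : ℂ), -Complex.I * 1) = ((1 : ℂ), (0 : ℂ)) + (-Complex.I) • ((0 : ℂ), (1 : ℂ)) := by
      simp
    rw [h5]
    simp only [ContinuousLinearMap.coe_restrictScalars', map_add, map_smul, smul_eq_mul]
    ring

theorem differentiableOn_conj_comp_conj {f : ℂ → ℂ} {ε : ℝ}
    (hf : DifferentiableOn ℂ f (Metric.ball 0 ε)) :
    DifferentiableOn ℂ (fun z => (starRingEnd ℂ) (f ((starRingEnd ℂ) z))) (Metric.ball 0 ε) := by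
  intro z hz
  have hz' : (starRingEnd ℂ) z ∈ Metric.ball (0 : ℂ) ε := by simpa using hz
  have h := (hf.differentiableAt (Metric.isOpen_ball.mem_nhds hz')).star_star
  simp only [← starRingEnd_apply, Complex.conj_conj] at h
  exact h.differentiableWithinAt

/-- The leading order function of a real function that is even in `ρ` is real. -/
theorem IsLead.eventually_real {g : ℝ × ℝ → ℝ} {ℓ : ℝ → ℂ} (h : IsLead (fun p => (g p : ℂ)) ℓ)
    (heven : ∀ᶠ p in 𝓝 (0 : ℝ × ℝ), g (p.1, -p.2) = g p) :
    ∀ᶠ r in 𝓝 (0 : ℝ), ((ℓ r).re : ℂ) = ℓ r := by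
  obtain ⟨G, hG, hl⟩ := h
  obtain ⟨ε, hε, hd, hz⟩ := exists_ball_of_analyticAt hG.1 (hG.2.and heven)
  have hd1 : ∀ w ∈ Metric.ball (0 : ℂ) ε,
      DifferentiableOn ℂ (fun z => G (z, w)) (Metric.ball 0 ε) := fun w hw z hz =>
    ((hd z hz w hw).comp z (by fun_prop :
      DifferentiableAt ℂ (fun z => (z, w)) z)).differentiableWithinAt
  have hd2 : ∀ z ∈ Metric.ball (0 : ℂ) ε,
      DifferentiableOn ℂ (fun w => G (z, w)) (Metric.ball 0 ε) := fun z hz w hw =>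
    ((hd z hz w hw).comp w (by fun_prop :
      DifferentiableAt ℂ (fun w => (z, w)) w)).differentiableWithinAt
  have hstar : ∀ z ∈ Metric.ball (0 : ℂ) ε, (starRingEnd ℂ) z ∈ Metric.ball (0 : ℂ) ε := by
    intro z hz
    simpa using hz
  have hneg : ∀ z ∈ Metric.ball (0 : ℂ) ε, -z ∈ Metric.ball (0 : ℂ) ε := by
    intro z hz
    simpa using hz
  -- A reflection principle: conjugating values and arguments, together with `w ↦ -w`, preserves `G`
  -- because `g` is real and even at real points. The points `(r, -i r)` are fixed by `(z, w) ↦ (z̄,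
  -- -w̄)`, so `G` is real there.
  have key : ∀ z ∈ Metric.ball (0 : ℂ) ε, ∀ w ∈ Metric.ball (0 : ℂ) ε,
      (starRingEnd ℂ) (G ((starRingEnd ℂ) z, (starRingEnd ℂ) (-w))) - G (z, w) = 0 := by
    intro z hz' w hw'
    refine eq_zero_of_real_prod (D := fun q =>
      (starRingEnd ℂ) (G ((starRingEnd ℂ) q.1, (starRingEnd ℂ) (-q.2))) - G q) (ε := ε)
      (fun w hw => ?_) (fun z hz => ?_) (fun x y hx hy => ?_) hz' hw'
    · exact ((differentiableOn_conj_comp_conj (hd1 _ (hstar _ (hneg w hw))))).sub (hd1 w hw)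
    · have h1 := differentiableOn_conj_comp_conj (hd2 _ (hstar z hz))
      exact (h1.comp (differentiableOn_id.neg) (fun w hw => hneg w hw)).sub (hd2 z hz)
    · have h1 := hz x y hx hy
      have h2 := hz x (-y) hx (by simpa using hy)
      have h3 : G ((x : ℂ), -(y : ℂ)) = g (x, y) := by
        simpa [h1.2] using h2.1.trans (congrArg Complex.ofReal h1.2)
      simp only [map_neg, Complex.conj_ofReal, h3, h1.1, sub_self]
  filter_upwards [hl, tendsto_nullLine.eventually (eventually_mem_ball_prod hε)] with r h1 h2
  have h3 := key _ h2.1 _ h2.2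
  rw [← Complex.conj_eq_iff_re, h1]
  simpa [sub_eq_zero] using h3

end Lead

/-! ### Integrals of analytic functions over a parameter -/

section ParametricIntegral

variable {E F : Type*} [NormedAddCommGroup E] [NormedSpace ℝ E] [NormedAddCommGroup F]
  [NormedSpace ℝ F] [CompleteSpace F]

/-- Averages of an analytic function over contracting linear maps are analytic. -/
theorem analyticAt_integral_comp {f : E → F} (hf : AnalyticAt ℝ f 0) {A : ℝ → E →L[ℝ] E}
    (hA : Continuous A) (hA1 : ∀ t ∈ Set.Icc (0 : ℝ) 1, ‖A t‖ ≤ 1) {w : ℝ → ℝ}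
    (hw : Continuous w) (hw1 : ∀ t ∈ Set.Icc (0 : ℝ) 1, |w t| ≤ 1) :
    AnalyticAt ℝ (fun x => ∫ t in (0 : ℝ)..1, w t • f (A t x)) 0 := by
  obtain ⟨p, R, hp⟩ := hf
  set T : (n : ℕ) → ℝ → ContinuousMultilinearMap ℝ (fun _ : Fin n => E) F :=
    fun n t => w t • (p n).compContinuousLinearMap (fun _ => A t) with hT
  have hTc : ∀ n, Continuous (T n) := by
    intro n
    have h1 : Continuous fun t =>
        (ContinuousMultilinearMap.compContinuousLinearMapContinuousMultilinear ℝ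
          (fun _ : Fin n => E) (fun _ : Fin n => E) F) (fun _ => A t) :=
      (ContinuousMultilinearMap.cont _).comp (continuous_pi fun _ => hA)
    exact hw.smul (h1.clm_apply continuous_const)
  have hTn : ∀ n, ∀ t ∈ Set.Icc (0 : ℝ) 1, ‖T n t‖ ≤ ‖p n‖ := by
    intro n t ht
    rw [hT, norm_smul]
    have h1 := (p n).norm_compContinuousLinearMap_le (fun _ => A t)
    have h2 : ∏ _i : Fin n, ‖A t‖ ≤ 1 :=
      Finset.prod_le_one (fun _ _ => norm_nonneg _) (fun _ _ => hA1 t ht)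
    calc ‖w t‖ * ‖(p n).compContinuousLinearMap (fun _ => A t)‖
        ≤ 1 * (‖p n‖ * 1) := by
          gcongr
          · exact hw1 t ht
          · exact h1.trans (by gcongr)
      _ = ‖p n‖ := by ring
  have hIoc : ∀ t ∈ Set.uIoc (0 : ℝ) 1, t ∈ Set.Icc (0 : ℝ) 1 := by
    intro t ht
    rw [Set.uIoc_of_le zero_le_one] at ht
    exact Set.Ioc_subset_Icc_self ht
  -- The candidate power series is obtained by integrating the coefficients. The bounds on `A` and
  -- `w` give `‖q n‖ ≤ ‖p n‖`, so no convergence is lost.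
  set q : FormalMultilinearSeries ℝ E F := fun n => ∫ t in (0 : ℝ)..1, T n t with hq
  have hqn : ∀ n, ‖q n‖ ≤ ‖p n‖ := by
    intro n
    have h1 := intervalIntegral.norm_integral_le_of_norm_le_const (a := 0) (b := 1) (f := T n)
      (C := ‖p n‖) fun t ht => hTn n t (hIoc t ht)
    simpa using h1
  obtain ⟨r, hr0, hr⟩ := ENNReal.lt_iff_exists_nnreal_btwn.1 hp.r_pos
  obtain ⟨C, -, hC⟩ := p.norm_mul_pow_le_of_lt_radius (hr.trans_le hp.r_le)
  refine ⟨q, r, ?_, hr0, ?_⟩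
  · exact q.le_radius_of_bound C fun n => le_trans (by gcongr; exact hqn n) (hC n)
  · intro y hy
    rw [zero_add]
    have hyn : ‖y‖₊ < r := by
      have h1 : ‖y‖ < r := by simpa using hy
      exact h1
    have hqy : ∀ n, q n (fun _ => y) = ∫ t in (0 : ℝ)..1, T n t (fun _ => y) := by
      intro n
      exact ((ContinuousMultilinearMap.apply ℝ (fun _ : Fin n => E) F
        (fun _ => y)).intervalIntegral_comp_comm ((hTc n).intervalIntegrable 0 1)).symm
    simp only [hqy]
    have hsum : Summable fun n => ‖p n‖ * ‖y‖ ^ n := by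
      have h1 : (‖y‖₊ : ENNReal) < p.radius :=
        (ENNReal.coe_lt_coe.2 hyn).trans (hr.trans_le hp.r_le)
      simpa using p.summable_norm_mul_pow h1
    refine intervalIntegral.hasSum_integral_of_dominated_convergence
      (fun n _ => ‖p n‖ * ‖y‖ ^ n) (fun n => ?_) (fun n => ?_) ?_ ?_ ?_
    · exact ((ContinuousMultilinearMap.apply ℝ (fun _ : Fin n => E) F
        (fun _ => y)).continuous.comp (hTc n)).aestronglyMeasurable
    · refine Eventually.of_forall fun t ht => ?_
      refine ((T n t).le_opNorm _).trans ?_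
      simp only [Finset.prod_const, Finset.card_univ, Fintype.card_fin]
      gcongr
      exact hTn n t (hIoc t ht)
    · exact Eventually.of_forall fun t _ => hsum
    · exact intervalIntegrable_const
    · refine Eventually.of_forall fun t ht => ?_
      have hAy : A t y ∈ Metric.eball (0 : E) R := by
        have h1 : ‖A t y‖ ≤ ‖y‖ := by
          have := (A t).le_of_opNorm_le (hA1 t (hIoc t ht)) y
          simpa using this
        have h2 : ‖A t y‖₊ < r := lt_of_le_of_lt h1 hyn
        have h3 : ‖A t y‖ₑ < R := (ENNReal.coe_lt_coe.2 h2).trans hr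
        simpa using h3
      have h1 := (hp.hasSum hAy).const_smul (w t)
      rw [zero_add] at h1
      exact h1

end ParametricIntegral

/-! ### Removable singularities on the axis and analytic division by `x² + y²` -/

section Division

/-- Used wherever an identity is obtained by dividing by a coordinate or a radius: continuity
carries it to the points where the divisor vanishes. -/
theorem eventually_eq_of_dense {E F : Type*} [TopologicalSpace E] [TopologicalSpace F] [T2Space F]
    {f g : E → F} {s : Set E} {a : E} (hs : Dense s) (hf : ∀ᶠ x in 𝓝 a, ContinuousAt f x)
    (hg : ∀ᶠ x in 𝓝 a, ContinuousAt g x) (h : ∀ᶠ x in 𝓝 a, x ∈ s → f x = g x) :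
    ∀ᶠ x in 𝓝 a, f x = g x := by
  filter_upwards [hf, hg, h.eventually_nhds] with x h1 h2 h3
  have : (𝓝[s] x).NeBot := mem_closure_iff_nhdsWithin_neBot.1 (hs x)
  refine tendsto_nhds_unique_of_eventuallyEq (l := 𝓝[s] x) (h1.tendsto.mono_left nhdsWithin_le_nhds)
    (h2.tendsto.mono_left nhdsWithin_le_nhds) ?_
  exact eventually_nhdsWithin_iff.2 h3

theorem dense_coord_ne {d : ℕ} (i : Fin d) : Dense {x : Chart d | x i ≠ 0} :=
  (dense_compl_singleton (0 : ℝ)).preimage (isOpenMap_eval i)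

theorem analyticAt_pd {d : ℕ} {F : Type*} [NormedAddCommGroup F] [NormedSpace ℝ F]
    [CompleteSpace F] {f : Chart d → F} {x : Chart d} (hf : AnalyticAt ℝ f x) (i : Fin d) :
    AnalyticAt ℝ (pd i f) x :=
  ((ContinuousLinearMap.apply ℝ F (Pi.single i (1 : ℝ) : Chart d)).analyticAt _).comp hf.fderiv

theorem eventually_continuousAt_of_analyticAt {E F : Type*} [NormedAddCommGroup E] [NormedSpace ℝ E]
    [NormedAddCommGroup F] [NormedSpace ℝ F] [CompleteSpace F] {f : E → F} {x : E}
    (hf : AnalyticAt ℝ f x) : ∀ᶠ y in 𝓝 x, ContinuousAt f y :=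
  hf.eventually_analyticAt.mono fun _ h => h.continuousAt

theorem fderiv_eq_sum_pd {d : ℕ} {F : Type*} [NormedAddCommGroup F] [NormedSpace ℝ F]
    (f : Chart d → F) (x v : Chart d) : fderiv ℝ f x v = ∑ i, v i • pd i f x := by
  conv_lhs => rw [pi_eq_sum_univ' v]
  simp only [map_sum, map_smul, pd]

/-- The projection that sets the coordinates in `s` to zero. -/
noncomputable def killCoords {d : ℕ} (s : Finset (Fin d)) : Chart d →L[ℝ] Chart d :=
  ContinuousLinearMap.pi fun i => if i ∈ s then 0 else ContinuousLinearMap.proj i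

theorem killCoords_apply {d : ℕ} (s : Finset (Fin d)) (x : Chart d) (i : Fin d) :
    killCoords s x i = if i ∈ s then 0 else x i := by
  by_cases h : i ∈ s <;> simp [killCoords, h]

theorem norm_killCoords_le {d : ℕ} (s : Finset (Fin d)) : ‖killCoords s‖ ≤ 1 := by
  refine ContinuousLinearMap.opNorm_le_bound _ zero_le_one fun x => ?_
  rw [one_mul, pi_norm_le_iff_of_nonneg (norm_nonneg x)]
  intro i
  rw [killCoords_apply]
  split_ifs
  · simp
  · exact norm_le_pi_norm x i

/-- The linear homotopy from `killCoords s` to the identity. -/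
noncomputable def contractCoords {d : ℕ} (s : Finset (Fin d)) (t : ℝ) : Chart d →L[ℝ] Chart d :=
  (1 - t) • killCoords s + t • ContinuousLinearMap.id ℝ (Chart d)

theorem contractCoords_apply {d : ℕ} (s : Finset (Fin d)) (t : ℝ) (x : Chart d) (i : Fin d) :
    contractCoords s t x i = if i ∈ s then t * x i else x i := by
  simp only [contractCoords, add_apply, smul_apply,
    ContinuousLinearMap.id_apply, Pi.add_apply, Pi.smul_apply, killCoords_apply, smul_eq_mul]
  split_ifs <;> ring

theorem continuous_contractCoords {d : ℕ} (s : Finset (Fin d)) :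
    Continuous (contractCoords s) := by
  unfold contractCoords
  fun_prop

theorem norm_contractCoords_le {d : ℕ} (s : Finset (Fin d)) :
    ∀ t ∈ Set.Icc (0 : ℝ) 1, ‖contractCoords s t‖ ≤ 1 := by
  intro t ht
  have h0 : 0 ≤ 1 - t := by linarith [ht.2]
  calc ‖contractCoords s t‖ ≤ ‖(1 - t) • killCoords s‖
        + ‖t • ContinuousLinearMap.id ℝ (Chart d)‖ := norm_add_le _ _
    _ ≤ (1 - t) * 1 + t * 1 := by
      rw [norm_smul, norm_smul, Real.norm_of_nonneg h0, Real.norm_of_nonneg ht.1]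
      gcongr
      · exact norm_killCoords_le s
      · exact ht.1
      · exact ContinuousLinearMap.norm_id_le
    _ = 1 := by ring

theorem contractCoords_one {d : ℕ} (s : Finset (Fin d)) (x : Chart d) :
    contractCoords s 1 x = x := by
  funext i
  simp [contractCoords_apply]

theorem contractCoords_zero {d : ℕ} (s : Finset (Fin d)) (x : Chart d) :
    contractCoords s 0 x = killCoords s x := by
  funext i
  simp [contractCoords_apply, killCoords_apply]

theorem eventually_forall_contractCoords {d : ℕ} (s : Finset (Fin d)) {P : Chart d → Prop}
    (hP : ∀ᶠ x in 𝓝 0, P x) :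
    ∀ᶠ x in 𝓝 (0 : Chart d), ∀ t ∈ Set.Icc (0 : ℝ) 1, P (contractCoords s t x) := by
  obtain ⟨ε, hε, h⟩ := Metric.eventually_nhds_iff_ball.1 hP
  filter_upwards [Metric.ball_mem_nhds (0 : Chart d) hε] with x hx t ht
  refine h _ ?_
  rw [mem_ball_zero_iff] at hx ⊢
  have := (contractCoords s t).le_of_opNorm_le (norm_contractCoords_le s t ht) x
  linarith

/-- The fundamental theorem of calculus along `contractCoords`. -/
theorem eventually_sub_killCoords_eq_integral {d : ℕ} (s : Finset (Fin d)) {f : Chart d → ℝ}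
    (hf : AnalyticAt ℝ f 0) : ∀ᶠ x in 𝓝 (0 : Chart d),
      f x - f (killCoords s x)
        = ∫ t in (0 : ℝ)..1, ∑ i ∈ s, x i * pd i f (contractCoords s t x) := by
  filter_upwards [eventually_forall_contractCoords s hf.eventually_analyticAt] with x hx
  have hpath : ∀ t : ℝ, HasDerivAt (fun t => contractCoords s t x)
      (fun i => if i ∈ s then x i else 0) t := by
    intro t
    rw [hasDerivAt_pi]
    intro i
    simp only [contractCoords_apply]
    split_ifs
    · simpa using (hasDerivAt_id t).mul_const (x i)
    · exact hasDerivAt_const t (x i)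
  have hd : ∀ t ∈ Set.uIcc (0 : ℝ) 1, HasDerivAt (fun t => f (contractCoords s t x))
      (∑ i ∈ s, x i * pd i f (contractCoords s t x)) t := by
    intro t ht
    rw [Set.uIcc_of_le zero_le_one] at ht
    have h1 := (hx t ht).differentiableAt.hasFDerivAt.comp_hasDerivAt t (hpath t)
    rw [fderiv_eq_sum_pd] at h1
    refine h1.congr_deriv ?_
    simp [ite_mul]
  have hc : ContinuousOn (fun t => ∑ i ∈ s, x i * pd i f (contractCoords s t x))
      (Set.uIcc (0 : ℝ) 1) := by
    intro t ht
    rw [Set.uIcc_of_le zero_le_one] at ht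
    refine ContinuousAt.continuousWithinAt (tendsto_finsetSum _ fun i _ => ?_)
    refine ContinuousAt.mul continuousAt_const ?_
    exact ContinuousAt.comp (f := fun t => contractCoords s t x)
      (analyticAt_pd (hx t ht) i).continuousAt (hpath t).continuousAt
  rw [intervalIntegral.integral_eq_sub_of_hasDerivAt hd hc.intervalIntegrable,
    contractCoords_one, contractCoords_zero]

theorem hasDerivAt_rotation_mulVec (x : Chart 3) :
    HasDerivAt (fun α => (rotation α).mulVec x) ![-x 1, x 0, 0] 0 := by
  rw [hasDerivAt_pi]
  have hc : HasDerivAt Real.cos 0 0 := by simpa using Real.hasDerivAt_cos 0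
  have hs : HasDerivAt Real.sin 1 0 := by simpa using Real.hasDerivAt_sin 0
  intro i
  fin_cases i
  · simpa [rotation, Matrix.mulVec, dotProduct, Fin.sum_univ_three] using
      ((hc.mul_const (x 0)).fun_add ((hs.neg).mul_const (x 1)))
  · simpa [rotation, Matrix.mulVec, dotProduct, Fin.sum_univ_three] using
      ((hs.mul_const (x 0)).fun_add (hc.mul_const (x 1)))
  · simpa [rotation, Matrix.mulVec, dotProduct, Fin.sum_univ_three] using
      (hasDerivAt_const (0 : ℝ) (x 2))

theorem rotation_zero_mulVec (x : Chart 3) : (rotation 0).mulVec x = x := by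
  funext i
  fin_cases i <;> simp [rotation, Matrix.mulVec, dotProduct, Fin.sum_univ_three]

/-- Axisymmetric functions are annihilated by `x ∂_y - y ∂_x`. -/
theorem pd_of_axisymmetric {f : Chart 3 → ℝ} {x : Chart 3} (hd : DifferentiableAt ℝ f x)
    (hf : ∀ α : ℝ, f ((rotation α).mulVec x) = f x) :
    x 0 * pd 1 f x = x 1 * pd 0 f x := by
  have h1 : HasDerivAt (fun α => f ((rotation α).mulVec x)) (fderiv ℝ f x ![-x 1, x 0, 0]) 0 := by
    have h2 : HasFDerivAt f (fderiv ℝ f x) ((rotation 0).mulVec x) := by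
      rw [rotation_zero_mulVec]
      exact hd.hasFDerivAt
    exact h2.comp_hasDerivAt 0 (hasDerivAt_rotation_mulVec x)
  have h3 : (fun α => f ((rotation α).mulVec x)) = fun _ => f x := funext hf
  rw [h3] at h1
  have h4 := h1.unique (hasDerivAt_const _ _)
  rw [fderiv_eq_sum_pd] at h4
  simp [Fin.sum_univ_three] at h4
  linarith

/-- An analytic axisymmetric function that vanishes on the axis is divisible by `x² + y²`. -/
theorem exists_analytic_quotient {f : Chart 3 → ℝ} (hf : AnalyticAt ℝ f 0)
    (hrot : ∀ᶠ x in 𝓝 0, x 0 * pd 1 f x = x 1 * pd 0 f x)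
    (haxis : ∀ᶠ x in 𝓝 0, f (killCoords {0, 1} x) = 0) :
    ∃ b : Chart 3 → ℝ, AnalyticAt ℝ b 0 ∧
      ∀ᶠ x in 𝓝 0, f x = (x 0 ^ 2 + x 1 ^ 2) * b x := by
  -- `c` is the analytic version of `∂_x f / x`, obtained by averaging `∂_x² f` along the segment
  -- from the plane `x = 0`.
  set c : Chart 3 → ℝ := fun x =>
    ∫ t in (0 : ℝ)..1, (1 : ℝ) • pd 0 (pd 0 f) (contractCoords {0} t x) with hc
  have hca : AnalyticAt ℝ c 0 :=
    analyticAt_integral_comp (analyticAt_pd (analyticAt_pd hf 0) 0)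
      (continuous_contractCoords _) (norm_contractCoords_le _) continuous_const
      (fun t _ => by simp)
  have htend : Tendsto (killCoords ({0} : Finset (Fin 3))) (𝓝 0) (𝓝 0) :=
    (killCoords _).continuous.tendsto' 0 0 (map_zero _)
  -- On the plane `x = 0` the rotation identity reads `y ∂_x f = 0`, which gives `∂_x f = 0` first
  -- for `y ≠ 0` and then by density.
  have h00 : ∀ᶠ x in 𝓝 0, pd 0 f (killCoords {0} x) = 0 := by
    refine eventually_eq_of_dense (g := fun _ => (0 : ℝ)) (dense_coord_ne 1) ?_
      (Eventually.of_forall fun _ => continuousAt_const) ?_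
    · filter_upwards [htend.eventually
        (eventually_continuousAt_of_analyticAt (analyticAt_pd hf 0))] with x hx
      exact ContinuousAt.comp (f := killCoords {0}) hx (killCoords _).continuous.continuousAt
    · filter_upwards [htend.eventually hrot] with x hx hx1
      simp only [killCoords_apply] at hx
      simpa [hx1] using hx
  have h0 : ∀ᶠ x in 𝓝 0, pd 0 f x = x 0 * c x := by
    filter_upwards [h00, eventually_sub_killCoords_eq_integral {0} (analyticAt_pd hf 0)]
      with x h1 h2
    rw [h1, sub_zero] at h2
    rw [h2, hc]
    simp
  -- The rotation identity forces `∂_y f` to have the same quotient `c` by `y` as `∂_x f` has by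
  -- `x`.
  have h1 : ∀ᶠ x in 𝓝 0, pd 1 f x = x 1 * c x := by
    refine eventually_eq_of_dense (dense_coord_ne 0)
      (eventually_continuousAt_of_analyticAt (analyticAt_pd hf 1)) ?_ ?_
    · filter_upwards [eventually_continuousAt_of_analyticAt hca] with x hx
      exact (continuous_apply 1).continuousAt.mul hx
    · filter_upwards [h0, hrot] with x h1 h2 hx
      rw [h1] at h2
      exact mul_left_cancel₀ hx (by rw [h2]; ring)
  -- Integrating from the axis, where `f` vanishes, the integrand is `x (t x) c + y (t y) c` at `(t
  -- x, t y, z)`. Taking out `x² + y²` leaves the average of `t c` as quotient.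
  refine ⟨fun x => ∫ t in (0 : ℝ)..1, t • c (contractCoords {0, 1} t x),
    analyticAt_integral_comp hca (continuous_contractCoords _) (norm_contractCoords_le _)
      continuous_id (fun t ht => (abs_of_nonneg ht.1).le.trans ht.2), ?_⟩
  filter_upwards [haxis, eventually_sub_killCoords_eq_integral {0, 1} hf,
    eventually_forall_contractCoords {0, 1} h0, eventually_forall_contractCoords {0, 1} h1]
    with x h2 h3 h4 h5
  rw [h2, sub_zero] at h3
  rw [h3, ← intervalIntegral.integral_const_mul]
  refine intervalIntegral.integral_congr fun t ht => ?_
  rw [Set.uIcc_of_le zero_le_one] at ht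
  simp only [Finset.sum_pair (show (0 : Fin 3) ≠ 1 by decide), h4 t ht, h5 t ht,
    contractCoords_apply, smul_eq_mul]
  simp
  ring

/-- `(e^{c u} - 1) / u` is analytic. -/
theorem exists_exp_quotient (c : ℝ) : ∃ E : ℝ → ℝ, AnalyticAt ℝ E 0 ∧
    ∀ u, Real.exp (c * u) - 1 = u * E u := by
  have h : AnalyticAt ℝ (fun u : ℝ => Real.exp (c * u)) 0 :=
    (analyticAt_const.mul analyticAt_id).rexp'
  obtain ⟨p, hp⟩ := h
  refine ⟨_, ⟨_, hp.has_fpower_series_dslope_fslope⟩, fun u => ?_⟩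
  have := sub_smul_dslope (fun u : ℝ => Real.exp (c * u)) 0 u
  simp at this
  rw [this]

/-- The primitive of an analytic function is analytic. -/
theorem analyticAt_primitive {f : ℝ → ℝ} (hf : AnalyticAt ℝ f 0) :
    AnalyticAt ℝ (fun r => ∫ s in (0 : ℝ)..r, f s) 0 := by
  have h1 : AnalyticAt ℝ
      (fun x => ∫ t in (0 : ℝ)..1, (1 : ℝ) • f ((t • ContinuousLinearMap.id ℝ ℝ) x)) 0 :=
    analyticAt_integral_comp hf (by fun_prop) (fun t ht => by
      rw [norm_smul, Real.norm_of_nonneg ht.1]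
      have := ContinuousLinearMap.norm_id_le (𝕜 := ℝ) (E := ℝ)
      nlinarith [ht.1, ht.2]) continuous_const (fun t _ => by simp)
  -- The substitution `s = t r` writes the primitive as `r ∫₀¹ f(t r) dt`.
  refine (analyticAt_id.mul h1).congr (Eventually.of_forall fun r => ?_)
  simp

end Division

/-! ### Analyticity of the multipole tensors -/

section Analytic

variable {d n : ℕ}

/-- `B` is an orthonormal frame of `h` near the origin that is analytic together with its
inverse. -/
structure AnalyticFrame (h B : MetricField d) : Prop where
  analytic : ∀ i j, AnalyticAt ℝ (fun x => B x i j) 0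
  analytic_inv : ∀ i j, AnalyticAt ℝ (fun x => (B x)⁻¹ i j) 0
  isFrame : ∀ᶠ x in 𝓝 0, IsFrame (h x) (B x)

theorem IsFrame.metric_eq {h B : Matrix (Fin d) (Fin d) ℝ} (hB : IsFrame h B) :
    h = (B⁻¹).transpose * B⁻¹ := by
  have := congruence_inv_congruence (h := h) hB.1
  rw [hB.2, mul_one] at this
  exact this.symm

theorem IsFrame.inv_eq {h B : Matrix (Fin d) (Fin d) ℝ} (hB : IsFrame h B) :
    h⁻¹ = B * B.transpose := by
  have := inv_congruence (h := h) hB.1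
  rw [hB.2, inv_one, mul_one] at this
  exact this.symm

theorem IsFrame.isUnit_det {h B : Matrix (Fin d) (Fin d) ℝ} (hB : IsFrame h B) :
    IsUnit h.det := by
  have := congrArg Matrix.det hB.2
  rw [Matrix.det_mul, Matrix.det_one] at this
  have h1 := IsUnit.of_mul_eq_one _ this
  rw [Matrix.det_mul] at h1
  exact isUnit_of_mul_isUnit_right h1

variable {h B : MetricField d}

theorem AnalyticFrame.metric (hB : AnalyticFrame h B) (i j : Fin d) :
    AnalyticAt ℝ (fun x => h x i j) 0 := by
  have h1 : AnalyticAt ℝ (fun x => ∑ k, (B x)⁻¹ k i * (B x)⁻¹ k j) 0 :=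
    Finset.analyticAt_fun_sum _ fun k _ => (hB.analytic_inv k i).mul (hB.analytic_inv k j)
  refine h1.congr (hB.isFrame.mono fun x hx => ?_)
  simp only
  conv_rhs => rw [hx.metric_eq]
  simp only [Matrix.mul_apply, Matrix.transpose_apply]

theorem AnalyticFrame.inv (hB : AnalyticFrame h B) (i j : Fin d) :
    AnalyticAt ℝ (fun x => (h x)⁻¹ i j) 0 := by
  have h1 : AnalyticAt ℝ (fun x => ∑ k, B x i k * B x j k) 0 :=
    Finset.analyticAt_fun_sum _ fun k _ => (hB.analytic i k).mul (hB.analytic j k)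
  refine h1.congr (hB.isFrame.mono fun x hx => ?_)
  simp only
  rw [hx.inv_eq]
  simp only [Matrix.mul_apply, Matrix.transpose_apply]

theorem AnalyticFrame.christoffel (hB : AnalyticFrame h B) (k i j : Fin d) :
    AnalyticAt ℝ (fun x => christoffel h x k i j) 0 := by
  refine analyticAt_const.mul (Finset.analyticAt_fun_sum _ fun l _ => (hB.inv k l).mul ?_)
  exact ((analyticAt_pd (hB.metric l j) i).add (analyticAt_pd (hB.metric l i) j)).sub
    (analyticAt_pd (hB.metric i j) l)

theorem AnalyticFrame.ricci (hB : AnalyticFrame h B) (i j : Fin d) :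
    AnalyticAt ℝ (fun x => ricci h x i j) 0 := by
  refine AnalyticAt.add (Finset.analyticAt_fun_sum _ fun k _ => ?_)
    (Finset.analyticAt_fun_sum _ fun k _ => Finset.analyticAt_fun_sum _ fun l _ => ?_)
  · exact (analyticAt_pd (hB.christoffel k i j) k).sub (analyticAt_pd (hB.christoffel k i k) j)
  · exact ((hB.christoffel k k l).mul (hB.christoffel l i j)).sub
      ((hB.christoffel k j l).mul (hB.christoffel l i k))

theorem analyticAt_ofReal {f : Chart d → ℝ} {x : Chart d} (hf : AnalyticAt ℝ f x) :
    AnalyticAt ℝ (fun y => (f y : ℂ)) x :=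
  (Complex.ofRealCLM.analyticAt _).comp hf

theorem analyticAt_pull {A : Chart d → Matrix (Fin d) (Fin d) ℝ} {T : Chart d → Tensor d n}
    {x : Chart d} (hA : ∀ i j, AnalyticAt ℝ (fun y => A y i j) x)
    (hT : ∀ i, AnalyticAt ℝ (fun y => T y i) x) (i : Fin n → Fin d) :
    AnalyticAt ℝ (fun y => pull ((A y).map Complex.ofReal) (T y) i) x :=
  Finset.analyticAt_fun_sum _ fun j _ =>
    (Finset.analyticAt_fun_prod _ fun k _ => analyticAt_ofReal (hA (j k) (i k))).mul (hT j)

theorem analyticAt_stfOne {T : Chart d → Tensor d n} {x : Chart d}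
    (hT : ∀ i, AnalyticAt ℝ (fun y => T y i) x) (i : Fin n → Fin d) :
    AnalyticAt ℝ (fun y => stfOne d n (T y) i) x := by
  have h1 : AnalyticAt ℝ T x := analyticAt_pi_iff.2 hT
  have h2 := (((LinearMap.toContinuousLinearMap (stfOne d n)).restrictScalars ℝ).analyticAt
    (T x)).comp h1
  exact analyticAt_pi_iff.1 h2 i

theorem AnalyticFrame.stfPart (hB : AnalyticFrame h B) {T : Chart d → Tensor d n}
    (hT : ∀ i, AnalyticAt ℝ (fun y => T y i) 0) (i : Fin n → Fin d) :
    AnalyticAt ℝ (fun y => stfPart (h y) (T y) i) 0 := by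
  refine (analyticAt_pull hB.analytic_inv
    (analyticAt_stfOne (analyticAt_pull hB.analytic hT)) i).congr ?_
  filter_upwards [hB.isFrame] with x hx
  rw [hx.stfPart_eq]

theorem AnalyticFrame.covDeriv (hB : AnalyticFrame h B) {T : Chart d → Tensor d n}
    (hT : ∀ i, AnalyticAt ℝ (fun y => T y i) 0) (i : Fin (n + 1) → Fin d) :
    AnalyticAt ℝ (fun y => covDeriv h T y i) 0 := by
  refine AnalyticAt.sub (analyticAt_pd (hT _) _) (Finset.analyticAt_fun_sum _ fun k _ =>
    Finset.analyticAt_fun_sum _ fun l _ => ?_)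
  exact (analyticAt_ofReal (hB.christoffel _ _ _)).mul (hT _)

theorem AnalyticFrame.multipoleTensor {h B : MetricField 3} (hB : AnalyticFrame h B)
    {φ : Chart 3 → ℂ} (hφ : AnalyticAt ℝ φ 0) : ∀ (n : ℕ) (i : Fin n → Fin 3),
      AnalyticAt ℝ (fun y => multipoleTensor h φ n y i) 0
  | 0 => fun _ => hφ
  | 1 => fun i => hB.stfPart (hB.covDeriv fun _ => hφ) i
  | n + 2 => fun i => hB.stfPart (fun j =>
      (hB.covDeriv (hB.multipoleTensor hφ (n + 1)) j).sub
        ((analyticAt_const.mul (analyticAt_ofReal (hB.ricci _ _))).mul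
          (hB.multipoleTensor hφ n _))) i

end Analytic

/-! ### Equivariance under linear isometries -/

section Equivariance

variable {d n : ℕ}

theorem tendsto_mulVec_zero (A : Matrix (Fin d) (Fin d) ℝ) :
    Tendsto (fun x : Chart d => A.mulVec x) (𝓝 0) (𝓝 0) :=
  (A.mulVecLin.continuous_of_finiteDimensional).tendsto' 0 0 (by simp)

theorem pd_comp_mulVec {F : Type*} [NormedAddCommGroup F] [NormedSpace ℝ F]
    (A : Matrix (Fin d) (Fin d) ℝ) {f : Chart d → F} {x : Chart d}
    (hf : DifferentiableAt ℝ f (A.mulVec x)) (i : Fin d) :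
    pd i (fun y => f (A.mulVec y)) x = ∑ c, A c i • pd c f (A.mulVec x) := by
  have h1 : HasFDerivAt (fun y : Chart d => A.mulVec y)
      (LinearMap.toContinuousLinearMap A.mulVecLin) x :=
    (LinearMap.toContinuousLinearMap A.mulVecLin).hasFDerivAt
  have h2 := hf.hasFDerivAt.comp x h1
  have h3 : pd i (fun y => f (A.mulVec y)) x
      = fderiv ℝ f (A.mulVec x) (A.mulVec (Pi.single i 1)) := by
    rw [pd]
    exact congrArg (fun L => L (Pi.single i 1)) h2.fderiv
  rw [h3, fderiv_eq_sum_pd]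
  simp [Matrix.mulVec_single]

/-- An upper index transforms with `A⁻¹` and a lower one with `A`, so the two factors cancel in a
contraction. -/
theorem sum_contract {A Ai : Matrix (Fin d) (Fin d) ℝ} (hA : A * Ai = 1)
    (X : Fin d → Fin d → ℝ) :
    ∑ k, ∑ m, ∑ c, Ai k m * A c k * X c m = ∑ m, X m m := by
  rw [Finset.sum_comm]
  refine Finset.sum_congr rfl fun m _ => ?_
  rw [Finset.sum_comm]
  have h1 : ∀ c, ∑ k, Ai k m * A c k * X c m = (1 : Matrix (Fin d) (Fin d) ℝ) c m * X c m := by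
    intro c
    rw [← hA, Matrix.mul_apply, Finset.sum_mul]
    exact Finset.sum_congr rfl fun k _ => by ring
  simp [h1, Matrix.one_apply]

/-- The pullback of a metric by a linear map. -/
def IsIsometryAt (h : MetricField d) (A : Matrix (Fin d) (Fin d) ℝ) (x : Chart d) : Prop :=
  h x = A.transpose * h (A.mulVec x) * A

variable {h : MetricField d} {A : Matrix (Fin d) (Fin d) ℝ} {x : Chart d}

theorem pd_metric_of_isometry (hiso : ∀ᶠ y in 𝓝 x, IsIsometryAt h A y)
    (hd : ∀ i j, DifferentiableAt ℝ (fun y => h y i j) (A.mulVec x)) (k i j : Fin d) :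
    pd k (fun y => h y i j) x = ∑ c, ∑ a, ∑ b, A c k * A a i * A b j *
      pd c (fun y => h y a b) (A.mulVec x) := by
  have h1 : (fun y => h y i j) =ᶠ[𝓝 x]
      fun y => (fun z => ∑ a, ∑ b, A a i * A b j * h z a b) (A.mulVec y) := by
    filter_upwards [hiso] with y hy
    have h2 := congrFun (congrFun hy i) j
    rw [h2]
    simp only [Matrix.mul_apply, Matrix.transpose_apply, Finset.sum_mul]
    rw [Finset.sum_comm]
    exact Finset.sum_congr rfl fun a _ => Finset.sum_congr rfl fun b _ => by ring
  rw [pd, h1.fderiv_eq, ← pd, pd_comp_mulVec A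
    (DifferentiableAt.fun_sum fun a _ => DifferentiableAt.fun_sum fun b _ =>
      (hd a b).const_mul _)]
  refine Finset.sum_congr rfl fun c _ => ?_
  rw [smul_eq_mul, pd, fderiv_fun_sum fun a _ => DifferentiableAt.fun_sum fun b _ =>
      (hd a b).const_mul _]
  simp only [sum_apply, Finset.mul_sum]
  refine Finset.sum_congr rfl fun a _ => ?_
  rw [fderiv_fun_sum fun b _ => (hd a b).const_mul _]
  simp only [sum_apply, Finset.mul_sum]
  refine Finset.sum_congr rfl fun b _ => ?_
  rw [fderiv_const_mul (hd a b)]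
  simp only [smul_apply, smul_eq_mul, pd]
  ring

/-- The coordinate change is linear, so the usual inhomogeneous term with its second derivatives is
absent and the Christoffel symbols transform as a tensor. -/
theorem christoffel_of_isometry (hA : IsUnit A.det)
    (hiso : ∀ᶠ y in 𝓝 x, IsIsometryAt h A y)
    (hd : ∀ i j, DifferentiableAt ℝ (fun y => h y i j) (A.mulVec x)) (k i j : Fin d) :
    christoffel h x k i j = ∑ m, A⁻¹ k m *
      ∑ a, ∑ b, A a i * A b j * christoffel h (A.mulVec x) m a b := by
  set L : Fin d → Fin d → Fin d → ℝ := fun l a b =>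
    pd a (fun y => h y l b) (A.mulVec x) + pd b (fun y => h y l a) (A.mulVec x)
      - pd l (fun y => h y a b) (A.mulVec x) with hL
  have hlow : ∀ l, pd i (fun y => h y l j) x + pd j (fun y => h y l i) x
      - pd l (fun y => h y i j) x
        = A.transpose.mulVec (fun c => ∑ a, ∑ b, A a i * A b j * L c a b) l := by
    intro l
    rw [pd_metric_of_isometry hiso hd, pd_metric_of_isometry hiso hd,
      pd_metric_of_isometry hiso hd]
    simp only [Matrix.mulVec, dotProduct, Matrix.transpose_apply, Finset.mul_sum]
    have e1 : ∑ c, ∑ a, ∑ b, A c i * A a l * A b j * pd c (fun y => h y a b) (A.mulVec x)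
        = ∑ c, ∑ a, ∑ b, A c l * (A a i * A b j * pd a (fun y => h y c b) (A.mulVec x)) := by
      rw [Finset.sum_comm]
      exact Finset.sum_congr rfl fun _ _ => Finset.sum_congr rfl fun _ _ =>
        Finset.sum_congr rfl fun _ _ => by ring
    have e2 : ∑ c, ∑ a, ∑ b, A c j * A a l * A b i * pd c (fun y => h y a b) (A.mulVec x)
        = ∑ c, ∑ a, ∑ b, A c l * (A a i * A b j * pd b (fun y => h y c a) (A.mulVec x)) := by
      rw [Finset.sum_comm]
      refine Finset.sum_congr rfl fun _ _ => ?_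
      rw [Finset.sum_comm]
      exact Finset.sum_congr rfl fun _ _ => Finset.sum_congr rfl fun _ _ => by ring
    rw [e1, e2, ← Finset.sum_add_distrib, ← Finset.sum_sub_distrib]
    refine Finset.sum_congr rfl fun c _ => ?_
    rw [← Finset.sum_add_distrib, ← Finset.sum_sub_distrib]
    refine Finset.sum_congr rfl fun a _ => ?_
    rw [← Finset.sum_add_distrib, ← Finset.sum_sub_distrib]
    refine Finset.sum_congr rfl fun b _ => ?_
    simp only [hL]
    ring
  have hAt : IsUnit A.transpose.det := by rwa [Matrix.det_transpose]
  have hinv : (h x)⁻¹ * A.transpose = A⁻¹ * (h (A.mulVec x))⁻¹ := by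
    have h1 : h x = A.transpose * h (A.mulVec x) * A := hiso.self_of_nhds
    rw [h1, Matrix.mul_inv_rev, Matrix.mul_inv_rev, mul_assoc, mul_assoc,
      Matrix.nonsing_inv_mul _ hAt, mul_one]
  have h1 : christoffel h x k i j = (1 / 2) * ((h x)⁻¹.mulVec
      (A.transpose.mulVec (fun c => ∑ a, ∑ b, A a i * A b j * L c a b))) k := by
    simp only [christoffel, hlow]
    rfl
  rw [h1, Matrix.mulVec_mulVec, hinv, ← Matrix.mulVec_mulVec]
  simp only [Matrix.mulVec, dotProduct, Finset.mul_sum, christoffel]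
  refine Finset.sum_congr rfl fun m _ => ?_
  rw [Finset.sum_comm]
  refine Finset.sum_congr rfl fun a _ => ?_
  rw [Finset.sum_comm]
  exact Finset.sum_congr rfl fun b _ => Finset.sum_congr rfl fun c _ => by
    simp only [hL]
    ring

theorem pd_christoffel_of_isometry (hA : IsUnit A.det)
    (hiso : ∀ᶠ y in 𝓝 x, IsIsometryAt h A y)
    (hd : ∀ᶠ y in 𝓝 x, ∀ i j, DifferentiableAt ℝ (fun y => h y i j) (A.mulVec y))
    (hΓ : ∀ k i j, DifferentiableAt ℝ (fun y => christoffel h y k i j) (A.mulVec x))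
    (e k i j : Fin d) :
    pd e (fun y => christoffel h y k i j) x = ∑ m, ∑ c, A⁻¹ k m * A c e *
      ∑ a, ∑ b, A a i * A b j * pd c (fun y => christoffel h y m a b) (A.mulVec x) := by
  have h1 : (fun y => christoffel h y k i j) =ᶠ[𝓝 x] fun y => (fun z => ∑ m, A⁻¹ k m *
      ∑ a, ∑ b, A a i * A b j * christoffel h z m a b) (A.mulVec y) := by
    filter_upwards [hiso.eventually_nhds, hd] with y hy hdy
    exact christoffel_of_isometry hA hy hdy k i j
  have hd3 : ∀ m a b, DifferentiableAt ℝ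
      (fun z => A a i * A b j * christoffel h z m a b) (A.mulVec x) :=
    fun m a b => (hΓ m a b).const_mul _
  have hd2 : ∀ m a, DifferentiableAt ℝ
      (fun z => ∑ b, A a i * A b j * christoffel h z m a b) (A.mulVec x) :=
    fun m a => DifferentiableAt.fun_sum fun b _ => hd3 m a b
  have hd1 : ∀ m, DifferentiableAt ℝ
      (fun z => ∑ a, ∑ b, A a i * A b j * christoffel h z m a b) (A.mulVec x) :=
    fun m => DifferentiableAt.fun_sum fun a _ => hd2 m a
  rw [pd, h1.fderiv_eq, ← pd, pd_comp_mulVec A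
    (DifferentiableAt.fun_sum fun m _ => (hd1 m).const_mul _), Finset.sum_comm]
  refine Finset.sum_congr rfl fun c _ => ?_
  rw [smul_eq_mul, pd, fderiv_fun_sum fun m _ => (hd1 m).const_mul _, sum_apply, Finset.mul_sum]
  refine Finset.sum_congr rfl fun m _ => ?_
  rw [fderiv_const_mul (hd1 m), fderiv_fun_sum fun a _ => hd2 m a]
  simp only [smul_apply, sum_apply, smul_eq_mul, Finset.mul_sum]
  refine Finset.sum_congr rfl fun a _ => ?_
  rw [fderiv_fun_sum fun b _ => hd3 m a b]
  simp only [sum_apply, Finset.mul_sum]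
  refine Finset.sum_congr rfl fun b _ => ?_
  rw [fderiv_const_mul (hΓ m a b)]
  simp only [smul_apply, smul_eq_mul, pd]
  ring

theorem ricci_of_isometry (hA : IsUnit A.det)
    (hiso : ∀ᶠ y in 𝓝 x, IsIsometryAt h A y)
    (hd : ∀ᶠ y in 𝓝 x, ∀ i j, DifferentiableAt ℝ (fun y => h y i j) (A.mulVec y))
    (hΓ : ∀ k i j, DifferentiableAt ℝ (fun y => christoffel h y k i j) (A.mulVec x))
    (i j : Fin d) :
    ricci h x i j = ∑ a, ∑ b, A a i * A b j * ricci h (A.mulVec x) a b := by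
  have hAi : A * A⁻¹ = 1 := Matrix.mul_nonsing_inv _ hA
  have hchr := christoffel_of_isometry hA hiso hd.self_of_nhds
  set G := christoffel h (A.mulVec x) with hG
  set E : Fin d → Fin d → Fin d → Fin d → ℝ := fun c m a b =>
    pd c (fun y => christoffel h y m a b) (A.mulVec x) with hE
  have t1 : ∑ k, pd k (fun y => christoffel h y k i j) x
      = ∑ a, ∑ b, A a i * A b j * ∑ m, E m m a b := by
    simp only [pd_christoffel_of_isometry hA hiso hd hΓ]
    rw [sum_contract hAi (fun c m => ∑ a, ∑ b, A a i * A b j * E c m a b), Finset.sum_comm]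
    refine Finset.sum_congr rfl fun a _ => ?_
    rw [Finset.sum_comm]
    exact Finset.sum_congr rfl fun b _ => by rw [Finset.mul_sum]
  have t2 : ∑ k, pd j (fun y => christoffel h y k i k) x
      = ∑ a, ∑ b, A a i * A b j * ∑ m, E b m a m := by
    simp only [pd_christoffel_of_isometry hA hiso hd hΓ]
    have h1 : ∀ k m, ∑ c, A⁻¹ k m * A c j * ∑ a, ∑ b, A a i * A b k * E c m a b
        = ∑ b, A⁻¹ k m * A b k * ∑ a, ∑ c, A a i * A c j * E c m a b := by
      intro k m
      simp only [Finset.mul_sum]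
      rw [Finset.sum_comm]
      conv_rhs => rw [Finset.sum_comm]
      refine Finset.sum_congr rfl fun a _ => ?_
      rw [Finset.sum_comm]
      exact Finset.sum_congr rfl fun b _ => Finset.sum_congr rfl fun c _ => by ring
    rw [Finset.sum_congr rfl fun k _ => Finset.sum_congr rfl fun m _ => h1 k m,
      sum_contract hAi (fun b m => ∑ a, ∑ c, A a i * A c j * E c m a b), Finset.sum_comm]
    refine Finset.sum_congr rfl fun a _ => ?_
    rw [Finset.sum_comm]
    exact Finset.sum_congr rfl fun b _ => by rw [Finset.mul_sum]
  have t3 : ∑ k, ∑ l, christoffel h x k k l * christoffel h x l i j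
      = ∑ a, ∑ b, A a i * A b j * ∑ k, ∑ l, G k k l * G l a b := by
    have h1 : ∀ l, ∑ k, christoffel h x k k l = ∑ b, A b l * ∑ m, G m m b := by
      intro l
      have h2 : ∀ k, christoffel h x k k l
          = ∑ m, ∑ a, A⁻¹ k m * A a k * ∑ b, A b l * G m a b := by
        intro k
        rw [hchr]
        refine Finset.sum_congr rfl fun m _ => ?_
        rw [Finset.mul_sum]
        refine Finset.sum_congr rfl fun a _ => ?_
        rw [Finset.mul_sum, Finset.mul_sum]
        exact Finset.sum_congr rfl fun b _ => by ring
      rw [Finset.sum_congr rfl fun k _ => h2 k,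
        sum_contract hAi (fun a m => ∑ b, A b l * G m a b), Finset.sum_comm]
      exact Finset.sum_congr rfl fun b _ => by rw [Finset.mul_sum]
    rw [Finset.sum_comm]
    simp only [← Finset.sum_mul, h1]
    have h3 : ∀ l, (∑ b, A b l * ∑ m, G m m b) * christoffel h x l i j
        = ∑ m, ∑ c, A⁻¹ l m * A c l *
          ((∑ q, G q q c) * ∑ a, ∑ b, A a i * A b j * G m a b) := by
      intro l
      rw [hchr, Finset.sum_mul_sum, Finset.sum_comm]
      exact Finset.sum_congr rfl fun m _ => Finset.sum_congr rfl fun c _ => by ring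
    rw [Finset.sum_congr rfl fun l _ => h3 l, sum_contract hAi (fun c m =>
      (∑ q, G q q c) * ∑ a, ∑ b, A a i * A b j * G m a b)]
    simp only [Finset.mul_sum]
    rw [Finset.sum_comm]
    refine Finset.sum_congr rfl fun a _ => ?_
    rw [Finset.sum_comm]
    refine Finset.sum_congr rfl fun b _ => ?_
    conv_rhs => rw [Finset.sum_comm]
    refine Finset.sum_congr rfl fun m _ => ?_
    rw [Finset.sum_mul]
    exact Finset.sum_congr rfl fun q _ => by ring
  have t4 : ∑ k, ∑ l, christoffel h x k j l * christoffel h x l i k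
      = ∑ a, ∑ b, A a i * A b j * ∑ k, ∑ l, G k b l * G l a k := by
    -- With the first lower index fixed, the Christoffel symbols form a matrix that transforms by
    -- conjugation with `A`. The quadratic term of the Ricci tensor is the trace of a product of two
    -- such matrices, and the conjugation disappears by cyclicity.
    set M : Fin d → Matrix (Fin d) (Fin d) ℝ := fun e =>
      Matrix.of fun m b => ∑ a, A a e * G m a b with hM
    have h1 : ∀ e k l, christoffel h x k e l = (A⁻¹ * M e * A) k l := by
      intro e k l
      rw [hchr, mul_assoc, Matrix.mul_apply]
      refine Finset.sum_congr rfl fun m _ => ?_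
      congr 1
      rw [Matrix.mul_apply, Finset.sum_comm]
      refine Finset.sum_congr rfl fun b _ => ?_
      simp only [hM, Matrix.of_apply]
      rw [Finset.sum_mul]
      exact Finset.sum_congr rfl fun a _ => by ring
    have h2 : ∑ k, ∑ l, christoffel h x k j l * christoffel h x l i k
        = ((A⁻¹ * M j * A) * (A⁻¹ * M i * A)).trace := by
      simp only [Matrix.trace, Matrix.diag, Matrix.mul_apply (M := A⁻¹ * M j * A), h1]
    have h3 : (A⁻¹ * M j * A) * (A⁻¹ * M i * A) = A⁻¹ * (M j * M i) * A := by
      rw [mul_assoc (A⁻¹ * M j), mul_assoc A⁻¹ (M i), ← mul_assoc A, hAi, one_mul]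
      simp only [mul_assoc]
    rw [h2, h3, Matrix.trace_mul_comm, ← mul_assoc, hAi, one_mul, Matrix.trace]
    have h4 : ∀ k l, (∑ b, A b j * G k b l) * ∑ a, A a i * G l a k
        = ∑ a, ∑ b, A a i * A b j * (G k b l * G l a k) := by
      intro k l
      rw [Finset.sum_mul_sum, Finset.sum_comm]
      exact Finset.sum_congr rfl fun a _ => Finset.sum_congr rfl fun b _ => by ring
    simp only [Matrix.diag, Matrix.mul_apply, hM, Matrix.of_apply, h4, Finset.mul_sum]
    rw [Finset.sum_congr rfl fun k _ => Finset.sum_comm, Finset.sum_comm]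
    refine Finset.sum_congr rfl fun a _ => ?_
    rw [Finset.sum_congr rfl fun k _ => Finset.sum_comm, Finset.sum_comm]
  simp only [ricci, Finset.sum_sub_distrib]
  rw [t1, t2, t3, t4]
  simp only [← hG, mul_add, mul_sub, Finset.sum_add_distrib, Finset.sum_sub_distrib]
  rfl

theorem sum_fin_succ_fun {M : Type*} [AddCommMonoid M] (F : (Fin (n + 1) → Fin d) → M) :
    ∑ i, F i = ∑ c : Fin d, ∑ j : Fin n → Fin d, F (Fin.cons c j) := by
  rw [← Fintype.sum_prod_type']
  exact (Equiv.sum_comp (Fin.consEquiv fun _ : Fin (n + 1) => Fin d) F).symm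

theorem covDeriv_of_isometry {T : Chart d → Tensor d n} (hA : IsUnit A.det)
    (hiso : ∀ᶠ y in 𝓝 x, IsIsometryAt h A y)
    (hd : ∀ i j, DifferentiableAt ℝ (fun y => h y i j) (A.mulVec x))
    (hT : ∀ᶠ y in 𝓝 x, T y = pull (A.map Complex.ofReal) (T (A.mulVec y)))
    (hTd : ∀ i, DifferentiableAt ℝ (fun y => T y i) (A.mulVec x)) :
    covDeriv h T x = pull (A.map Complex.ofReal) (covDeriv h T (A.mulVec x)) := by
  funext i
  have hAi : A * A⁻¹ = 1 := Matrix.mul_nonsing_inv _ hA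
  have hchr := christoffel_of_isometry hA hiso hd
  have e1 : pd (i 0) (fun y => T y (Fin.tail i)) x = ∑ c, ∑ j : Fin n → Fin d,
      (A c (i 0) : ℂ) * (∏ k, (A (j k) (Fin.tail i k) : ℂ)) * pd c (fun y => T y j) (A.mulVec x) := by
    have h1 : (fun y => T y (Fin.tail i)) =ᶠ[𝓝 x] fun y => (fun z =>
        ∑ j : Fin n → Fin d, (∏ k, (A (j k) (Fin.tail i k) : ℂ)) * T z j) (A.mulVec y) := by
      filter_upwards [hT] with y hy
      rw [hy]
      rfl
    rw [pd, h1.fderiv_eq, ← pd, pd_comp_mulVec A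
      (DifferentiableAt.fun_sum fun j _ => (hTd j).const_mul _)]
    refine Finset.sum_congr rfl fun c _ => ?_
    rw [pd, fderiv_fun_sum fun j _ => (hTd j).const_mul _]
    simp only [sum_apply, Finset.smul_sum]
    refine Finset.sum_congr rfl fun j _ => ?_
    rw [fderiv_const_mul (hTd j)]
    simp only [smul_apply, smul_eq_mul, Complex.real_smul, pd]
    ring
  have e2 : ∀ k : Fin n, ∑ l : Fin d, (christoffel h x l (i 0) (Fin.tail i k) : ℂ)
        * T x (Function.update (Fin.tail i) k l)
      = ∑ c, ∑ j : Fin n → Fin d, (A c (i 0) : ℂ) * (∏ q, (A (j q) (Fin.tail i q) : ℂ)) *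
        ∑ l, (christoffel h (A.mulVec x) l c (j k) : ℂ)
          * T (A.mulVec x) (Function.update j k l) := by
    intro k
    have hprod : ∀ (j : Fin n → Fin d) (l : Fin d),
        ∏ q, (A (j q) (Function.update (Fin.tail i) k l q) : ℂ)
          = A (j k) l * ∏ q ∈ Finset.univ.erase k, (A (j q) (Fin.tail i q) : ℂ) := by
      intro j l
      rw [← Finset.mul_prod_erase _ _ (Finset.mem_univ k), Function.update_self]
      congr 1
      refine Finset.prod_congr rfl fun q hq => ?_
      rw [Function.update_of_ne (Finset.ne_of_mem_erase hq)]
    have hprod' : ∀ (j : Fin n → Fin d) (b : Fin d),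
        ∏ q, (A (Function.update j k b q) (Fin.tail i q) : ℂ)
          = A b (Fin.tail i k) * ∏ q ∈ Finset.univ.erase k, (A (j q) (Fin.tail i q) : ℂ) := by
      intro j l
      rw [← Finset.mul_prod_erase _ _ (Finset.mem_univ k), Function.update_self]
      congr 1
      refine Finset.prod_congr rfl fun q hq => ?_
      rw [Function.update_of_ne (Finset.ne_of_mem_erase hq)]
    have hpush : ∀ m : Fin d, ∑ l, A m l * christoffel h x l (i 0) (Fin.tail i k)
        = ∑ a, ∑ b, A a (i 0) * A b (Fin.tail i k) * christoffel h (A.mulVec x) m a b := by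
      intro m
      have h2 : ∑ l, A m l * christoffel h x l (i 0) (Fin.tail i k) = A.mulVec (A⁻¹.mulVec
          fun m => ∑ a, ∑ b, A a (i 0) * A b (Fin.tail i k)
            * christoffel h (A.mulVec x) m a b) m := by
        simp only [hchr]
        rfl
      rw [h2, Matrix.mulVec_mulVec, hAi, Matrix.one_mulVec]
    have hl : ∑ l : Fin d, (christoffel h x l (i 0) (Fin.tail i k) : ℂ)
        * T x (Function.update (Fin.tail i) k l)
        = ∑ j : Fin n → Fin d, (∏ q ∈ Finset.univ.erase k, (A (j q) (Fin.tail i q) : ℂ)) *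
          ((∑ a, ∑ b, A a (i 0) * A b (Fin.tail i k)
            * christoffel h (A.mulVec x) (j k) a b : ℝ) : ℂ) * T (A.mulVec x) j := by
      rw [hT.self_of_nhds]
      simp only [pull, Matrix.map_apply, hprod, Finset.mul_sum]
      rw [Finset.sum_comm]
      refine Finset.sum_congr rfl fun j _ => ?_
      rw [← hpush, Complex.ofReal_sum, Finset.mul_sum, Finset.sum_mul]
      refine Finset.sum_congr rfl fun l _ => ?_
      push_cast
      ring
    rw [hl]
    -- The index contracted between `T` and the Christoffel symbol is renamed by `sum_sum_update`,
    -- so that `T` carries the unmodified multi-index, as on the left-hand side.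
    have hr : ∀ c, ∑ j : Fin n → Fin d, (A c (i 0) : ℂ) *
        (∏ q, (A (j q) (Fin.tail i q) : ℂ)) *
        ∑ l, (christoffel h (A.mulVec x) l c (j k) : ℂ)
          * T (A.mulVec x) (Function.update j k l)
        = ∑ j : Fin n → Fin d, ∑ b, (A c (i 0) : ℂ) * (A b (Fin.tail i k) *
          ∏ q ∈ Finset.univ.erase k, (A (j q) (Fin.tail i q) : ℂ)) *
          (christoffel h (A.mulVec x) (j k) c b : ℂ) * T (A.mulVec x) j := by
      intro c
      rw [← sum_sum_update k]
      refine Finset.sum_congr rfl fun j _ => ?_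
      rw [Finset.mul_sum]
      refine Finset.sum_congr rfl fun l _ => ?_
      rw [Function.update_self]
      have h3 := hprod' (Function.update j k l) (j k)
      rw [Function.update_idem, Function.update_eq_self] at h3
      rw [h3]
      ring
    rw [Finset.sum_congr rfl fun c _ => hr c, Finset.sum_comm]
    refine Finset.sum_congr rfl fun j _ => ?_
    push_cast
    simp only [Finset.mul_sum, Finset.sum_mul]
    exact Finset.sum_congr rfl fun a _ => Finset.sum_congr rfl fun b _ => by ring
  rw [pull, sum_fin_succ_fun]
  simp only [covDeriv, Fin.cons_zero, Fin.tail_cons, Fin.prod_univ_succ, Fin.cons_succ,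
    Matrix.map_apply, mul_sub, Finset.sum_sub_distrib]
  have ht : ∀ k : Fin n, i k.succ = Fin.tail i k := fun _ => rfl
  simp only [ht]
  rw [e1]
  congr 1
  simp only [Finset.mul_sum (s := (Finset.univ : Finset (Fin n)))]
  rw [Finset.sum_congr rfl fun k _ => e2 k, Finset.sum_comm]
  refine Finset.sum_congr rfl fun c _ => ?_
  rw [Finset.sum_comm]

end Equivariance

/-! ### Equivariance of the multipole recursion -/

section MultipoleEquivariance

variable {d n : ℕ} {h B : MetricField d} {A : Matrix (Fin d) (Fin d) ℝ}

theorem AnalyticFrame.stfPart_equivariant (hB : AnalyticFrame h B) (hA : IsUnit A.det)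
    (hiso : ∀ᶠ x in 𝓝 0, IsIsometryAt h A x) {T : Chart d → Tensor d n}
    (hT : ∀ᶠ x in 𝓝 0, T x = pull (A.map Complex.ofReal) (T (A.mulVec x))) :
    ∀ᶠ x in 𝓝 0, Multipole.stfPart (h x) (T x)
      = pull (A.map Complex.ofReal) (Multipole.stfPart (h (A.mulVec x)) (T (A.mulVec x))) := by
  filter_upwards [hiso, hT, (tendsto_mulVec_zero A).eventually hB.isFrame] with x h1 h2 h3
  rw [← h3.stfPart_pull hA, ← h2, ← (h1 : h x = _)]

theorem AnalyticFrame.covDeriv_equivariant (hB : AnalyticFrame h B) (hA : IsUnit A.det)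
    (hiso : ∀ᶠ x in 𝓝 0, IsIsometryAt h A x) {T : Chart d → Tensor d n}
    (hTa : ∀ i, AnalyticAt ℝ (fun y => T y i) 0)
    (hT : ∀ᶠ x in 𝓝 0, T x = pull (A.map Complex.ofReal) (T (A.mulVec x))) :
    ∀ᶠ x in 𝓝 0, Multipole.covDeriv h T x
      = pull (A.map Complex.ofReal) (Multipole.covDeriv h T (A.mulVec x)) := by
  have h1 : ∀ᶠ x in 𝓝 0, ∀ i j, AnalyticAt ℝ (fun y => h y i j) x :=
    eventually_all.2 fun i => eventually_all.2 fun j => (hB.metric i j).eventually_analyticAt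
  have h2 : ∀ᶠ x in 𝓝 0, ∀ i, AnalyticAt ℝ (fun y => T y i) x :=
    eventually_all.2 fun i => (hTa i).eventually_analyticAt
  filter_upwards [hiso.eventually_nhds, hT.eventually_nhds,
    (tendsto_mulVec_zero A).eventually h1, (tendsto_mulVec_zero A).eventually h2]
    with x h3 h4 h5 h6
  exact covDeriv_of_isometry hA h3 (fun i j => (h5 i j).differentiableAt) h4
    (fun i => (h6 i).differentiableAt)

theorem AnalyticFrame.ricci_equivariant (hB : AnalyticFrame h B) (hA : IsUnit A.det)
    (hiso : ∀ᶠ x in 𝓝 0, IsIsometryAt h A x) :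
    ∀ᶠ x in 𝓝 0, ∀ i j, Multipole.ricci h x i j
      = ∑ a, ∑ b, A a i * A b j * Multipole.ricci h (A.mulVec x) a b := by
  have h1 : ∀ᶠ x in 𝓝 0, ∀ i j, AnalyticAt ℝ (fun y => h y i j) x :=
    eventually_all.2 fun i => eventually_all.2 fun j => (hB.metric i j).eventually_analyticAt
  have h2 : ∀ᶠ x in 𝓝 0, ∀ k i j, AnalyticAt ℝ (fun y => Multipole.christoffel h y k i j) x :=
    eventually_all.2 fun k => eventually_all.2 fun i => eventually_all.2 fun j =>
      (hB.christoffel k i j).eventually_analyticAt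
  filter_upwards [hiso.eventually_nhds, ((tendsto_mulVec_zero A).eventually h1).eventually_nhds,
    (tendsto_mulVec_zero A).eventually h2] with x h3 h4 h5
  exact ricci_of_isometry hA h3 (h4.mono fun y hy i j => (hy i j).differentiableAt)
    (fun k i j => (h5 k i j).differentiableAt)

theorem pull_ricci_mul {R R' : Fin d → Fin d → ℝ} (c : ℂ)
    (hR : ∀ i j, R i j = ∑ a, ∑ b, A a i * A b j * R' a b) (T : Tensor d n) :
    (fun i : Fin (n + 2) → Fin d => c * (R (i 0) (i 1) : ℂ)
        * pull (A.map Complex.ofReal) T (fun k => i k.succ.succ))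
      = pull (A.map Complex.ofReal) (fun i : Fin (n + 2) → Fin d => c * (R' (i 0) (i 1) : ℂ)
        * T (fun k => i k.succ.succ)) := by
  funext i
  have h1 : (1 : Fin (n + 2)) = Fin.succ 0 := rfl
  conv_rhs => rw [pull, sum_fin_succ_fun]
  rw [hR]
  push_cast
  rw [Finset.mul_sum, Finset.sum_mul]
  refine Finset.sum_congr rfl fun a _ => ?_
  rw [sum_fin_succ_fun, Finset.mul_sum, Finset.sum_mul]
  refine Finset.sum_congr rfl fun b _ => ?_
  rw [pull, Finset.mul_sum]
  refine Finset.sum_congr rfl fun j _ => ?_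
  simp only [h1, Fin.cons_zero, Fin.cons_succ, Fin.prod_univ_succ, Matrix.map_apply]
  ring

/-- Every ingredient of the recursion is natural under linear isometries. The case of interest is `x
= 0`, which `A` fixes: there the tensor is invariant under `A`. -/
theorem AnalyticFrame.multipoleTensor_equivariant {h B : MetricField 3} (hB : AnalyticFrame h B)
    {A : Matrix (Fin 3) (Fin 3) ℝ} (hA : IsUnit A.det)
    (hiso : ∀ᶠ x in 𝓝 0, IsIsometryAt h A x) {φ : Chart 3 → ℂ} (hφ : AnalyticAt ℝ φ 0)
    (hφA : ∀ᶠ x in 𝓝 0, φ x = φ (A.mulVec x)) : ∀ n : ℕ, ∀ᶠ x in 𝓝 0,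
      Multipole.multipoleTensor h φ n x
        = pull (A.map Complex.ofReal) (Multipole.multipoleTensor h φ n (A.mulVec x))
  | 0 => by
    filter_upwards [hφA] with x hx
    funext i
    simp [Multipole.multipoleTensor, pull, hx]
  | 1 => hB.stfPart_equivariant hA hiso (hB.covDeriv_equivariant hA hiso
      (hB.multipoleTensor hφ 0) (hB.multipoleTensor_equivariant hA hiso hφ hφA 0))
  | n + 2 => by
    refine hB.stfPart_equivariant hA hiso ?_
    filter_upwards [hB.covDeriv_equivariant hA hiso (hB.multipoleTensor hφ (n + 1))
      (hB.multipoleTensor_equivariant hA hiso hφ hφA (n + 1)),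
      hB.multipoleTensor_equivariant hA hiso hφ hφA n, hB.ricci_equivariant hA hiso]
      with x h1 h2 h3
    rw [h1, h2]
    have h4 := pull_ricci_mul (n := n) (((n : ℂ) + 1) * (2 * (n : ℂ) + 1) / 2) h3
      (Multipole.multipoleTensor h φ n (A.mulVec x))
    have h5 := pull_sub (A.map Complex.ofReal)
      (Multipole.covDeriv h (Multipole.multipoleTensor h φ (n + 1)) (A.mulVec x))
      (fun i : Fin (n + 2) → Fin 3 => (((n : ℂ) + 1) * (2 * (n : ℂ) + 1) / 2)
        * (Multipole.ricci h (A.mulVec x) (i 0) (i 1) : ℂ)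
        * Multipole.multipoleTensor h φ n (A.mulVec x) (fun k => i k.succ.succ))
    rw [← h4] at h5
    exact h5.symm

end MultipoleEquivariance

/-! ### Curvature at a point where the metric is diagonal -/

section Jets

variable {d : ℕ}

theorem pd_add {f g : Chart d → ℝ} {x : Chart d} (hf : DifferentiableAt ℝ f x)
    (hg : DifferentiableAt ℝ g x) (k : Fin d) :
    pd k (fun y => f y + g y) x = pd k f x + pd k g x := by
  simp [pd, fderiv_fun_add hf hg]

theorem pd_sub {f g : Chart d → ℝ} {x : Chart d} (hf : DifferentiableAt ℝ f x)
    (hg : DifferentiableAt ℝ g x) (k : Fin d) :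
    pd k (fun y => f y - g y) x = pd k f x - pd k g x := by
  simp [pd, fderiv_fun_sub hf hg]

theorem pd_mul {f g : Chart d → ℝ} {x : Chart d} (hf : DifferentiableAt ℝ f x)
    (hg : DifferentiableAt ℝ g x) (k : Fin d) :
    pd k (fun y => f y * g y) x = pd k f x * g x + f x * pd k g x := by
  simp [pd, fderiv_fun_mul hf hg]
  ring

theorem pd_const (c : ℝ) (x : Chart d) (k : Fin d) : pd k (fun _ : Chart d => c) x = 0 := by
  simp [pd]

theorem pd_const_mul (c : ℝ) {g : Chart d → ℝ} {x : Chart d}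
    (hg : DifferentiableAt ℝ g x) (k : Fin d) :
    pd k (fun y => c * g y) x = c * pd k g x := by
  rw [pd_mul (differentiableAt_const c) hg, pd_const]
  ring

theorem pd_sum {ι : Type*} (s : Finset ι) {f : ι → Chart d → ℝ} {x : Chart d}
    (hf : ∀ i ∈ s, DifferentiableAt ℝ (f i) x) (k : Fin d) :
    pd k (fun y => ∑ i ∈ s, f i y) x = ∑ i ∈ s, pd k (f i) x := by
  simp [pd, fderiv_fun_sum hf]

theorem pd_congr {F : Type*} [NormedAddCommGroup F] [NormedSpace ℝ F] {f g : Chart d → F}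
    {x : Chart d} (h : f =ᶠ[𝓝 x] g) (k : Fin d) : pd k f x = pd k g x := by
  rw [pd, pd, h.fderiv_eq]

theorem pd_exp {f : Chart d → ℝ} {x : Chart d} (hf : DifferentiableAt ℝ f x) (k : Fin d) :
    pd k (fun y => Real.exp (f y)) x = Real.exp (f x) * pd k f x := by
  simp [pd, hf.hasFDerivAt.exp.fderiv]

theorem pd_coord (x : Chart d) (k i : Fin d) :
    pd k (fun y : Chart d => y i) x = if i = k then 1 else 0 := by
  have h : HasFDerivAt (fun y : Chart d => y i) (ContinuousLinearMap.proj (R := ℝ) i) x :=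
    (ContinuousLinearMap.proj (R := ℝ) (φ := fun _ : Fin d => ℝ) i).hasFDerivAt
  rw [pd, h.fderiv]
  simp [Pi.single_apply]

theorem pd_pd_comm {f : Chart d → ℝ} {x : Chart d} (hf : AnalyticAt ℝ f x) (i j : Fin d) :
    pd i (pd j f) x = pd j (pd i f) x := by
  have hsymm : IsSymmSndFDerivAt ℝ f x := hf.contDiffAt.isSymmSndFDerivAt (n := 2) (by simp)
  have hd : DifferentiableAt ℝ (fderiv ℝ f) x := hf.fderiv.differentiableAt
  have h : ∀ k l : Fin d, pd k (pd l f) x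
      = fderiv ℝ (fderiv ℝ f) x (Pi.single k 1) (Pi.single l 1) := by
    intro k l
    have h1 : HasFDerivAt (pd l f)
        ((ContinuousLinearMap.apply ℝ ℝ (Pi.single l (1 : ℝ) : Chart d)).comp
          (fderiv ℝ (fderiv ℝ f) x)) x :=
      (ContinuousLinearMap.apply ℝ ℝ (Pi.single l (1 : ℝ) : Chart d)).hasFDerivAt.comp x
        hd.hasFDerivAt
    rw [pd, h1.fderiv]
    rfl
  rw [h, h]
  exact hsymm.eq _ _

variable {h : MetricField d} {p : Chart d} {g : Fin d → ℝ}

theorem inv_apply_of_diagonal (hunit : IsUnit (h p).det) (hp : h p = Matrix.diagonal g)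
    (hg : ∀ k, g k ≠ 0) (k l : Fin d) : (h p)⁻¹ k l = if k = l then (g k)⁻¹ else 0 := by
  have h1 := congrFun (congrFun (Matrix.mul_nonsing_inv _ hunit) k) l
  rw [Matrix.mul_apply, Matrix.one_apply] at h1
  have h2 : ∀ j, h p k j = if k = j then g k else 0 := by
    intro j
    rw [hp, Matrix.diagonal_apply]
  simp only [h2, ite_mul, zero_mul, Finset.sum_ite_eq, Finset.mem_univ, if_true] at h1
  split_ifs at h1 ⊢ with hkl
  · exact eq_inv_of_mul_eq_one_right h1
  · exact (mul_eq_zero.1 h1).resolve_left (hg k)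

theorem christoffel_of_diagonal (hunit : IsUnit (h p).det) (hp : h p = Matrix.diagonal g)
    (hg : ∀ k, g k ≠ 0) (k i j : Fin d) :
    christoffel h p k i j = (1 / 2) * (g k)⁻¹ * (pd i (fun y => h y k j) p
      + pd j (fun y => h y k i) p - pd k (fun y => h y i j) p) := by
  simp [christoffel, inv_apply_of_diagonal hunit hp hg, mul_assoc]

/-- Differentiate `h h⁻¹ = 1` at `p`. The curvature at `p` involves the inverse metric only through
its value and first derivatives, so no formula for it away from `p` is needed. -/
theorem pd_inv_of_diagonal (hunit : ∀ᶠ y in 𝓝 p, IsUnit (h y).det)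
    (hp : h p = Matrix.diagonal g) (hg : ∀ k, g k ≠ 0)
    (hd : ∀ i j, DifferentiableAt ℝ (fun y => h y i j) p)
    (hdi : ∀ i j, DifferentiableAt ℝ (fun y => (h y)⁻¹ i j) p) (m k l : Fin d) :
    pd m (fun y => (h y)⁻¹ k l) p
      = -(g k)⁻¹ * (g l)⁻¹ * pd m (fun y => h y k l) p := by
  have h1 : (fun y => ∑ j, h y k j * (h y)⁻¹ j l) =ᶠ[𝓝 p]
      fun _ => (1 : Matrix (Fin d) (Fin d) ℝ) k l := by
    filter_upwards [hunit] with y hy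
    rw [← Matrix.mul_nonsing_inv _ hy, Matrix.mul_apply]
  have h2 := pd_congr h1 m
  rw [pd_const, pd_sum _ (fun j _ => (hd k j).fun_mul (hdi j l))] at h2
  have h3 : ∀ j, h p k j = if k = j then g k else 0 := by
    intro j
    rw [hp, Matrix.diagonal_apply]
  simp only [pd_mul (hd _ _) (hdi _ _), inv_apply_of_diagonal hunit.self_of_nhds hp hg, h3,
    Finset.sum_add_distrib] at h2
  simp at h2
  have hk := hg k
  field_simp
  field_simp at h2
  linear_combination h2

theorem pd_christoffel_of_diagonal (hunit : ∀ᶠ y in 𝓝 p, IsUnit (h y).det)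
    (hp : h p = Matrix.diagonal g) (hg : ∀ k, g k ≠ 0)
    (hd : ∀ i j, DifferentiableAt ℝ (fun y => h y i j) p)
    (hdi : ∀ i j, DifferentiableAt ℝ (fun y => (h y)⁻¹ i j) p)
    (hdd : ∀ k i j, DifferentiableAt ℝ (pd k (fun y => h y i j)) p) (m k i j : Fin d) :
    pd m (fun y => christoffel h y k i j) p
      = (1 / 2) * (g k)⁻¹ * (pd m (pd i (fun y => h y k j)) p
          + pd m (pd j (fun y => h y k i)) p - pd m (pd k (fun y => h y i j)) p)
        - (1 / 2) * ∑ l, (g k)⁻¹ * (g l)⁻¹ * pd m (fun y => h y k l) p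
          * (pd i (fun y => h y l j) p + pd j (fun y => h y l i) p
            - pd l (fun y => h y i j) p) := by
  have hlow : ∀ l, DifferentiableAt ℝ (fun y => pd i (fun y => h y l j) y
      + pd j (fun y => h y l i) y - pd l (fun y => h y i j) y) p := fun l =>
    ((hdd i l j).add (hdd j l i)).sub (hdd l i j)
  have h1 : pd m (fun y => christoffel h y k i j) p = (1 / 2) * ∑ l,
      (pd m (fun y => (h y)⁻¹ k l) p * (pd i (fun y => h y l j) p
        + pd j (fun y => h y l i) p - pd l (fun y => h y i j) p)
      + (h p)⁻¹ k l * (pd m (pd i (fun y => h y l j)) p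
        + pd m (pd j (fun y => h y l i)) p - pd m (pd l (fun y => h y i j)) p)) := by
    have hs : DifferentiableAt ℝ (fun y => ∑ l, (h y)⁻¹ k l *
        (pd i (fun y => h y l j) y + pd j (fun y => h y l i) y - pd l (fun y => h y i j) y)) p :=
      DifferentiableAt.fun_sum fun l _ => (hdi k l).fun_mul (hlow l)
    simp only [christoffel]
    rw [pd_const_mul _ hs, pd_sum _ (fun l _ => (hdi k l).fun_mul (hlow l))]
    congr 1
    refine Finset.sum_congr rfl fun l _ => ?_
    rw [pd_mul (hdi k l) (hlow l), pd_sub ((hdd i l j).fun_add (hdd j l i)) (hdd l i j),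
      pd_add (hdd i l j) (hdd j l i)]
  rw [h1]
  simp only [pd_inv_of_diagonal hunit hp hg hd hdi,
    inv_apply_of_diagonal hunit.self_of_nhds hp hg, Finset.sum_add_distrib, ite_mul, zero_mul,
    Finset.sum_ite_eq, Finset.mem_univ, if_true, mul_add, neg_mul, Finset.sum_neg_distrib]
  ring

end Jets

/-! ### The curvature of an axially symmetric metric in a meridian plane -/

section Axial

/-- The rotation field `x ∂_y - y ∂_x`. -/
def rotVec (x : Chart 3) : Fin 3 → ℝ := ![-x 1, x 0, 0]

/-- The derivatives `∂_k v_i` of the rotation field. -/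
def rotVecDeriv : Fin 3 → Fin 3 → ℝ := ![![0, 1, 0], ![-1, 0, 0], ![0, 0, 0]]

/-- The metric `a δ_{ij} + σ v_i v_j`, where `v` is the rotation field. -/
def axialMetric (a σ : Chart 3 → ℝ) : MetricField 3 := fun x => Matrix.of fun i j =>
  a x * (if i = j then 1 else 0) + σ x * (rotVec x i * rotVec x j)

theorem differentiable_rotVec (i : Fin 3) : Differentiable ℝ (fun x : Chart 3 => rotVec x i) := by
  fin_cases i <;> simp [rotVec] <;> fun_prop

theorem pd_rotVec (x : Chart 3) (k i : Fin 3) :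
    pd k (fun y => rotVec y i) x = rotVecDeriv k i := by
  have h1 : pd k (fun y : Chart 3 => -y 1) x = -(if (1 : Fin 3) = k then 1 else 0) := by
    rw [← pd_coord x k 1]
    simp [pd]
  have h0 := pd_coord x k 0
  have h2 := pd_const 0 x k
  fin_cases i
  · simp only [rotVec, Fin.zero_eta, Matrix.cons_val_zero, h1]
    fin_cases k <;> simp [rotVecDeriv]
  · simp only [rotVec, Fin.mk_one, Matrix.cons_val_one, Matrix.cons_val_zero, h0]
    fin_cases k <;> simp [rotVecDeriv]
  · simp only [rotVec, Fin.reduceFinMk, Matrix.cons_val, h2]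
    fin_cases k <;> simp [rotVecDeriv]

variable {a σ : Chart 3 → ℝ} {x : Chart 3}

theorem differentiableAt_axialMetric (ha : DifferentiableAt ℝ a x) (hσ : DifferentiableAt ℝ σ x)
    (i j : Fin 3) : DifferentiableAt ℝ (fun y => axialMetric a σ y i j) x :=
  (ha.fun_mul (differentiableAt_const _)).fun_add
    (hσ.fun_mul ((differentiable_rotVec i x).fun_mul (differentiable_rotVec j x)))

theorem pd_axialMetric (ha : DifferentiableAt ℝ a x) (hσ : DifferentiableAt ℝ σ x)
    (k i j : Fin 3) :
    pd k (fun y => axialMetric a σ y i j) x = pd k a x * (if i = j then 1 else 0)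
      + pd k σ x * (rotVec x i * rotVec x j)
      + σ x * (rotVecDeriv k i * rotVec x j + rotVec x i * rotVecDeriv k j) := by
  have hi := differentiable_rotVec i x
  have hj := differentiable_rotVec j x
  simp only [axialMetric, Matrix.of_apply]
  rw [pd_add (ha.fun_mul (differentiableAt_const _)) (hσ.fun_mul (hi.fun_mul hj)),
    pd_mul ha (differentiableAt_const _), pd_const, pd_mul hσ (hi.fun_mul hj), pd_mul hi hj,
    pd_rotVec, pd_rotVec]
  ring

theorem eventually_pd_axialMetric (ha : AnalyticAt ℝ a x) (hσ : AnalyticAt ℝ σ x)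
    (k i j : Fin 3) :
    pd k (fun y => axialMetric a σ y i j) =ᶠ[𝓝 x] fun y => pd k a y * (if i = j then 1 else 0)
      + pd k σ y * (rotVec y i * rotVec y j)
      + σ y * (rotVecDeriv k i * rotVec y j + rotVec y i * rotVecDeriv k j) := by
  filter_upwards [ha.eventually_analyticAt, hσ.eventually_analyticAt] with y h1 h2
  exact pd_axialMetric h1.differentiableAt h2.differentiableAt k i j

theorem pd_pd_axialMetric (ha : AnalyticAt ℝ a x) (hσ : AnalyticAt ℝ σ x) (m k i j : Fin 3) :
    pd m (pd k (fun y => axialMetric a σ y i j)) x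
      = pd m (pd k a) x * (if i = j then 1 else 0)
      + pd m (pd k σ) x * (rotVec x i * rotVec x j)
      + pd k σ x * (rotVecDeriv m i * rotVec x j + rotVec x i * rotVecDeriv m j)
      + pd m σ x * (rotVecDeriv k i * rotVec x j + rotVec x i * rotVecDeriv k j)
      + σ x * (rotVecDeriv k i * rotVecDeriv m j + rotVecDeriv m i * rotVecDeriv k j) := by
  have hi := differentiable_rotVec i x
  have hj := differentiable_rotVec j x
  have ha1 := (analyticAt_pd ha k).differentiableAt
  have hσ1 := (analyticAt_pd hσ k).differentiableAt
  have hσ0 := hσ.differentiableAt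
  have hc : ∀ c : ℝ, DifferentiableAt ℝ (fun _ : Chart 3 => c) x := fun c =>
    differentiableAt_const c
  rw [pd_congr (eventually_pd_axialMetric ha hσ k i j) m,
    pd_add ((ha1.fun_mul (hc _)).fun_add (hσ1.fun_mul (hi.fun_mul hj)))
      (hσ0.fun_mul (((hc _).fun_mul hj).fun_add (hi.fun_mul (hc _)))),
    pd_add (ha1.fun_mul (hc _)) (hσ1.fun_mul (hi.fun_mul hj)),
    pd_mul ha1 (hc _), pd_mul hσ1 (hi.fun_mul hj), pd_mul hi hj,
    pd_mul hσ0 (((hc _).fun_mul hj).fun_add (hi.fun_mul (hc _))),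
    pd_add ((hc _).fun_mul hj) (hi.fun_mul (hc _)), pd_mul (hc _) hj, pd_mul hi (hc _),
    pd_rotVec, pd_rotVec, pd_const, pd_const, pd_const]
  ring

theorem differentiableAt_pd_axialMetric (ha : AnalyticAt ℝ a x) (hσ : AnalyticAt ℝ σ x)
    (k i j : Fin 3) : DifferentiableAt ℝ (pd k (fun y => axialMetric a σ y i j)) x := by
  have hi := differentiable_rotVec i x
  have hj := differentiable_rotVec j x
  have hc : ∀ c : ℝ, DifferentiableAt ℝ (fun _ : Chart 3 => c) x := fun c =>
    differentiableAt_const c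
  refine DifferentiableAt.congr_of_eventuallyEq ?_ (eventually_pd_axialMetric ha hσ k i j)
  exact (((analyticAt_pd ha k).differentiableAt.fun_mul (hc _)).fun_add
    ((analyticAt_pd hσ k).differentiableAt.fun_mul (hi.fun_mul hj))).fun_add
      (hσ.differentiableAt.fun_mul (((hc _).fun_mul hj).fun_add (hi.fun_mul (hc _))))

/-- The relations between the derivatives of an axisymmetric function in the plane `y = 0`. -/
structure AxialJet (f : Chart 3 → ℝ) (x : Chart 3) : Prop where
  d1 : pd 1 f x = 0
  d01 : pd 0 (pd 1 f) x = 0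
  d10 : pd 1 (pd 0 f) x = 0
  d21 : pd 2 (pd 1 f) x = 0
  d12 : pd 1 (pd 2 f) x = 0
  d11 : x 0 * pd 1 (pd 1 f) x = pd 0 f x
  d20 : pd 2 (pd 0 f) x = pd 0 (pd 2 f) x

/-- All relations result from `x ∂_y f = y ∂_x f`, its first derivatives at `y = 0`, and the
symmetry of second derivatives. -/
theorem axialJet_of_axisymmetric {f : Chart 3 → ℝ} (hf : AnalyticAt ℝ f x)
    (hrot : ∀ᶠ y in 𝓝 x, y 0 * pd 1 f y = y 1 * pd 0 f y) (hx0 : x 0 ≠ 0) (hx1 : x 1 = 0) :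
    AxialJet f x := by
  have hd0 := (analyticAt_pd hf 0).differentiableAt
  have hd1 := (analyticAt_pd hf 1).differentiableAt
  have hc : ∀ i : Fin 3, DifferentiableAt ℝ (fun y : Chart 3 => y i) x := fun i => by fun_prop
  have h1 : pd 1 f x = 0 := by
    have := hrot.self_of_nhds
    rw [hx1, zero_mul] at this
    exact (mul_eq_zero.1 this).resolve_left hx0
  have key : ∀ k, (if (0 : Fin 3) = k then 1 else 0) * pd 1 f x + x 0 * pd k (pd 1 f) x
      = (if (1 : Fin 3) = k then 1 else 0) * pd 0 f x + x 1 * pd k (pd 0 f) x := by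
    intro k
    have := pd_congr hrot k
    rwa [pd_mul (hc 0) hd1, pd_mul (hc 1) hd0, pd_coord, pd_coord] at this
  have h01 : pd 0 (pd 1 f) x = 0 := by
    have := key 0
    simpa [h1, hx1, hx0] using this
  have h21 : pd 2 (pd 1 f) x = 0 := by
    have := key 2
    simpa [h1, hx1, hx0] using this
  refine ⟨h1, h01, by rw [pd_pd_comm hf, h01], h21, by rw [pd_pd_comm hf, h21], ?_,
    pd_pd_comm hf 2 0⟩
  have := key 1
  simpa [h1, hx1] using this

end Axial

/-! ### Ricci tensor and connection along the null direction in the plane `y = 0` -/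

section Plane

variable {a σ : Chart 3 → ℝ} {x : Chart 3}

theorem axialMetric_eq_diagonal (hx1 : x 1 = 0) :
    axialMetric a σ x = Matrix.diagonal ![a x, a x + σ x * x 0 ^ 2, a x] := by
  ext i j
  fin_cases i <;> fin_cases j <;> simp [axialMetric, rotVec, hx1, sq]

/-- The hypotheses under which the connection of `a δ + σ v v` is computed at `x`. -/
structure AxialPoint (a σ : Chart 3 → ℝ) (x : Chart 3) : Prop where
  analytic_a : AnalyticAt ℝ a x
  analytic_σ : AnalyticAt ℝ σ x
  analytic_inv : ∀ i j, AnalyticAt ℝ (fun y => (axialMetric a σ y)⁻¹ i j) x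
  unit : ∀ᶠ y in 𝓝 x, IsUnit (axialMetric a σ y).det
  jet_a : AxialJet a x
  jet_σ : AxialJet σ x
  ne : x 0 ≠ 0
  eq : x 1 = 0
  a_ne : a x ≠ 0
  b_ne : a x + σ x * x 0 ^ 2 ≠ 0

theorem AxialPoint.diag_ne (h : AxialPoint a σ x) (k : Fin 3) :
    (![a x, a x + σ x * x 0 ^ 2, a x] : Fin 3 → ℝ) k ≠ 0 := by
  fin_cases k
  · exact h.a_ne
  · exact h.b_ne
  · exact h.a_ne

theorem AxialPoint.christoffel_eq (h : AxialPoint a σ x) (k i j : Fin 3) :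
    christoffel (axialMetric a σ) x k i j = (1 / 2)
      * ((![a x, a x + σ x * x 0 ^ 2, a x] : Fin 3 → ℝ) k)⁻¹
      * (pd i (fun y => axialMetric a σ y k j) x + pd j (fun y => axialMetric a σ y k i) x
        - pd k (fun y => axialMetric a σ y i j) x) :=
  christoffel_of_diagonal h.unit.self_of_nhds (axialMetric_eq_diagonal h.eq) h.diag_ne k i j

/-- The derivatives of `a = e^{2κ}` and `a + σ (x² + y²) = e^{2κ - 2β}` in the plane `y = 0`, in
terms of the derivatives `k` of `κ` and `u` of `β`. -/
structure PlaneJet (a σ : Chart 3 → ℝ) (x : Chart 3) (k u : Fin 3 → ℝ)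
    (k' u' : Fin 3 → Fin 3 → ℝ) (b : ℝ) : Prop where
  b_ne : b ≠ 0
  val : σ x * x 0 ^ 2 = b - a x
  a0 : pd 0 a x = 2 * a x * k 0
  a2 : pd 2 a x = 2 * a x * k 2
  a00 : pd 0 (pd 0 a) x = a x * (2 * k' 0 0 + 4 * k 0 * k 0)
  a02 : pd 0 (pd 2 a) x = a x * (2 * k' 0 2 + 4 * k 0 * k 2)
  a22 : pd 2 (pd 2 a) x = a x * (2 * k' 2 2 + 4 * k 2 * k 2)
  s0 : pd 0 σ x * x 0 ^ 2 + 2 * x 0 * σ x = 2 * b * (k 0 - u 0) - 2 * a x * k 0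
  s2 : pd 2 σ x * x 0 ^ 2 = 2 * b * (k 2 - u 2) - 2 * a x * k 2
  s00 : pd 0 (pd 0 σ) x * x 0 ^ 2 + 4 * x 0 * pd 0 σ x + 2 * σ x
    = b * (2 * (k' 0 0 - u' 0 0) + 4 * (k 0 - u 0) * (k 0 - u 0))
      - a x * (2 * k' 0 0 + 4 * k 0 * k 0)
  s02 : pd 0 (pd 2 σ) x * x 0 ^ 2 + 2 * x 0 * pd 2 σ x
    = b * (2 * (k' 0 2 - u' 0 2) + 4 * (k 0 - u 0) * (k 2 - u 2))
      - a x * (2 * k' 0 2 + 4 * k 0 * k 2)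
  s22 : pd 2 (pd 2 σ) x * x 0 ^ 2
    = b * (2 * (k' 2 2 - u' 2 2) + 4 * (k 2 - u 2) * (k 2 - u 2))
      - a x * (2 * k' 2 2 + 4 * k 2 * k 2)

variable {k u : Fin 3 → ℝ} {k' u' : Fin 3 → Fin 3 → ℝ} {b : ℝ}

-- Up to the factor `-i`, this is the part of `Ric(η,η)` for `η = ∂_z - i ∂_x` that comes from the
-- mixed components; `AxialPoint.ricci_diff` supplies the rest. The relations of `PlaneJet`
-- eliminate `σ` in favour of `β` and `κ`, after which only `1 / x` survives as a denominator.
set_option maxHeartbeats 1000000 in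
theorem AxialPoint.ricci_mixed (h : AxialPoint a σ x) (hj : PlaneJet a σ x k u k' u' b) :
    ricci (axialMetric a σ) x 0 2 + ricci (axialMetric a σ) x 2 0
      = 2 * u' 0 2 - 2 * u 0 * u 2 + 2 * u 2 / x 0 - 2 * k' 0 2 + 2 * k 0 * k 2 := by
  have ha := h.analytic_a.differentiableAt
  have hσ := h.analytic_σ.differentiableAt
  have hpd := pd_christoffel_of_diagonal h.unit (axialMetric_eq_diagonal h.eq) h.diag_ne
    (differentiableAt_axialMetric ha hσ) (fun i j => (h.analytic_inv i j).differentiableAt)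
    (differentiableAt_pd_axialMetric h.analytic_a h.analytic_σ)
  obtain ⟨a1, a01, a10, a21, a12, a11, a20⟩ := h.jet_a
  obtain ⟨s1, s01, s10, s21, s12, s11, s20⟩ := h.jet_σ
  simp only [ricci, h.christoffel_eq, hpd, pd_axialMetric ha hσ,
    pd_pd_axialMetric h.analytic_a h.analytic_σ, Fin.sum_univ_three]
  simp [rotVec, rotVecDeriv, h.eq, a1, a01, a10, a21, a12, a20, s1, s01, s10, s21, s12, s20]
  have hx := h.ne
  have hA := h.a_ne
  have hb := hj.b_ne
  have e0 : σ x = (b - a x) / x 0 ^ 2 := by rw [← hj.val]; field_simp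
  have e1 : a x + σ x * x 0 ^ 2 = b := by rw [hj.val]; ring
  have f2 : pd 2 σ x = (2 * b * (k 2 - u 2) - 2 * a x * k 2) / x 0 ^ 2 := by
    rw [← hj.s2]; field_simp
  have f0 : pd 0 σ x = (2 * b * (k 0 - u 0) - 2 * a x * k 0 - 2 * x 0 * σ x) / x 0 ^ 2 := by
    rw [← hj.s0]; field_simp; ring
  have f02 : pd 0 (pd 2 σ) x = (b * (2 * (k' 0 2 - u' 0 2) + 4 * (k 0 - u 0) * (k 2 - u 2))
      - a x * (2 * k' 0 2 + 4 * k 0 * k 2) - 2 * x 0 * pd 2 σ x) / x 0 ^ 2 := by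
    rw [← hj.s02]; field_simp; ring
  simp only [e1]
  simp only [f02, f0, f2, e0, hj.a0, hj.a2, hj.a02]
  field_simp
  ring

set_option maxHeartbeats 1000000 in
theorem AxialPoint.ricci_diff (h : AxialPoint a σ x) (hj : PlaneJet a σ x k u k' u' b) :
    ricci (axialMetric a σ) x 2 2 - ricci (axialMetric a σ) x 0 0
      = u' 2 2 - u' 0 0 - u 2 ^ 2 + u 0 ^ 2 - 2 * u 0 / x 0 - k' 2 2 + k' 0 0
        + k 2 ^ 2 - k 0 ^ 2 := by
  have ha := h.analytic_a.differentiableAt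
  have hσ := h.analytic_σ.differentiableAt
  have hpd := pd_christoffel_of_diagonal h.unit (axialMetric_eq_diagonal h.eq) h.diag_ne
    (differentiableAt_axialMetric ha hσ) (fun i j => (h.analytic_inv i j).differentiableAt)
    (differentiableAt_pd_axialMetric h.analytic_a h.analytic_σ)
  obtain ⟨a1, a01, a10, a21, a12, a11, a20⟩ := h.jet_a
  obtain ⟨s1, s01, s10, s21, s12, s11, s20⟩ := h.jet_σ
  simp only [ricci, h.christoffel_eq, hpd, pd_axialMetric ha hσ,
    pd_pd_axialMetric h.analytic_a h.analytic_σ, Fin.sum_univ_three]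
  simp [rotVec, rotVecDeriv, h.eq, a1, a01, a10, a21, a12, a20, s1, s01, s10, s21, s12, s20]
  have hx := h.ne
  have hA := h.a_ne
  have hb := hj.b_ne
  have e0 : σ x = (b - a x) / x 0 ^ 2 := by rw [← hj.val]; field_simp
  have e1 : a x + σ x * x 0 ^ 2 = b := by rw [hj.val]; ring
  have g11 : pd 1 (pd 1 a) x = pd 0 a x / x 0 := by rw [← a11]; field_simp
  have f2 : pd 2 σ x = (2 * b * (k 2 - u 2) - 2 * a x * k 2) / x 0 ^ 2 := by
    rw [← hj.s2]; field_simp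
  have f0 : pd 0 σ x = (2 * b * (k 0 - u 0) - 2 * a x * k 0 - 2 * x 0 * σ x) / x 0 ^ 2 := by
    rw [← hj.s0]; field_simp; ring
  have f00 : pd 0 (pd 0 σ) x
      = (b * (2 * (k' 0 0 - u' 0 0) + 4 * (k 0 - u 0) * (k 0 - u 0))
        - a x * (2 * k' 0 0 + 4 * k 0 * k 0) - 4 * x 0 * pd 0 σ x - 2 * σ x) / x 0 ^ 2 := by
    rw [← hj.s00]; field_simp; ring
  have f22 : pd 2 (pd 2 σ) x
      = (b * (2 * (k' 2 2 - u' 2 2) + 4 * (k 2 - u 2) * (k 2 - u 2))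
        - a x * (2 * k' 2 2 + 4 * k 2 * k 2)) / x 0 ^ 2 := by
    rw [← hj.s22]; field_simp
  simp only [e1]
  simp only [g11, f00, f22, f0, f2, e0, hj.a0, hj.a2, hj.a00, hj.a22]
  field_simp
  ring

/-- `Γ^l_{ij} η^i η^j` is proportional to `η^l` for the null vector `η = ∂_z - i ∂_x`. -/
theorem AxialPoint.christoffel_nullDir (h : AxialPoint a σ x) (hj : PlaneJet a σ x k u k' u' b)
    (l : Fin 3) :
    ∑ i, ∑ j, (christoffel (axialMetric a σ) x l i j : ℂ) * nullDir i * nullDir j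
      = 2 * ((k 2 : ℂ) - Complex.I * k 0) * nullDir l := by
  have ha := h.analytic_a.differentiableAt
  have hσ := h.analytic_σ.differentiableAt
  have a1 := h.jet_a.d1
  have s1 := h.jet_σ.d1
  have hA : (a x : ℂ) ≠ 0 := by exact_mod_cast h.a_ne
  have hI := Complex.I_sq
  simp only [h.christoffel_eq, pd_axialMetric ha hσ, Fin.sum_univ_three]
  fin_cases l
  · simp [rotVec, rotVecDeriv, h.eq, a1, s1, nullDir, hj.a0, hj.a2]
    field_simp
    linear_combination (-k 0 : ℂ) * hI
  · simp [rotVec, rotVecDeriv, h.eq, a1, s1, nullDir, hj.a0, hj.a2]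
  · simp [rotVec, rotVecDeriv, h.eq, a1, s1, nullDir, hj.a0, hj.a2]
    field_simp
    linear_combination (-k 2 : ℂ) * hI

end Plane

/-! ### The rescaled metric near the origin -/

section AxialFrame

/-- Matrices `a δ + σ v v` act as `a` across `v` and as `a + (x² + y²) σ` along `v`, and products
multiply these two numbers. Inverses and orthonormality thereby reduce to scalar identities. -/
theorem axialMetric_mul (a σ a' σ' : Chart 3 → ℝ) (x : Chart 3) :
    axialMetric a σ x * axialMetric a' σ' x = axialMetric (fun y => a y * a' y)
      (fun y => a y * σ' y + σ y * a' y + σ y * σ' y * (y 0 ^ 2 + y 1 ^ 2)) x := by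
  ext i j
  fin_cases i <;> fin_cases j <;>
    simp [axialMetric, rotVec, Matrix.mul_apply, Fin.sum_univ_three] <;> ring

theorem axialMetric_transpose (a σ : Chart 3 → ℝ) (x : Chart 3) :
    (axialMetric a σ x).transpose = axialMetric a σ x := by
  ext i j
  simp [axialMetric, eq_comm, mul_comm (rotVec x i)]

/-- `σ` matters only through `(x² + y²) σ`, because `v` vanishes on the axis. This avoids knowing
the value of the analytic quotient there. -/
theorem axialMetric_congr {a σ a' σ' : Chart 3 → ℝ} {x y : Chart 3} (ha : a x = a' y)
    (hv : rotVec x = rotVec y)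
    (hσ : (x 0 ^ 2 + x 1 ^ 2) * σ x = (x 0 ^ 2 + x 1 ^ 2) * σ' y) :
    axialMetric a σ x = axialMetric a' σ' y := by
  ext i j
  simp only [axialMetric, Matrix.of_apply, ha, ← hv]
  rcases eq_or_ne (x 0 ^ 2 + x 1 ^ 2) 0 with h0 | h0
  · have hx0 : x 0 = 0 := by nlinarith [sq_nonneg (x 0), sq_nonneg (x 1)]
    have hx1 : x 1 = 0 := by nlinarith [sq_nonneg (x 0), sq_nonneg (x 1)]
    have : ∀ i, rotVec x i = 0 := by
      intro i
      fin_cases i <;> simp [rotVec, hx0, hx1]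
    simp [this]
  · rw [mul_left_cancel₀ h0 hσ]

theorem axialMetric_eq_one {a σ : Chart 3 → ℝ} {x : Chart 3} (ha : a x = 1)
    (hσ : (x 0 ^ 2 + x 1 ^ 2) * σ x = 0) : axialMetric a σ x = 1 := by
  have h1 : axialMetric a σ x = axialMetric (fun _ => 1) (fun _ => 0) x :=
    axialMetric_congr ha rfl (by rw [hσ, mul_zero])
  rw [h1]
  ext i j
  simp [axialMetric, Matrix.one_apply]

theorem analyticAt_coord {d : ℕ} (i : Fin d) (x : Chart d) :
    AnalyticAt ℝ (fun y : Chart d => y i) x :=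
  (ContinuousLinearMap.proj (R := ℝ) (φ := fun _ : Fin d => ℝ) i).analyticAt x

theorem analyticAt_rotVec (i : Fin 3) (x : Chart 3) :
    AnalyticAt ℝ (fun y : Chart 3 => rotVec y i) x := by
  fin_cases i
  · exact (analyticAt_coord 1 x).neg
  · exact analyticAt_coord 0 x
  · exact analyticAt_const

theorem analyticAt_axialMetric {a σ : Chart 3 → ℝ} {x : Chart 3} (ha : AnalyticAt ℝ a x)
    (hσ : AnalyticAt ℝ σ x) (i j : Fin 3) :
    AnalyticAt ℝ (fun y => axialMetric a σ y i j) x :=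
  (ha.mul analyticAt_const).add (hσ.mul ((analyticAt_rotVec i x).mul (analyticAt_rotVec j x)))

/-- Axisymmetry near the origin. -/
def AxisymmetricNear {F : Type*} (f : Chart 3 → F) : Prop :=
  ∀ᶠ x in 𝓝 0, ∀ α : ℝ, f ((rotation α).mulVec x) = f x

theorem eventually_forall_rotation {P : Chart 3 → Prop} (hP : ∀ᶠ x in 𝓝 0, P x) :
    ∀ᶠ x in 𝓝 0, ∀ α : ℝ, P ((rotation α).mulVec x) := by
  obtain ⟨ε, hε, h⟩ := Metric.eventually_nhds_iff_ball.1 hP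
  filter_upwards [Metric.ball_mem_nhds (0 : Chart 3) (half_pos hε)] with x hx α
  refine h _ ?_
  rw [mem_ball_zero_iff] at hx ⊢
  rw [pi_norm_lt_iff hε]
  have hb : ∀ i, |x i| < ε / 2 := fun i => lt_of_le_of_lt (norm_le_pi_norm x i) hx
  have hc := Real.abs_cos_le_one α
  have hs := Real.abs_sin_le_one α
  have key : ∀ c s : ℝ, |c| ≤ 1 → |s| ≤ 1 → |c * x 0 + s * x 1| < ε := by
    intro c s hc hs
    calc |c * x 0 + s * x 1| ≤ |c * x 0| + |s * x 1| := abs_add_le _ _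
      _ ≤ 1 * |x 0| + 1 * |x 1| := by rw [abs_mul, abs_mul]; gcongr
      _ < ε := by linarith [hb 0, hb 1]
  intro i
  fin_cases i
  · simpa [rotation, Matrix.mulVec, dotProduct, Fin.sum_univ_three] using
      key (Real.cos α) (-Real.sin α) hc (by rwa [abs_neg])
  · simpa [rotation, Matrix.mulVec, dotProduct, Fin.sum_univ_three] using
      key (Real.sin α) (Real.cos α) hs hc
  · have h2 : |x 2| < ε := by linarith [hb 2]
    simpa [rotation, Matrix.mulVec, dotProduct, Fin.sum_univ_three] using h2

theorem rotation_radius (α : ℝ) (x : Chart 3) :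
    ((rotation α).mulVec x) 0 ^ 2 + ((rotation α).mulVec x) 1 ^ 2 = x 0 ^ 2 + x 1 ^ 2 := by
  simp [rotation, Matrix.mulVec, dotProduct, Fin.sum_univ_three]
  linear_combination (x 0 ^ 2 + x 1 ^ 2) * Real.sin_sq_add_cos_sq α

theorem rotation_congruence_axialMetric (a σ : Chart 3 → ℝ) (α : ℝ) (x : Chart 3) :
    (rotation α).transpose * axialMetric a σ ((rotation α).mulVec x) * rotation α
      = axialMetric (fun y => a ((rotation α).mulVec y)) (fun y => σ ((rotation α).mulVec y)) x := by
  have h := Real.sin_sq_add_cos_sq α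
  have h2 : Real.sin α ^ 2 = 1 - Real.cos α ^ 2 := by linarith
  have h4 : Real.sin α ^ 4 = (1 - Real.cos α ^ 2) ^ 2 := by rw [← h2]; ring
  ext i j
  fin_cases i <;> fin_cases j <;>
    simp [axialMetric, rotVec, rotation, Matrix.mul_apply, Fin.sum_univ_three,
      Matrix.mulVec, dotProduct] <;> ring_nf <;> simp only [h2, h4] <;> ring

/-- The data near the origin that determine the rescaled metric: `β = (x² + y²) b`. -/
structure AxialGeometry (κ β b : Chart 3 → ℝ) : Prop where
  analytic_κ : AnalyticAt ℝ κ 0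
  analytic_β : AnalyticAt ℝ β 0
  analytic_b : AnalyticAt ℝ b 0
  axisymmetric_κ : AxisymmetricNear κ
  axisymmetric_β : AxisymmetricNear β
  β_eq : ∀ᶠ x in 𝓝 0, β x = (x 0 ^ 2 + x 1 ^ 2) * b x

variable {κ β b : Chart 3 → ℝ}

theorem AxialGeometry.β_zero (hG : AxialGeometry κ β b) : β 0 = 0 := by
  simpa using hG.β_eq.self_of_nhds

/-- For every `c`, the function `(e^{c β} - 1) / (x² + y²)` is analytic. -/
theorem AxialGeometry.exists_exp_quotient (hG : AxialGeometry κ β b) (c : ℝ) :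
    ∃ s : Chart 3 → ℝ, AnalyticAt ℝ s 0 ∧
      ∀ᶠ x in 𝓝 0, (x 0 ^ 2 + x 1 ^ 2) * s x = Real.exp (c * β x) - 1 := by
  obtain ⟨E, hE, hE'⟩ := Multipole.exists_exp_quotient c
  have hE0 : AnalyticAt ℝ E (β 0) := by rwa [hG.β_zero]
  refine ⟨fun x => b x * E (β x), hG.analytic_b.mul (hE0.comp hG.analytic_β), ?_⟩
  filter_upwards [hG.β_eq] with x hx
  rw [hE', ← mul_assoc, ← hx]

/-- `(e^{-2β} - 1) / (x² + y²)`. -/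
noncomputable def AxialGeometry.s (hG : AxialGeometry κ β b) : Chart 3 → ℝ :=
  (hG.exists_exp_quotient (-2)).choose

theorem AxialGeometry.analytic_s (hG : AxialGeometry κ β b) : AnalyticAt ℝ hG.s 0 :=
  (hG.exists_exp_quotient (-2)).choose_spec.1

theorem AxialGeometry.s_eq (hG : AxialGeometry κ β b) :
    ∀ᶠ x in 𝓝 0, (x 0 ^ 2 + x 1 ^ 2) * hG.s x = Real.exp (-2 * β x) - 1 :=
  (hG.exists_exp_quotient (-2)).choose_spec.2

/-- The metric `e^{2κ} (δ + (e^{-2β} - 1) / (x² + y²) v v)`. -/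
noncomputable def AxialGeometry.metric (hG : AxialGeometry κ β b) : MetricField 3 :=
  axialMetric (fun x => Real.exp (2 * κ x)) (fun x => Real.exp (2 * κ x) * hG.s x)

theorem analyticAt_exp_mul {f : Chart 3 → ℝ} {x : Chart 3} (hf : AnalyticAt ℝ f x) (c : ℝ) :
    AnalyticAt ℝ (fun y => Real.exp (c * f y)) x :=
  (analyticAt_const.mul hf).rexp'

/-- The frame is the inverse square root of the metric: `e^{-κ}` across the rotation field and `e^{β
- κ}` along it. Both it and its inverse have the form `a δ + σ v v` with `σ` analytic, since
`(e^{±β} - 1) / (x² + y²)` is analytic. -/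
theorem AxialGeometry.exists_analyticFrame (hG : AxialGeometry κ β b) {h : MetricField 3}
    (hh : h =ᶠ[𝓝 0] hG.metric) : ∃ B, AnalyticFrame h B := by
  obtain ⟨t, hta, ht⟩ := hG.exists_exp_quotient 1
  obtain ⟨r, hra, hr⟩ := hG.exists_exp_quotient (-1)
  have hκm := analyticAt_exp_mul hG.analytic_κ (-1)
  have hκp := analyticAt_exp_mul hG.analytic_κ 1
  set B : MetricField 3 := axialMetric (fun x => Real.exp (-1 * κ x))
    (fun x => Real.exp (-1 * κ x) * t x) with hB
  set Bi : MetricField 3 := axialMetric (fun x => Real.exp (1 * κ x))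
    (fun x => Real.exp (1 * κ x) * r x) with hBi
  have hinv : ∀ᶠ x in 𝓝 0, B x * Bi x = 1 := by
    filter_upwards [ht, hr] with x h1 h2
    have e1 : Real.exp (-1 * κ x) * Real.exp (1 * κ x) = 1 := by
      rw [← Real.exp_add]
      simp
    have e2 : Real.exp (1 * β x) * Real.exp (-1 * β x) = 1 := by
      rw [← Real.exp_add]
      simp
    rw [hB, hBi, axialMetric_mul]
    refine axialMetric_eq_one e1 ?_
    have e3 : (1 + (x 0 ^ 2 + x 1 ^ 2) * t x) * (1 + (x 0 ^ 2 + x 1 ^ 2) * r x) = 1 := by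
      rw [h1, h2]
      linear_combination e2
    linear_combination (Real.exp (-1 * κ x) * Real.exp (1 * κ x)) * e3
  refine ⟨B, ⟨analyticAt_axialMetric hκm (hκm.mul hta), fun i j => ?_, ?_⟩⟩
  · refine (analyticAt_axialMetric hκp (hκp.mul hra) i j).congr ?_
    filter_upwards [hinv] with x hx
    exact (congrFun (congrFun (Matrix.inv_eq_right_inv hx) i) j).symm
  · filter_upwards [hinv, hh, ht, hG.s_eq] with x h1 h2 h3 h4
    refine ⟨Matrix.isUnit_det_of_right_inverse h1, ?_⟩
    have e1 : Real.exp (-1 * κ x) * Real.exp (2 * κ x) * Real.exp (-1 * κ x) = 1 := by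
      rw [← Real.exp_add, ← Real.exp_add]
      ring_nf
      simp
    have e2 : Real.exp (1 * β x) * Real.exp (-2 * β x) * Real.exp (1 * β x) = 1 := by
      rw [← Real.exp_add, ← Real.exp_add]
      ring_nf
      simp
    rw [h2, hB, AxialGeometry.metric, axialMetric_transpose, axialMetric_mul, axialMetric_mul]
    refine axialMetric_eq_one e1 ?_
    have e3 : (1 + (x 0 ^ 2 + x 1 ^ 2) * t x) * (1 + (x 0 ^ 2 + x 1 ^ 2) * hG.s x)
        * (1 + (x 0 ^ 2 + x 1 ^ 2) * t x) = 1 := by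
      rw [h3, h4]
      linear_combination e2
    linear_combination
      (Real.exp (-1 * κ x) * Real.exp (2 * κ x) * Real.exp (-1 * κ x)) * e3

theorem AxialGeometry.s_rotation (hG : AxialGeometry κ β b) :
    ∀ᶠ x in 𝓝 0, ∀ α : ℝ, (x 0 ^ 2 + x 1 ^ 2) * hG.s ((rotation α).mulVec x)
      = (x 0 ^ 2 + x 1 ^ 2) * hG.s x := by
  filter_upwards [hG.s_eq, eventually_forall_rotation hG.s_eq, hG.axisymmetric_β]
    with x h1 h2 h3 α
  have := h2 α
  rw [rotation_radius, h3 α] at this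
  rw [this, h1]

theorem AxialGeometry.isometry (hG : AxialGeometry κ β b) {h : MetricField 3}
    (hh : h =ᶠ[𝓝 0] hG.metric) (α : ℝ) :
    ∀ᶠ x in 𝓝 0, IsIsometryAt h (rotation α) x := by
  filter_upwards [hh, (tendsto_mulVec_zero (rotation α)).eventually hh, hG.s_rotation,
    hG.axisymmetric_κ] with x h1 h2 h3 h4
  rw [IsIsometryAt, h1, h2, AxialGeometry.metric, rotation_congruence_axialMetric]
  refine axialMetric_congr ?_ rfl ?_
  · simp only [h4 α]
  · simp only [h4 α]
    linear_combination -Real.exp (2 * κ x) * h3 α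

end AxialFrame

/-! ### Derivatives in the meridian plane -/

section PlaneJets

variable {f : Chart 3 → ℝ} {x : Chart 3}

theorem pd_exp_two (hf : DifferentiableAt ℝ f x) (i : Fin 3) :
    pd i (fun y => Real.exp (2 * f y)) x = 2 * Real.exp (2 * f x) * pd i f x := by
  rw [pd_exp (hf.const_mul 2), pd_const_mul _ hf]
  ring

theorem pd_pd_exp_two (hf : AnalyticAt ℝ f x) (i j : Fin 3) :
    pd i (pd j (fun y => Real.exp (2 * f y))) x
      = Real.exp (2 * f x) * (2 * pd i (pd j f) x + 4 * pd i f x * pd j f x) := by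
  have h1 : pd j (fun y => Real.exp (2 * f y)) =ᶠ[𝓝 x]
      fun y => (2 * Real.exp (2 * f y)) * pd j f y := by
    filter_upwards [hf.eventually_analyticAt] with y hy
    exact pd_exp_two hy.differentiableAt j
  have h2 := (analyticAt_exp_mul hf 2).differentiableAt
  rw [pd_congr h1, pd_mul (h2.const_mul 2) (analyticAt_pd hf j).differentiableAt,
    pd_const_mul _ h2, pd_exp_two hf.differentiableAt]
  ring

theorem pd_radius (x : Chart 3) (i : Fin 3) :
    pd i (fun y : Chart 3 => y 0 ^ 2 + y 1 ^ 2) x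
      = 2 * x 0 * (if (0 : Fin 3) = i then 1 else 0)
        + 2 * x 1 * (if (1 : Fin 3) = i then 1 else 0) := by
  have h : ∀ j : Fin 3, DifferentiableAt ℝ (fun y : Chart 3 => y j) x := fun j => by fun_prop
  simp only [sq]
  rw [pd_add ((h 0).fun_mul (h 0)) ((h 1).fun_mul (h 1)), pd_mul (h 0) (h 0), pd_mul (h 1) (h 1),
    pd_coord, pd_coord]
  ring

variable {σ ψ : Chart 3 → ℝ}

theorem pd_mul_radius (hσ : DifferentiableAt ℝ σ x) (i : Fin 3) :
    pd i (fun y => σ y * (y 0 ^ 2 + y 1 ^ 2)) x = pd i σ x * (x 0 ^ 2 + x 1 ^ 2)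
      + σ x * (2 * x 0 * (if (0 : Fin 3) = i then 1 else 0)
        + 2 * x 1 * (if (1 : Fin 3) = i then 1 else 0)) := by
  rw [pd_mul hσ (by fun_prop), pd_radius]

theorem pd_pd_mul_radius (hσ : AnalyticAt ℝ σ x) (i j : Fin 3) (hj : j ≠ 1) :
    pd j (pd i (fun y => σ y * (y 0 ^ 2 + y 1 ^ 2))) x
      = pd j (pd i σ) x * (x 0 ^ 2 + x 1 ^ 2)
        + pd i σ x * (2 * x 0 * (if (0 : Fin 3) = j then 1 else 0))
        + pd j σ x * (2 * x 0 * (if (0 : Fin 3) = i then 1 else 0)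
          + 2 * x 1 * (if (1 : Fin 3) = i then 1 else 0))
        + σ x * (2 * (if (0 : Fin 3) = j then 1 else 0) * (if (0 : Fin 3) = i then 1 else 0)) := by
  have h1 : pd i (fun y => σ y * (y 0 ^ 2 + y 1 ^ 2)) =ᶠ[𝓝 x] fun y =>
      pd i σ y * (y 0 ^ 2 + y 1 ^ 2)
      + σ y * (2 * y 0 * (if (0 : Fin 3) = i then 1 else 0)
        + 2 * y 1 * (if (1 : Fin 3) = i then 1 else 0)) := by
    filter_upwards [hσ.eventually_analyticAt] with y hy
    exact pd_mul_radius hy.differentiableAt i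
  have hd := (analyticAt_pd hσ i).differentiableAt
  have hs := hσ.differentiableAt
  have hc : ∀ k : Fin 3, DifferentiableAt ℝ (fun y : Chart 3 => y k) x := fun k => by fun_prop
  have hlin : pd j (fun y : Chart 3 => 2 * y 0 * (if (0 : Fin 3) = i then 1 else 0)
        + 2 * y 1 * (if (1 : Fin 3) = i then 1 else 0)) x
      = 2 * (if (0 : Fin 3) = j then 1 else 0) * (if (0 : Fin 3) = i then 1 else 0) := by
    have e : ∀ k : Fin 3, pd j (fun y : Chart 3 => 2 * y k * (if k = i then 1 else 0)) x
        = 2 * (if k = j then 1 else 0) * (if k = i then 1 else 0) := by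
      intro k
      rw [pd_mul ((hc k).const_mul 2) (by fun_prop), pd_const_mul _ (hc k), pd_coord, pd_const]
      ring
    rw [pd_add (by fun_prop) (by fun_prop), e, e, if_neg hj.symm]
    ring
  rw [pd_congr h1, pd_add (hd.fun_mul (by fun_prop)) (hs.fun_mul (by fun_prop)),
    pd_mul_radius hd, pd_mul hs (by fun_prop), hlin, if_neg hj.symm]
  ring

variable {κ β b : Chart 3 → ℝ}

/-- The relations for `σ` come from differentiating `σ (x² + y²) = e^{2(κ - β)} - e^{2κ}` at most
twice and setting `y = 0`. -/
theorem AxialGeometry.eventually_planeJet (hG : AxialGeometry κ β b) :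
    ∀ᶠ x in 𝓝 0, x 0 ≠ 0 → x 1 = 0 →
      PlaneJet (fun y => Real.exp (2 * κ y)) (fun y => Real.exp (2 * κ y) * hG.s y) x
        (fun i => pd i κ x) (fun i => pd i β x) (fun i j => pd i (pd j κ) x)
        (fun i j => pd i (pd j β) x) (Real.exp (2 * (κ x - β x))) := by
  filter_upwards [hG.analytic_κ.eventually_analyticAt, hG.analytic_β.eventually_analyticAt,
    hG.analytic_s.eventually_analyticAt, hG.s_eq.eventually_nhds] with x h1 h2 h3 h4 hx0 hx1
  set σ : Chart 3 → ℝ := fun y => Real.exp (2 * κ y) * hG.s y with hσ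
  have hσa : AnalyticAt ℝ σ x := (analyticAt_exp_mul h1 2).mul h3
  have hrel : (fun y => σ y * (y 0 ^ 2 + y 1 ^ 2)) =ᶠ[𝓝 x]
      fun y => Real.exp (2 * (κ y - β y)) - Real.exp (2 * κ y) := by
    filter_upwards [h4] with y hy
    have e : Real.exp (2 * (κ y - β y)) = Real.exp (2 * κ y) * Real.exp (-2 * β y) := by
      rw [← Real.exp_add]
      ring_nf
    rw [e]
    linear_combination Real.exp (2 * κ y) * hy
  have hsub : AnalyticAt ℝ (fun y => κ y - β y) x := h1.sub h2
  have hk := analyticAt_exp_mul h1 2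
  have hkb : AnalyticAt ℝ (fun y => Real.exp (2 * (κ y - β y))) x := analyticAt_exp_mul hsub 2
  have hpsub : ∀ i, pd i (fun y => κ y - β y) =ᶠ[𝓝 x] fun y => pd i κ y - pd i β y := by
    intro i
    filter_upwards [h1.eventually_analyticAt, h2.eventually_analyticAt] with y hy1 hy2
    exact pd_sub hy1.differentiableAt hy2.differentiableAt i
  have hp2 : ∀ i j, pd i (pd j (fun y => κ y - β y)) x
      = pd i (pd j κ) x - pd i (pd j β) x := by
    intro i j
    rw [pd_congr (hpsub j), pd_sub (analyticAt_pd h1 j).differentiableAt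
      (analyticAt_pd h2 j).differentiableAt]
  have hrel1 : ∀ i, pd i (fun y => σ y * (y 0 ^ 2 + y 1 ^ 2)) x
      = 2 * Real.exp (2 * (κ x - β x)) * (pd i κ x - pd i β x)
        - 2 * Real.exp (2 * κ x) * pd i κ x := by
    intro i
    rw [pd_congr hrel, pd_sub hkb.differentiableAt hk.differentiableAt,
      pd_exp_two hsub.differentiableAt, pd_exp_two h1.differentiableAt, (hpsub i).self_of_nhds]
  have hrel2 : ∀ i j, pd i (pd j (fun y => σ y * (y 0 ^ 2 + y 1 ^ 2))) x
      = Real.exp (2 * (κ x - β x)) * (2 * (pd i (pd j κ) x - pd i (pd j β) x)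
          + 4 * (pd i κ x - pd i β x) * (pd j κ x - pd j β x))
        - Real.exp (2 * κ x) * (2 * pd i (pd j κ) x + 4 * pd i κ x * pd j κ x) := by
    intro i j
    have e1 : pd j (fun y => σ y * (y 0 ^ 2 + y 1 ^ 2)) =ᶠ[𝓝 x] fun y =>
        pd j (fun y => Real.exp (2 * (κ y - β y))) y - pd j (fun y => Real.exp (2 * κ y)) y := by
      filter_upwards [hrel.eventually_nhds, hkb.eventually_analyticAt, hk.eventually_analyticAt]
        with y hy1 hy2 hy3
      rw [pd_congr hy1, pd_sub hy2.differentiableAt hy3.differentiableAt]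
    rw [pd_congr e1, pd_sub (analyticAt_pd hkb j).differentiableAt
      (analyticAt_pd hk j).differentiableAt, pd_pd_exp_two hsub, pd_pd_exp_two h1, hp2,
      (hpsub i).self_of_nhds, (hpsub j).self_of_nhds]
  have g0 := hrel1 0
  have g2 := hrel1 2
  have g00 := hrel2 0 0
  have g02 := hrel2 0 2
  have g22 := hrel2 2 2
  rw [pd_mul_radius hσa.differentiableAt] at g0 g2
  rw [pd_pd_mul_radius hσa _ _ (by decide)] at g00 g02 g22
  simp [hx1] at g0 g2 g00 g02 g22
  have gv := hrel.self_of_nhds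
  simp [hx1] at gv
  refine ⟨(Real.exp_pos _).ne', gv, pd_exp_two h1.differentiableAt 0,
    pd_exp_two h1.differentiableAt 2, pd_pd_exp_two h1 0 0, pd_pd_exp_two h1 0 2,
    pd_pd_exp_two h1 2 2, ?_, ?_, ?_, ?_, ?_⟩
  · linear_combination g0
  · linear_combination g2
  · linear_combination g00
  · linear_combination g02
  · linear_combination g22

theorem AxisymmetricNear.eventually_pd {f : Chart 3 → ℝ} (h : AxisymmetricNear f)
    (hf : AnalyticAt ℝ f 0) : ∀ᶠ x in 𝓝 0, x 0 * pd 1 f x = x 1 * pd 0 f x := by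
  filter_upwards [h, hf.eventually_analyticAt] with x h1 h2
  exact pd_of_axisymmetric h2.differentiableAt h1

theorem AxialGeometry.eventually_axialPoint (hG : AxialGeometry κ β b) :
    ∀ᶠ x in 𝓝 0, x 0 ≠ 0 → x 1 = 0 →
      AxialPoint (fun y => Real.exp (2 * κ y)) (fun y => Real.exp (2 * κ y) * hG.s y) x := by
  obtain ⟨B, hB⟩ := hG.exists_analyticFrame (h := hG.metric) EventuallyEq.rfl
  have hinv : ∀ᶠ x in 𝓝 0, ∀ i j, AnalyticAt ℝ (fun y => (hG.metric y)⁻¹ i j) x :=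
    eventually_all.2 fun i => eventually_all.2 fun j => (hB.inv i j).eventually_analyticAt
  filter_upwards [hG.analytic_κ.eventually_analyticAt, hG.analytic_s.eventually_analyticAt,
    hinv, hB.isFrame.eventually_nhds, hG.eventually_planeJet, hG.axisymmetric_κ.eventually_nhds,
    hG.s_rotation.eventually_nhds] with x h1 h2 h3 h4 h5 h6 h7 hx0 hx1
  have ha := analyticAt_exp_mul h1 2
  have hσ : AnalyticAt ℝ (fun y => Real.exp (2 * κ y) * hG.s y) x := ha.mul h2
  have hr : ∀ᶠ y : Chart 3 in 𝓝 x, y 0 ≠ 0 :=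
    (continuous_apply (0 : Fin 3)).continuousAt.eventually_ne hx0
  refine ⟨ha, hσ, h3, h4.mono fun y hy => hy.isUnit_det, ?_, ?_, hx0, hx1,
    (Real.exp_pos _).ne', ?_⟩
  · refine axialJet_of_axisymmetric ha ?_ hx0 hx1
    filter_upwards [h6, ha.eventually_analyticAt] with y hy1 hy2
    exact pd_of_axisymmetric hy2.differentiableAt fun α => by rw [hy1 α]
  · refine axialJet_of_axisymmetric hσ ?_ hx0 hx1
    filter_upwards [h6, h7, hσ.eventually_analyticAt, hr] with y hy1 hy2 hy3 hy4
    refine pd_of_axisymmetric hy3.differentiableAt fun α => ?_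
    have hne : y 0 ^ 2 + y 1 ^ 2 ≠ 0 := by positivity
    rw [hy1 α, mul_left_cancel₀ hne (hy2 α)]
  · have h8 := h5 hx0 hx1
    have h9 := h8.val
    rw [h9]
    simp

theorem christoffel_congr {d : ℕ} {h h' : MetricField d} {x : Chart d} (hh : h =ᶠ[𝓝 x] h')
    (k i j : Fin d) : christoffel h x k i j = christoffel h' x k i j := by
  have h1 : ∀ i j, (fun y => h y i j) =ᶠ[𝓝 x] fun y => h' y i j := fun i j =>
    hh.mono fun y hy => by simp only [hy]
  simp only [christoffel, hh.self_of_nhds, pd_congr (h1 _ _)]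

theorem ricci_congr {d : ℕ} {h h' : MetricField d} {x : Chart d} (hh : h =ᶠ[𝓝 x] h')
    (i j : Fin d) : ricci h x i j = ricci h' x i j := by
  have h1 : ∀ k i j, (fun y => christoffel h y k i j) =ᶠ[𝓝 x] fun y => christoffel h' y k i j :=
    fun k i j => hh.eventually_nhds.mono fun y hy => christoffel_congr hy k i j
  simp only [ricci, christoffel_congr hh, pd_congr (h1 _ _ _)]

/-! ### Contraction of the recursion with the null direction -/

/-- The derivative along the null vector `∂_z - i ∂_x`. -/
noncomputable def etaD (f : Chart 3 → ℂ) (x : Chart 3) : ℂ := ∑ i, nullDir i * pd i f x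

theorem analyticAt_etaD {f : Chart 3 → ℂ} {x : Chart 3} (hf : AnalyticAt ℝ f x) :
    AnalyticAt ℝ (etaD f) x :=
  Finset.analyticAt_fun_sum _ fun i _ => analyticAt_const.mul (analyticAt_pd hf i)

theorem pd_ofReal {f : Chart 3 → ℝ} {x : Chart 3} (hf : DifferentiableAt ℝ f x) (i : Fin 3) :
    pd i (fun y => (f y : ℂ)) x = ((pd i f x : ℝ) : ℂ) := by
  have h := (Complex.ofRealCLM.hasFDerivAt (x := f x)).comp x hf.hasFDerivAt
  have h2 : fderiv ℝ (fun y => (f y : ℂ)) x = _ := h.fderiv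
  rw [pd, h2]
  rfl

theorem etaD_ofReal {f : Chart 3 → ℝ} {x : Chart 3} (hf : DifferentiableAt ℝ f x) :
    etaD (fun y => (f y : ℂ)) x = ((pd 2 f x : ℝ) : ℂ) - Complex.I * ((pd 0 f x : ℝ) : ℂ) := by
  simp only [etaD, pd_ofReal hf, Fin.sum_univ_three]
  simp [nullDir]
  ring

theorem etaD_etaD_ofReal {f : Chart 3 → ℝ} {x : Chart 3} (hf : AnalyticAt ℝ f x) :
    etaD (etaD (fun y => (f y : ℂ))) x = ((pd 2 (pd 2 f) x : ℝ) : ℂ)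
      - ((pd 0 (pd 0 f) x : ℝ) : ℂ) - 2 * Complex.I * ((pd 0 (pd 2 f) x : ℝ) : ℂ) := by
  have h1 : etaD (fun y => (f y : ℂ)) =ᶠ[𝓝 x]
      fun y => ((pd 2 f y : ℝ) : ℂ) - Complex.I * ((pd 0 f y : ℝ) : ℂ) := by
    filter_upwards [hf.eventually_analyticAt] with y hy
    exact etaD_ofReal hy.differentiableAt
  have hd2 := (analyticAt_ofReal (analyticAt_pd hf 2)).differentiableAt
  have hd0 := (analyticAt_ofReal (analyticAt_pd hf 0)).differentiableAt
  have h2 : ∀ i, pd i (etaD (fun y => (f y : ℂ))) x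
      = ((pd i (pd 2 f) x : ℝ) : ℂ) - Complex.I * ((pd i (pd 0 f) x : ℝ) : ℂ) := by
    intro i
    rw [pd_congr h1, pd, fderiv_fun_sub hd2 (hd0.const_mul _), fderiv_const_mul hd0]
    have e2 := pd_ofReal (analyticAt_pd hf 2).differentiableAt i
    have e0 := pd_ofReal (analyticAt_pd hf 0).differentiableAt i
    rw [← e2, ← e0]
    simp [pd]
  have hc := pd_pd_comm hf 2 0
  rw [etaD, Fin.sum_univ_three, h2, h2, h2, hc]
  simp [nullDir]
  ring_nf
  simp
  ring

/-- `Ric(η,η) = R_zz - R_xx - i (R_xz + R_zx)`, and the two real formulas combine into derivatives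
along `η`. The factor `x` makes both sides analytic across the axis. -/
theorem AxialGeometry.ricci_nullDir (hG : AxialGeometry κ β b) {h : MetricField 3}
    (hh : h =ᶠ[𝓝 0] hG.metric) : ∀ᶠ x in 𝓝 0, x 0 ≠ 0 → x 1 = 0 →
      (x 0 : ℂ) * ∑ i, ∑ j, (ricci h x i j : ℂ) * nullDir i * nullDir j
        = x 0 * (etaD (etaD fun y => (β y : ℂ)) x - etaD (fun y => (β y : ℂ)) x ^ 2
            - etaD (etaD fun y => (κ y : ℂ)) x + etaD (fun y => (κ y : ℂ)) x ^ 2)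
          - 2 * Complex.I * etaD (fun y => (β y : ℂ)) x := by
  filter_upwards [hh.eventually_nhds, hG.eventually_axialPoint, hG.eventually_planeJet,
    hG.analytic_κ.eventually_analyticAt, hG.analytic_β.eventually_analyticAt]
    with x h1 h2 h3 h4 h5 hx0 hx1
  have hmix := (h2 hx0 hx1).ricci_mixed (h3 hx0 hx1)
  have hdiff := (h2 hx0 hx1).ricci_diff (h3 hx0 hx1)
  rw [← AxialGeometry.metric] at hmix hdiff
  simp only [← ricci_congr h1] at hmix hdiff
  rw [etaD_ofReal h4.differentiableAt, etaD_ofReal h5.differentiableAt, etaD_etaD_ofReal h4,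
    etaD_etaD_ofReal h5]
  have hx0' : (x 0 : ℂ) ≠ 0 := by exact_mod_cast hx0
  have hmix' := congrArg Complex.ofReal hmix
  have hdiff' := congrArg Complex.ofReal hdiff
  push_cast at hmix' hdiff'
  have e : ∑ i, ∑ j, (ricci h x i j : ℂ) * nullDir i * nullDir j
      = ((ricci h x 2 2 : ℂ) - ricci h x 0 0)
        - Complex.I * ((ricci h x 0 2 : ℂ) + ricci h x 2 0) := by
    simp only [Fin.sum_univ_three]
    simp [nullDir]
    ring_nf
    simp
  rw [e, hmix', hdiff']
  field_simp
  ring_nf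
  simp
  ring

theorem AxialGeometry.christoffel_nullDir (hG : AxialGeometry κ β b) {h : MetricField 3}
    (hh : h =ᶠ[𝓝 0] hG.metric) : ∀ᶠ x in 𝓝 0, x 0 ≠ 0 → x 1 = 0 → ∀ l,
      ∑ i, ∑ j, (christoffel h x l i j : ℂ) * nullDir i * nullDir j
        = 2 * etaD (fun y => (κ y : ℂ)) x * nullDir l := by
  filter_upwards [hh.eventually_nhds, hG.eventually_axialPoint, hG.eventually_planeJet,
    hG.analytic_κ.eventually_analyticAt] with x h1 h2 h3 h4 hx0 hx1 l
  rw [etaD_ofReal h4.differentiableAt, ← (h2 hx0 hx1).christoffel_nullDir (h3 hx0 hx1) l,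
    ← AxialGeometry.metric]
  simp only [christoffel_congr h1]

/-- The components of `η` are constant, so the derivative term is `η` applied to the contraction.
Each of the `n` connection terms contains `Γ(η,η) = c η`, and hence contributes one multiple `c` of
the contraction. -/
theorem evalDiag_covDeriv {n : ℕ} {h : MetricField 3} {T : Chart 3 → Tensor 3 n} {x : Chart 3}
    (hT : ∀ i, DifferentiableAt ℝ (fun y => T y i) x) {c : ℂ}
    (hΓ : ∀ l, ∑ i, ∑ j, (christoffel h x l i j : ℂ) * nullDir i * nullDir j = c * nullDir l) :
    evalDiag nullDir (covDeriv h T x)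
      = etaD (fun y => evalDiag nullDir (T y)) x - n * c * evalDiag nullDir (T x) := by
  have e1 : etaD (fun y => evalDiag nullDir (T y)) x = ∑ i0, ∑ j : Fin n → Fin 3,
      nullDir i0 * (∏ k, nullDir (j k)) * pd i0 (fun y => T y j) x := by
    refine Finset.sum_congr rfl fun i0 _ => ?_
    have : pd i0 (fun y => evalDiag nullDir (T y)) x
        = ∑ j : Fin n → Fin 3, (∏ k, nullDir (j k)) * pd i0 (fun y => T y j) x := by
      simp only [evalDiag]
      rw [pd, fderiv_fun_sum fun j _ => (hT j).const_mul _, sum_apply]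
      refine Finset.sum_congr rfl fun j _ => ?_
      rw [fderiv_const_mul (hT j)]
      rfl
    rw [this, Finset.mul_sum]
    exact Finset.sum_congr rfl fun j _ => by ring
  have e2 : ∀ k : Fin n, ∑ i0, ∑ j : Fin n → Fin 3, nullDir i0 * (∏ q, nullDir (j q))
      * ∑ l, (christoffel h x l i0 (j k) : ℂ) * T x (Function.update j k l)
        = c * evalDiag nullDir (T x) := by
    intro k
    have hprod : ∀ (j : Fin n → Fin 3) (l : Fin 3), ∏ q, nullDir (Function.update j k l q)
        = nullDir l * ∏ q ∈ Finset.univ.erase k, nullDir (j q) := by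
      intro j l
      rw [← Finset.mul_prod_erase _ _ (Finset.mem_univ k), Function.update_self]
      congr 1
      refine Finset.prod_congr rfl fun q hq => ?_
      rw [Function.update_of_ne (Finset.ne_of_mem_erase hq)]
    have hr : ∀ i0, ∑ j : Fin n → Fin 3, nullDir i0 * (∏ q, nullDir (j q))
        * ∑ l, (christoffel h x l i0 (j k) : ℂ) * T x (Function.update j k l)
        = ∑ j : Fin n → Fin 3, ∑ l, nullDir i0 *
          (nullDir l * ∏ q ∈ Finset.univ.erase k, nullDir (j q)) *
          (christoffel h x (j k) i0 l : ℂ) * T x j := by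
      intro i0
      rw [← sum_sum_update k]
      refine Finset.sum_congr rfl fun j _ => ?_
      rw [Finset.mul_sum]
      refine Finset.sum_congr rfl fun l _ => ?_
      rw [Function.update_self]
      have h3 := hprod (Function.update j k l) (j k)
      rw [Function.update_idem, Function.update_eq_self] at h3
      rw [h3]
      ring
    rw [Finset.sum_congr rfl fun i0 _ => hr i0, Finset.sum_comm, evalDiag, Finset.mul_sum]
    refine Finset.sum_congr rfl fun j _ => ?_
    have h4 := hΓ (j k)
    have h5 : ∏ q, nullDir (j q)
        = nullDir (j k) * ∏ q ∈ Finset.univ.erase k, nullDir (j q) :=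
      (Finset.mul_prod_erase _ _ (Finset.mem_univ k)).symm
    rw [h5]
    calc _ = (∑ i, ∑ l, (christoffel h x (j k) i l : ℂ) * nullDir i * nullDir l)
          * ((∏ q ∈ Finset.univ.erase k, nullDir (j q)) * T x j) := by
          rw [Finset.sum_mul]
          refine Finset.sum_congr rfl fun i _ => ?_
          rw [Finset.sum_mul]
          exact Finset.sum_congr rfl fun l _ => by ring
      _ = _ := by rw [h4]; ring
  rw [evalDiag, sum_fin_succ_fun]
  simp only [covDeriv, Fin.cons_zero, Fin.tail_cons, Fin.prod_univ_succ, Fin.cons_succ, mul_sub,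
    Finset.sum_sub_distrib]
  rw [e1]
  congr 1
  simp only [Finset.mul_sum (s := (Finset.univ : Finset (Fin n)))]
  have e3 : (n : ℂ) * c * evalDiag nullDir (T x)
      = ∑ _k : Fin n, c * evalDiag nullDir (T x) := by
    simp
    ring
  rw [e3, ← Finset.sum_congr rfl fun k _ => e2 k]
  conv_rhs => rw [Finset.sum_comm]
  refine Finset.sum_congr rfl fun i0 _ => ?_
  rw [Finset.sum_comm]

theorem evalDiag_ricci_mul {n : ℕ} (R : Fin 3 → Fin 3 → ℝ) (c : ℂ) (T : Tensor 3 n) :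
    evalDiag nullDir (fun i : Fin (n + 2) → Fin 3 => c * (R (i 0) (i 1) : ℂ)
        * T (fun k => i k.succ.succ))
      = c * (∑ i, ∑ j, (R i j : ℂ) * nullDir i * nullDir j) * evalDiag nullDir T := by
  have h1 : (1 : Fin (n + 2)) = Fin.succ 0 := rfl
  rw [evalDiag, sum_fin_succ_fun, Finset.mul_sum, Finset.sum_mul]
  refine Finset.sum_congr rfl fun a _ => ?_
  rw [sum_fin_succ_fun, Finset.mul_sum, Finset.sum_mul]
  refine Finset.sum_congr rfl fun b _ => ?_
  rw [evalDiag, Finset.mul_sum]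
  refine Finset.sum_congr rfl fun j _ => ?_
  simp only [h1, Fin.cons_zero, Fin.cons_succ, Fin.prod_univ_succ]
  ring

/-- On `y = 0` the metric is diagonal with equal `x` and `z` entries, and `η` has components `-i`
and `1` there, so it stays null although the conformal factor varies. -/
theorem AxialGeometry.evalDiag_stfPart (hG : AxialGeometry κ β b) {h : MetricField 3}
    (hh : h =ᶠ[𝓝 0] hG.metric) : ∀ᶠ x in 𝓝 0, x 1 = 0 → ∀ (n : ℕ) (T : Tensor 3 n),
      evalDiag nullDir (stfPart (h x) T) = evalDiag nullDir T := by
  obtain ⟨B, hB⟩ := hG.exists_analyticFrame hh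
  filter_upwards [hB.isFrame, hh] with x h1 h2 hx1 n T
  refine (h1.isSTFPart_stfPart T).evalDiag_eq h1.isUnit_det ?_
  rw [h2, AxialGeometry.metric, axialMetric_eq_diagonal hx1]
  simp [Fin.sum_univ_three, Matrix.diagonal_apply, nullDir]
  ring_nf
  simp

end PlaneJets

/-! ### Restriction to the meridian plane -/

section Meridian

/-- The inclusion `(z, ρ) ↦ (ρ, 0, z)` of the meridian plane. -/
noncomputable def planeCLM : ℝ × ℝ →L[ℝ] Chart 3 :=
  ContinuousLinearMap.pi ![ContinuousLinearMap.snd ℝ ℝ ℝ, 0, ContinuousLinearMap.fst ℝ ℝ ℝ]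

theorem planeCLM_apply (p : ℝ × ℝ) : planeCLM p = ![p.2, 0, p.1] := by
  ext i
  fin_cases i <;> simp [planeCLM]

theorem meridian_eq_comp {F : Type*} (f : Chart 3 → F) : meridian f = f ∘ planeCLM := by
  ext p
  simp [meridian, planeCLM_apply]

theorem tendsto_plane : Tendsto (fun p : ℝ × ℝ => (![p.2, 0, p.1] : Chart 3)) (𝓝 0) (𝓝 0) := by
  have h : Tendsto planeCLM (𝓝 0) (𝓝 0) := planeCLM.continuous.tendsto' 0 0 (map_zero _)
  exact h.congr planeCLM_apply

theorem analyticAt_meridian {F : Type*} [NormedAddCommGroup F] [NormedSpace ℝ F]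
    {f : Chart 3 → F} (hf : AnalyticAt ℝ f 0) : AnalyticAt ℝ (meridian f) 0 := by
  rw [meridian_eq_comp]
  refine AnalyticAt.comp ?_ (planeCLM.analyticAt 0)
  rwa [map_zero]

variable {f g : Chart 3 → ℂ} {ℓ : ℝ → ℂ}

/-- `η` has no `y` component, so differentiating along it commutes with restricting to the plane. -/
theorem nullDeriv_meridian (hf : AnalyticAt ℝ f 0) :
    nullDeriv (meridian f) =ᶠ[𝓝 0] meridian (etaD f) := by
  filter_upwards [tendsto_plane.eventually hf.eventually_analyticAt] with p hp
  rw [← planeCLM_apply] at hp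
  have h1 : fderiv ℝ (meridian f) p = (fderiv ℝ f (planeCLM p)).comp planeCLM := by
    rw [meridian_eq_comp, fderiv_comp _ hp.differentiableAt planeCLM.differentiableAt,
      planeCLM.fderiv]
  have h2 : (![0, 0, 1] : Chart 3) = Pi.single 2 1 := by
    ext i
    fin_cases i <;> simp
  have h3 : (![1, 0, 0] : Chart 3) = Pi.single 0 1 := by
    ext i
    fin_cases i <;> simp
  rw [nullDeriv, h1, meridian, ← planeCLM_apply]
  simp only [ContinuousLinearMap.comp_apply, planeCLM_apply (1, 0), planeCLM_apply (0, 1), h2, h3,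
    etaD, Fin.sum_univ_three, nullDir]
  simp [pd]
  ring

theorem isLead_leadC (hf : AnalyticAt ℝ f 0) : IsLead (meridian f) (leadC f) :=
  isLead_leadingOrder (analyticAt_meridian hf)

theorem isLead_etaD (hf : AnalyticAt ℝ f 0) : IsLead (meridian (etaD f)) (deriv (leadC f)) :=
  (isLead_leadC hf).nullDeriv.congr_left (nullDeriv_meridian hf)

/-- The axis has dense complement in the meridian plane; this disposes of the condition `x 0 ≠ 0` in
all the plane identities. -/
theorem meridian_eventuallyEq (hf : AnalyticAt ℝ f 0) (hg : AnalyticAt ℝ g 0)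
    (h : ∀ᶠ x in 𝓝 0, x 0 ≠ 0 → x 1 = 0 → f x = g x) : meridian f =ᶠ[𝓝 0] meridian g := by
  have hd : Dense {p : ℝ × ℝ | p.2 ≠ 0} :=
    (dense_compl_singleton (0 : ℝ)).preimage isOpenMap_snd
  refine eventually_eq_of_dense hd (eventually_continuousAt_of_analyticAt (analyticAt_meridian hf))
    (eventually_continuousAt_of_analyticAt (analyticAt_meridian hg)) ?_
  filter_upwards [tendsto_plane.eventually h] with p hp h2
  exact hp h2 rfl

/-- An identity between analytic functions in the meridian plane passes to leading orders. -/
theorem IsLead.eventuallyEq_of_plane {ℓ' : ℝ → ℂ} (hℓ : IsLead (meridian f) ℓ)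
    (hℓ' : IsLead (meridian g) ℓ') (hf : AnalyticAt ℝ f 0) (hg : AnalyticAt ℝ g 0)
    (h : ∀ᶠ x in 𝓝 0, x 0 ≠ 0 → x 1 = 0 → f x = g x) : ℓ =ᶠ[𝓝 0] ℓ' :=
  (hℓ.congr_left (meridian_eventuallyEq hf hg h)).unique hℓ'

end Meridian

/-! ### Leading orders of the contracted recursion -/

section Leads

variable {κ β b : Chart 3 → ℝ} {h : MetricField 3} {φ : Chart 3 → ℂ}

/-- The component of the `n`-th multipole tensor along the null direction. -/
noncomputable def nullComponent (h : MetricField 3) (φ : Chart 3 → ℂ) (n : ℕ) (x : Chart 3) : ℂ :=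
  evalDiag nullDir (multipoleTensor h φ n x)

/-- The null component of the Ricci tensor. -/
noncomputable def nullRicci (h : MetricField 3) (x : Chart 3) : ℂ :=
  ∑ i, ∑ j, (ricci h x i j : ℂ) * nullDir i * nullDir j

theorem AxialGeometry.analyticAt_nullComponent (hG : AxialGeometry κ β b)
    (hh : h =ᶠ[𝓝 0] hG.metric) (hφ : AnalyticAt ℝ φ 0) (n : ℕ) :
    AnalyticAt ℝ (nullComponent h φ n) 0 := by
  obtain ⟨B, hB⟩ := hG.exists_analyticFrame hh
  exact Finset.analyticAt_fun_sum _ fun i _ => analyticAt_const.mul (hB.multipoleTensor hφ n i)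

theorem AxialGeometry.analyticAt_nullRicci (hG : AxialGeometry κ β b)
    (hh : h =ᶠ[𝓝 0] hG.metric) : AnalyticAt ℝ (nullRicci h) 0 := by
  obtain ⟨B, hB⟩ := hG.exists_analyticFrame hh
  exact Finset.analyticAt_fun_sum _ fun i _ => Finset.analyticAt_fun_sum _ fun j _ =>
    ((analyticAt_ofReal (hB.ricci i j)).mul analyticAt_const).mul analyticAt_const

theorem evalDiag_sub {n : ℕ} (η : Fin 3 → ℂ) (S T : Tensor 3 n) :
    evalDiag η (fun i => S i - T i) = evalDiag η S - evalDiag η T := by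
  simp only [evalDiag, mul_sub, Finset.sum_sub_distrib]

theorem AxialGeometry.eventually_differentiableAt_multipoleTensor (hG : AxialGeometry κ β b)
    (hh : h =ᶠ[𝓝 0] hG.metric) (hφ : AnalyticAt ℝ φ 0) (n : ℕ) :
    ∀ᶠ x in 𝓝 0, ∀ i, DifferentiableAt ℝ (fun y => multipoleTensor h φ n y i) x := by
  obtain ⟨B, hB⟩ := hG.exists_analyticFrame hh
  exact eventually_all.2 fun i => (hB.multipoleTensor hφ n i).eventually_analyticAt.mono
    fun x hx => hx.differentiableAt

theorem AxialGeometry.nullComponent_one (hG : AxialGeometry κ β b)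
    (hh : h =ᶠ[𝓝 0] hG.metric) (hφ : AnalyticAt ℝ φ 0) :
    ∀ᶠ x in 𝓝 0, x 0 ≠ 0 → x 1 = 0 → nullComponent h φ 1 x = etaD (nullComponent h φ 0) x := by
  filter_upwards [hG.evalDiag_stfPart hh, hG.christoffel_nullDir hh,
    hG.eventually_differentiableAt_multipoleTensor hh hφ 0] with x h1 h2 h3 hx0 hx1
  rw [nullComponent, multipoleTensor, h1 hx1, evalDiag_covDeriv h3 (h2 hx0 hx1)]
  simp
  rfl

/-- The tensor being differentiated has rank `n + 1`, and `Γ(η,η) = 2 (ηκ) η`; the product of these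
factors is the coefficient `2 (n + 1)`. -/
theorem AxialGeometry.nullComponent_add_two (hG : AxialGeometry κ β b)
    (hh : h =ᶠ[𝓝 0] hG.metric) (hφ : AnalyticAt ℝ φ 0) (n : ℕ) :
    ∀ᶠ x in 𝓝 0, x 0 ≠ 0 → x 1 = 0 → nullComponent h φ (n + 2) x =
      etaD (nullComponent h φ (n + 1)) x
        - 2 * (n + 1) * (etaD (fun y => (κ y : ℂ)) x * nullComponent h φ (n + 1) x)
        - (((n : ℂ) + 1) * (2 * (n : ℂ) + 1) / 2) * (nullRicci h x * nullComponent h φ n x) := by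
  filter_upwards [hG.evalDiag_stfPart hh, hG.christoffel_nullDir hh,
    hG.eventually_differentiableAt_multipoleTensor hh hφ (n + 1)] with x h1 h2 h3 hx0 hx1
  rw [nullComponent, multipoleTensor, h1 hx1, evalDiag_sub, evalDiag_covDeriv h3 (h2 hx0 hx1),
    evalDiag_ricci_mul (ricci h x), ← nullRicci]
  have e : (fun y => evalDiag nullDir (multipoleTensor h φ (n + 1) y))
      = nullComponent h φ (n + 1) := rfl
  rw [e, ← nullComponent, ← nullComponent]
  push_cast
  ring

/-- On the null line the coordinate `x` equals `-i r`, so the term `-2i (ηβ) / x` becomes `2 β_L' /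
r`. The right-hand side is thus `r` times the expression `M`. -/
theorem AxialGeometry.leadC_nullRicci (hG : AxialGeometry κ β b) (hh : h =ᶠ[𝓝 0] hG.metric) :
    ∀ᶠ r : ℝ in 𝓝 0, (r : ℂ) * leadC (nullRicci h) r
      = r * (deriv (deriv (leadC fun x => (β x : ℂ))) r - deriv (leadC fun x => (β x : ℂ)) r ^ 2
          - deriv (deriv (leadC fun x => (κ x : ℂ))) r + deriv (leadC fun x => (κ x : ℂ)) r ^ 2)
        + 2 * deriv (leadC fun x => (β x : ℂ)) r := by
  have hβ := analyticAt_ofReal hG.analytic_β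
  have hκ := analyticAt_ofReal hG.analytic_κ
  have hx : AnalyticAt ℝ (fun x : Chart 3 => (x 0 : ℂ)) 0 := analyticAt_ofReal (analyticAt_coord 0 0)
  have hR := hG.analyticAt_nullRicci hh
  have lβ := isLead_etaD hβ
  have lκ := isLead_etaD hκ
  have lββ : IsLead (meridian (etaD (etaD fun x => (β x : ℂ)))) _ :=
    lβ.nullDeriv.congr_left (nullDeriv_meridian (analyticAt_etaD hβ))
  have lκκ : IsLead (meridian (etaD (etaD fun x => (κ x : ℂ)))) _ :=
    lκ.nullDeriv.congr_left (nullDeriv_meridian (analyticAt_etaD hκ))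
  have lx : IsLead (meridian (fun x : Chart 3 => (x 0 : ℂ))) _ := isLead_snd
  have key := IsLead.eventuallyEq_of_plane
    (f := fun x => (x 0 : ℂ) * nullRicci h x)
    (g := fun x => (x 0 : ℂ) * (etaD (etaD fun y => (β y : ℂ)) x
            - etaD (fun y => (β y : ℂ)) x * etaD (fun y => (β y : ℂ)) x
            - etaD (etaD fun y => (κ y : ℂ)) x
            + etaD (fun y => (κ y : ℂ)) x * etaD (fun y => (κ y : ℂ)) x)
          - 2 * Complex.I * etaD (fun y => (β y : ℂ)) x)
    (lx.mul (isLead_leadC hR))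
    ((lx.mul (((lββ.sub (lβ.mul lβ)).sub lκκ).add (lκ.mul lκ))).sub (lβ.const_mul _))
    (hx.mul hR)
    ((hx.mul (((((analyticAt_etaD (analyticAt_etaD hβ)).sub
      ((analyticAt_etaD hβ).mul (analyticAt_etaD hβ)))).sub
      (analyticAt_etaD (analyticAt_etaD hκ))).add
        ((analyticAt_etaD hκ).mul (analyticAt_etaD hκ)))).sub
      (analyticAt_const.mul (analyticAt_etaD hβ)))
    (by
      filter_upwards [hG.ricci_nullDir hh] with x h1 hx0 hx1
      rw [nullRicci, h1 hx0 hx1]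
      ring)
  filter_upwards [key] with r hr
  have hI := Complex.I_mul_I
  -- Multiplication by `i` turns the common factor `-i r` into `r`.
  linear_combination Complex.I * hr
    + (-(r : ℂ) * leadC (nullRicci h) r
      + r * (deriv (deriv (leadC fun x => (β x : ℂ))) r - deriv (leadC fun x => (β x : ℂ)) r ^ 2
          - deriv (deriv (leadC fun x => (κ x : ℂ))) r + deriv (leadC fun x => (κ x : ℂ)) r ^ 2)
        + 2 * deriv (leadC fun x => (β x : ℂ)) r) * (-hI)

/-- Once `Ric(η,η)_L` vanishes, the two-step recursion involves only the preceding component. The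
first step is separate because the definition of the tensor of rank one has no Ricci term. -/
theorem AxialGeometry.leadC_nullComponent (hG : AxialGeometry κ β b) (hh : h =ᶠ[𝓝 0] hG.metric)
    (hφ : AnalyticAt ℝ φ 0) (hR : leadC (nullRicci h) =ᶠ[𝓝 0] 0) (n : ℕ) :
    ∀ᶠ r : ℝ in 𝓝 0, leadC (nullComponent h φ (n + 1)) r
      = deriv (leadC (nullComponent h φ n)) r
        - 2 * n * (deriv (leadC fun x => (κ x : ℂ)) r * leadC (nullComponent h φ n) r) := by
  have hF := hG.analyticAt_nullComponent hh hφ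
  have hκ := analyticAt_ofReal hG.analytic_κ
  have hRa := hG.analyticAt_nullRicci hh
  rcases n with - | n
  · filter_upwards [(isLead_leadC (hF 1)).eventuallyEq_of_plane (isLead_etaD (hF 0)) (hF 1)
      (analyticAt_etaD (hF 0)) (hG.nullComponent_one hh hφ)] with r hr
    simpa using hr
  · have key := (isLead_leadC (hF (n + 2))).eventuallyEq_of_plane
      (g := fun x => etaD (nullComponent h φ (n + 1)) x
        - 2 * (n + 1) * (etaD (fun y => (κ y : ℂ)) x * nullComponent h φ (n + 1) x)
        - (((n : ℂ) + 1) * (2 * (n : ℂ) + 1) / 2) * (nullRicci h x * nullComponent h φ n x))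
      (((isLead_etaD (hF (n + 1))).sub
        (((isLead_etaD hκ).mul (isLead_leadC (hF (n + 1)))).const_mul _)).sub
        (((isLead_leadC hRa).mul (isLead_leadC (hF n))).const_mul _)) (hF (n + 2))
      (((analyticAt_etaD (hF (n + 1))).sub (analyticAt_const.mul
        ((analyticAt_etaD hκ).mul (hF (n + 1))))).sub
        (analyticAt_const.mul (hRa.mul (hF n))))
      (hG.nullComponent_add_two hh hφ n)
    filter_upwards [key, hR] with r h1 h2
    rw [h1, h2]
    push_cast
    simp

end Leads

/-! ### The equations satisfied by the leading orders -/

section Radial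

variable {k u E : ℝ → ℝ} {C : ℝ}

/-- The integrands agree except possibly at `s = 0`, where division by zero gives the quotient the
value `0`. A single point does not affect the integral. -/
theorem eventually_integral_quotient
    (hu : ∀ᶠ r in 𝓝 0, Real.exp (2 * u r) - 1 = r ^ 2 * E r) :
    ∀ᶠ r in 𝓝 (0 : ℝ), (∫ s in (0 : ℝ)..r, (Real.exp (2 * u s) - 1) / s ^ 2)
      = ∫ s in (0 : ℝ)..r, E s := by
  obtain ⟨ε, hε, h⟩ := Metric.eventually_nhds_iff_ball.1 hu
  filter_upwards [Metric.ball_mem_nhds (0 : ℝ) hε] with r hr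
  refine intervalIntegral.integral_congr_ae ?_
  filter_upwards [MeasureTheory.Measure.ae_ne MeasureTheory.volume (0 : ℝ)] with s hs hsr
  have hsε : s ∈ Metric.ball (0 : ℝ) ε := by
    rw [mem_ball_zero_iff, Real.norm_eq_abs] at hr ⊢
    refine lt_of_le_of_lt ?_ hr
    simpa using Set.abs_sub_left_of_mem_uIcc (Set.uIoc_subset_uIcc hsr)
  rw [h s hsε]
  field_simp

/-- The logarithmic form of the conformal factor, with the singular integrand replaced by its
analytic continuation. -/
theorem eventually_exp_sub (hE : AnalyticAt ℝ E 0)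
    (hu : ∀ᶠ r in 𝓝 0, Real.exp (2 * u r) - 1 = r ^ 2 * E r)
    (hk : ∀ᶠ r in 𝓝 (0 : ℝ), k r = -Real.log (1 - r * (∫ s in (0 : ℝ)..r,
      (Real.exp (2 * u s) - 1) / s ^ 2) - r * C) + u r) :
    ∀ᶠ r in 𝓝 (0 : ℝ), 0 < 1 - r * (∫ s in (0 : ℝ)..r, E s) - r * C ∧
      k r = -Real.log (1 - r * (∫ s in (0 : ℝ)..r, E s) - r * C) + u r := by
  have hc : ContinuousAt (fun r : ℝ => 1 - r * (∫ s in (0 : ℝ)..r, E s) - r * C) 0 := by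
    have := (analyticAt_primitive hE).continuousAt
    fun_prop
  have hpos := hc.eventually (lt_mem_nhds (a := (0 : ℝ)) (by simp))
  filter_upwards [hpos, eventually_integral_quotient hu, hk] with r h1 h2 h3
  exact ⟨h1, by rw [h3, h2]⟩

theorem eventually_hasDerivAt_primitive (hE : AnalyticAt ℝ E 0) :
    ∀ᶠ r in 𝓝 (0 : ℝ), HasDerivAt (fun r => ∫ s in (0 : ℝ)..r, E s) (E r) r := by
  obtain ⟨ε, hε, h⟩ := Metric.eventually_nhds_iff_ball.1 (eventually_continuousAt_of_analyticAt hE)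
  filter_upwards [Metric.ball_mem_nhds (0 : ℝ) hε] with r hr
  have hcont : ContinuousOn E (Metric.ball 0 ε) := fun s hs => (h s hs).continuousWithinAt
  refine intervalIntegral.integral_hasDerivAt_right ?_ ?_ (h r hr)
  · refine (hcont.mono fun s hs => ?_).intervalIntegrable
    rw [mem_ball_zero_iff, Real.norm_eq_abs] at hr ⊢
    refine lt_of_le_of_lt ?_ hr
    simpa using Set.abs_sub_left_of_mem_uIcc hs
  · exact hcont.stronglyMeasurableAtFilter Metric.isOpen_ball r hr

/-- With `q = 1 - r ∫₀^r E - r C` one has `k - u = -ln q` and `q - r q' = 1 + r² E = e^{2u}`, where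
`C` cancels. Hence `1 + r (k' - u') = (q - r q') / q = e^{2u} / q = e^{k + u}`. -/
theorem eventually_one_add_mul_deriv_sub (hE : AnalyticAt ℝ E 0) (hka : AnalyticAt ℝ k 0)
    (hua : AnalyticAt ℝ u 0) (hu : ∀ᶠ r in 𝓝 0, Real.exp (2 * u r) - 1 = r ^ 2 * E r)
    (hk : ∀ᶠ r in 𝓝 (0 : ℝ), k r = -Real.log (1 - r * (∫ s in (0 : ℝ)..r,
      (Real.exp (2 * u s) - 1) / s ^ 2) - r * C) + u r) :
    ∀ᶠ r in 𝓝 (0 : ℝ), 1 + r * (deriv k r - deriv u r) = Real.exp (k r + u r) := by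
  filter_upwards [(eventually_exp_sub hE hu hk).eventually_nhds,
    eventually_hasDerivAt_primitive hE, hka.eventually_analyticAt, hua.eventually_analyticAt, hu]
    with r h1 h2 h3 h4 h5
  set J : ℝ → ℝ := fun r => ∫ s in (0 : ℝ)..r, E s with hJ
  set q : ℝ → ℝ := fun r => 1 - r * J r - r * C with hq
  have hq0 : 0 < q r := h1.self_of_nhds.1
  have hdq : HasDerivAt q (-(J r + r * E r) - C) r := by
    refine ((((hasDerivAt_id r).mul h2).const_sub 1).sub
      ((hasDerivAt_id r).mul_const C)).congr_deriv ?_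
    simp
  have hd : HasDerivAt (fun r => k r - u r) (deriv k r - deriv u r) r :=
    h3.differentiableAt.hasDerivAt.sub h4.differentiableAt.hasDerivAt
  have hd' : HasDerivAt (fun r => k r - u r) (-((-(J r + r * E r) - C) / q r)) r := by
    refine (hdq.log hq0.ne').neg.congr_of_eventuallyEq ?_
    filter_upwards [h1] with s hs
    rw [hs.2]
    simp [hq, hJ]
  rw [hd.unique hd']
  have hexp : Real.exp (k r + u r) = (q r)⁻¹ * Real.exp (2 * u r) := by
    have e : k r + u r = -Real.log (q r) + 2 * u r := by
      rw [h1.self_of_nhds.2]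
      ring
    rw [e, Real.exp_add, Real.exp_neg, Real.exp_log hq0]
  have e2 : Real.exp (2 * u r) = 1 + r ^ 2 * E r := by linarith
  rw [hexp, e2]
  have hqr : q r = 1 - r * J r - r * C := rfl
  field_simp
  rw [hqr]
  ring

/-- The product rule gives `e^{k - u} (1 + r (k' - u'))`, and by the equation this is `e^{k - u}
e^{k + u}`. -/
theorem eventually_hasDerivAt_radial (hka : AnalyticAt ℝ k 0) (hua : AnalyticAt ℝ u 0)
    (h : ∀ᶠ r in 𝓝 (0 : ℝ), 1 + r * (deriv k r - deriv u r) = Real.exp (k r + u r)) :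
    ∀ᶠ r in 𝓝 (0 : ℝ), HasDerivAt (fun r => r * Real.exp (k r - u r)) (Real.exp (2 * k r)) r := by
  filter_upwards [h, hka.eventually_analyticAt, hua.eventually_analyticAt] with r h1 h2 h3
  have hd := (hasDerivAt_id r).mul
    (h2.differentiableAt.hasDerivAt.sub h3.differentiableAt.hasDerivAt).exp
  refine hd.congr_deriv ?_
  have e : Real.exp (2 * k r) = Real.exp (k r - u r) * Real.exp (k r + u r) := by
    rw [← Real.exp_add]
    ring_nf
  rw [e, ← h1]
  simp
  ring

/-- Differentiate the equation and use it once more to replace `e^{k + u}` by `1 + r (k' - u')`; the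
result is `r M = 0`. -/
theorem eventually_mul_curvature_eq_zero (hka : AnalyticAt ℝ k 0) (hua : AnalyticAt ℝ u 0)
    (h : ∀ᶠ r in 𝓝 (0 : ℝ), 1 + r * (deriv k r - deriv u r) = Real.exp (k r + u r)) :
    ∀ᶠ r in 𝓝 (0 : ℝ), r * (deriv (deriv u) r - deriv u r ^ 2 - deriv (deriv k) r
      + deriv k r ^ 2) + 2 * deriv u r = 0 := by
  filter_upwards [h.eventually_nhds, hka.eventually_analyticAt, hua.eventually_analyticAt]
    with r h1 h2 h3
  have d1 := ((hasDerivAt_id r).mul (h2.deriv.differentiableAt.hasDerivAt.sub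
    h3.deriv.differentiableAt.hasDerivAt)).const_add 1
  have d2 := (h2.differentiableAt.hasDerivAt.add h3.differentiableAt.hasDerivAt).exp
  have h4 := (d1.congr_of_eventuallyEq (EventuallyEq.symm h1)).unique d2
  have h5 := h1.self_of_nhds
  simp at h4
  rw [← h5] at h4
  linear_combination -h4

end Radial

/-! ### Derivatives with respect to the radial parameter -/

/-- By induction on `n`: differentiating `e^{-2nk}` produces exactly the term `-2n k' L_n` of the
recursion, and `dr/dρ = e^{-2k}` raises the exponent to `-2(n+1)k`. -/
theorem iteratedDeriv_eventuallyEq {k rr : ℝ → ℝ} {L : ℕ → ℝ → ℂ} {y : ℝ → ℂ}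
    (hk : AnalyticAt ℝ k 0) (hL : ∀ n, AnalyticAt ℝ (L n) 0)
    (hrec : ∀ n : ℕ, ∀ᶠ r in 𝓝 (0 : ℝ),
      L (n + 1) r = deriv (L n) r - 2 * n * (((deriv k r : ℝ) : ℂ) * L n r))
    (hrr0 : Tendsto rr (𝓝 0) (𝓝 0))
    (hrr : ∀ᶠ s in 𝓝 (0 : ℝ), HasDerivAt rr (Real.exp (-2 * k (rr s))) s)
    (hy : y =ᶠ[𝓝 0] fun s => L 0 (rr s)) (n : ℕ) :
    iteratedDeriv n y =ᶠ[𝓝 0]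
      fun s => (Real.exp (-2 * n * k (rr s)) : ℂ) * L n (rr s) := by
  induction n with
  | zero =>
    filter_upwards [hy] with s hs
    simp [hs]
  | succ n ih =>
    rw [iteratedDeriv_succ]
    filter_upwards [ih.eventually_nhds, hrr, hrr0.eventually (hrec n),
      hrr0.eventually hk.eventually_analyticAt, hrr0.eventually (hL n).eventually_analyticAt]
      with s h1 h2 h3 h4 h5
    have dk : HasDerivAt (fun s => k (rr s)) (deriv k (rr s) * Real.exp (-2 * k (rr s))) s :=
      h4.differentiableAt.hasDerivAt.comp s h2
    have dL : HasDerivAt (fun s => L n (rr s))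
        (Real.exp (-2 * k (rr s)) • deriv (L n) (rr s)) s :=
      h5.differentiableAt.hasDerivAt.scomp s h2
    have de := ((dk.const_mul (-2 * (n : ℝ))).exp).ofReal_comp
    rw [EventuallyEq.deriv_eq h1]
    refine ((de.mul dL).congr_deriv ?_).deriv
    have e : Real.exp (-2 * ((n + 1 : ℕ) : ℝ) * k (rr s))
        = Real.exp (-2 * n * k (rr s)) * Real.exp (-2 * k (rr s)) := by
      rw [← Real.exp_add]
      push_cast
      ring_nf
    rw [h3, e, Complex.real_smul]
    push_cast
    ring

section LocalInverse

variable {f rr : ℝ → ℝ}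

theorem exists_isLocalInverse (hf : AnalyticAt ℝ f 0) (h0 : f 0 = 0) (hd : deriv f 0 ≠ 0) :
    ∃ rr, IsLocalInverse f rr := by
  have h := hf.hasStrictDerivAt
  refine ⟨h.localInverse _ _ _ hd, ?_, ?_, ?_⟩
  · have := HasStrictFDerivAt.localInverse_apply_image (h.hasStrictFDerivAt_equiv hd)
    rwa [h0] at this
  · have := (hf.analyticAt_localInverse hd).continuousAt
    rwa [h0] at this
  · have := h.eventually_right_inverse hd
    rwa [h0] at this

theorem IsLocalInverse.tendsto (hrr : IsLocalInverse f rr) : Tendsto rr (𝓝 0) (𝓝 0) := by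
  have := hrr.2.1.tendsto
  rwa [hrr.1] at this

/-- Continuity at `0` keeps `rr` in the range where the analytic inverse inverts `f` from the left,
so the two functions have the same germ. -/
theorem IsLocalInverse.analyticAt (hrr : IsLocalInverse f rr) (hf : AnalyticAt ℝ f 0)
    (h0 : f 0 = 0) (hd : deriv f 0 ≠ 0) : AnalyticAt ℝ rr 0 := by
  have h := hf.hasStrictDerivAt
  have ha := hf.analyticAt_localInverse hd
  rw [h0] at ha
  refine ha.congr ?_
  filter_upwards [hrr.2.2, hrr.tendsto.eventually (h.eventually_left_inverse hd)] with s h1 h2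
  rw [← h2, h1]

theorem IsLocalInverse.hasDerivAt (hrr : IsLocalInverse f rr) (ha : AnalyticAt ℝ rr 0)
    {f' : ℝ → ℝ} (hf : ∀ᶠ r in 𝓝 0, HasDerivAt f (f' r) r) :
    ∀ᶠ s in 𝓝 0, HasDerivAt rr (f' (rr s))⁻¹ s := by
  filter_upwards [hrr.2.2.eventually_nhds, ha.eventually_analyticAt, hrr.tendsto.eventually hf]
    with s h1 h2 h3
  have h4 := h2.differentiableAt.hasDerivAt
  have h5 : HasDerivAt (fun s => f (rr s)) _ s := h3.comp s h4
  have h6 := (h5.congr_of_eventuallyEq (EventuallyEq.symm h1)).unique (hasDerivAt_id s)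
  rwa [← eq_inv_of_mul_eq_one_right h6]

end LocalInverse

/-! ### Real leading orders -/

section RealLeads

variable {f : Chart 3 → ℝ}

theorem analyticAt_leadC {f : Chart 3 → ℂ} (hf : AnalyticAt ℝ f 0) : AnalyticAt ℝ (leadC f) 0 :=
  (isLead_leadC hf).analyticAt

theorem meridian_zero {F : Type*} (f : Chart 3 → F) : meridian f 0 = f 0 := by
  rw [meridian_eq_comp, Function.comp_apply, map_zero]

theorem leadC_zero {f : Chart 3 → ℂ} (hf : AnalyticAt ℝ f 0) : leadC f 0 = f 0 := by
  rw [(isLead_leadC hf).apply_zero, meridian_zero]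

theorem analyticAt_leadR (hf : AnalyticAt ℝ f 0) : AnalyticAt ℝ (leadR f) 0 :=
  (Complex.reCLM.analyticAt _).comp (analyticAt_leadC (analyticAt_ofReal hf))

theorem leadR_zero (hf : AnalyticAt ℝ f 0) : leadR f 0 = f 0 := by
  rw [leadR, leadC_zero (analyticAt_ofReal hf), Complex.ofReal_re]

theorem AxisymmetricNear.leadC_eq (h : AxisymmetricNear f) (hf : AnalyticAt ℝ f 0) :
    ∀ᶠ r in 𝓝 (0 : ℝ), leadC (fun x => (f x : ℂ)) r = leadR f r := by
  have heven : ∀ᶠ p in 𝓝 (0 : ℝ × ℝ), meridian f (p.1, -p.2) = meridian f p := by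
    filter_upwards [tendsto_plane.eventually h] with p hp
    -- The half-turn maps `(ρ, 0, z)` to `(-ρ, 0, z)`, so axisymmetry implies evenness in `ρ`.
    have := hp Real.pi
    rw [meridian, meridian, ← this]
    congr 1
    ext i
    fin_cases i <;> simp [rotation, Matrix.mulVec, dotProduct, Fin.sum_univ_three]
  filter_upwards [IsLead.eventually_real (g := meridian f)
    (isLead_leadC (analyticAt_ofReal hf)) heven] with r hr
  exact hr.symm

theorem eventually_deriv_ofReal {ℓ : ℝ → ℂ} {k : ℝ → ℝ} (hk : AnalyticAt ℝ k 0)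
    (h : ∀ᶠ r in 𝓝 (0 : ℝ), ℓ r = k r) : ∀ᶠ r in 𝓝 (0 : ℝ), deriv ℓ r = ((deriv k r : ℝ) : ℂ) := by
  filter_upwards [h.eventually_nhds, hk.eventually_analyticAt] with r h1 h2
  rw [EventuallyEq.deriv_eq h1]
  exact h2.differentiableAt.hasDerivAt.ofReal_comp.deriv

variable {κ β b : Chart 3 → ℝ}

/-- On the null line `x² + y²` becomes `(-i r)² = -r²`. The resulting factor `r²` makes the
integrand `(e^{2β_L} - 1) / s²` regular. -/
theorem AxialGeometry.leadR_β (hG : AxialGeometry κ β b) :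
    ∀ᶠ r in 𝓝 (0 : ℝ), leadR β r = -(r ^ 2 * leadR b r) := by
  have hb := isLead_leadC (analyticAt_ofReal hG.analytic_b)
  have h1 : IsLead (meridian fun x => (β x : ℂ)) _ :=
    ((isLead_snd.mul isLead_snd).mul hb).congr_left (by
      filter_upwards [tendsto_plane.eventually hG.β_eq] with p hp
      rw [meridian, meridian, hp]
      simp [sq])
  filter_upwards [(isLead_leadC (analyticAt_ofReal hG.analytic_β)).unique h1] with r hr
  have e : -Complex.I * (r : ℂ) * (-Complex.I * r) = ((-r ^ 2 : ℝ) : ℂ) := by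
    push_cast
    linear_combination (r : ℂ) ^ 2 * Complex.I_mul_I
  rw [leadR, leadR, hr, e, Complex.re_ofReal_mul]
  ring

theorem AxialGeometry.exists_leadR_quotient (hG : AxialGeometry κ β b) :
    ∃ E : ℝ → ℝ, AnalyticAt ℝ E 0 ∧
      ∀ᶠ r in 𝓝 (0 : ℝ), Real.exp (2 * leadR β r) - 1 = r ^ 2 * E r := by
  obtain ⟨E, hE, h⟩ := Multipole.exists_exp_quotient 2
  have hβ := analyticAt_leadR hG.analytic_β
  have h0 : leadR β 0 = 0 := by rw [leadR_zero hG.analytic_β, hG.β_zero]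
  refine ⟨fun r => -leadR b r * E (leadR β r),
    (analyticAt_leadR hG.analytic_b).neg.mul (AnalyticAt.comp (by rwa [h0]) hβ), ?_⟩
  filter_upwards [hG.leadR_β] with r hr
  rw [h]
  linear_combination E (leadR β r) * hr

variable {C : ℝ}

theorem AxialGeometry.one_add_mul_deriv (hG : AxialGeometry κ β b)
    (hκ : IsSpecialExponent β κ C) :
    ∀ᶠ r in 𝓝 (0 : ℝ), 1 + r * (deriv (leadR κ) r - deriv (leadR β) r)
      = Real.exp (leadR κ r + leadR β r) := by
  obtain ⟨E, hE, h⟩ := hG.exists_leadR_quotient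
  exact eventually_one_add_mul_deriv_sub hE (analyticAt_leadR hG.analytic_κ)
    (analyticAt_leadR hG.analytic_β) h hκ

theorem AxialGeometry.hasDerivAt_radial (hG : AxialGeometry κ β b)
    (hκ : IsSpecialExponent β κ C) :
    ∀ᶠ r in 𝓝 (0 : ℝ), HasDerivAt (radial β κ) (Real.exp (2 * leadR κ r)) r :=
  eventually_hasDerivAt_radial (analyticAt_leadR hG.analytic_κ)
    (analyticAt_leadR hG.analytic_β) (hG.one_add_mul_deriv hκ)

theorem AxialGeometry.curvatureM_eq_zero (hG : AxialGeometry κ β b)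
    (hκ : IsSpecialExponent β κ C) : ∀ᶠ r in 𝓝[≠] (0 : ℝ), curvatureM β κ r = 0 := by
  filter_upwards [nhdsWithin_le_nhds (eventually_mul_curvature_eq_zero
    (analyticAt_leadR hG.analytic_κ) (analyticAt_leadR hG.analytic_β)
    (hG.one_add_mul_deriv hκ)), self_mem_nhdsWithin] with r h1 h2
  have h3 : r ≠ 0 := h2
  refine mul_left_cancel₀ h3 ?_
  rw [mul_zero, ← h1, curvatureM]
  field_simp
  ring

theorem AxialGeometry.leadC_nullRicci_eq_zero (hG : AxialGeometry κ β b)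
    (hκ : IsSpecialExponent β κ C) {h : MetricField 3} (hh : h =ᶠ[𝓝 0] hG.metric) :
    leadC (nullRicci h) =ᶠ[𝓝 0] 0 := by
  have ak := analyticAt_leadR hG.analytic_κ
  have au := analyticAt_leadR hG.analytic_β
  have k1 := eventually_deriv_ofReal ak (hG.axisymmetric_κ.leadC_eq hG.analytic_κ)
  have u1 := eventually_deriv_ofReal au (hG.axisymmetric_β.leadC_eq hG.analytic_β)
  -- The identity at hand is `r · Ric(η,η)_L = 0`. It yields the vanishing for `r ≠ 0`, and
  -- continuity covers `r = 0`.
  refine eventually_eq_of_dense (dense_compl_singleton (0 : ℝ))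
    (eventually_continuousAt_of_analyticAt (analyticAt_leadC (hG.analyticAt_nullRicci hh)))
    (Eventually.of_forall fun _ => continuousAt_const) ?_
  filter_upwards [hG.leadC_nullRicci hh, k1, u1, eventually_deriv_ofReal ak.deriv k1,
    eventually_deriv_ofReal au.deriv u1, eventually_mul_curvature_eq_zero ak au
      (hG.one_add_mul_deriv hκ)] with r h1 h2 h3 h4 h5 h6 hr
  have hr' : (r : ℂ) ≠ 0 := by exact_mod_cast hr
  refine mul_left_cancel₀ hr' ?_
  rw [h1, h2, h3, h4, h5]
  have h7 := congrArg Complex.ofReal h6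
  push_cast at h7
  simpa using h7

/-! ### The moments -/

theorem analyticAt_rescaledPotential {κ : Chart 3 → ℝ} {φ : Chart 3 → ℂ} (hκ : AnalyticAt ℝ κ 0)
    (hφ : AnalyticAt ℝ φ 0) : AnalyticAt ℝ (rescaledPotential κ φ) 0 :=
  (analyticAt_ofReal ((hκ.neg.div_const (c := 2)).rexp')).mul hφ

theorem leadC_rescaledPotential {φ : Chart 3 → ℂ} (hκ : AnalyticAt ℝ κ 0)
    (hκs : AxisymmetricNear κ) (hφ : AnalyticAt ℝ φ 0) :
    ∀ᶠ r in 𝓝 (0 : ℝ), leadC (rescaledPotential κ φ) r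
      = (Real.exp (-leadR κ r / 2) : ℂ) * leadC φ r := by
  have h1 : IsLead (meridian (rescaledPotential κ φ)) _ :=
    (((isLead_leadC (analyticAt_ofReal hκ)).const_mul (-1 / 2)).cexp.mul
      (isLead_leadC hφ)).congr_left (Eventually.of_forall fun p => by
        simp only [meridian, rescaledPotential]
        push_cast
        ring_nf)
  filter_upwards [(isLead_leadC (analyticAt_rescaledPotential hκ hφ)).unique h1,
    hκs.leadC_eq hκ] with r h2 h3
  rw [h2, h3]
  push_cast
  ring_nf

theorem AxialGeometry.metric_zero (hG : AxialGeometry κ β b) (hκ0 : κ 0 = 0) :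
    hG.metric 0 = 1 :=
  axialMetric_eq_one (by simp [hκ0]) (by simp)

/-- Since `κ(Λ) = 0`, the rescaled metric at `Λ` is Euclidean. The multipole tensor there is
symmetric and trace-free by construction and rotation invariant by equivariance, so contraction with
the null vector determines its coefficient. -/
theorem AxialGeometry.isMultipoleMoment_iff (hG : AxialGeometry κ β b) (hκ0 : κ 0 = 0)
    {h : MetricField 3} (hh : h =ᶠ[𝓝 0] hG.metric) {φ : Chart 3 → ℂ} (hφ : AnalyticAt ℝ φ 0)
    (hφs : AxisymmetricNear φ) (n : ℕ) (m : ℂ) :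
    IsMultipoleMoment h φ n m ↔ m = nullComponent h φ n 0 := by
  obtain ⟨B, hB⟩ := hG.exists_analyticFrame hh
  have h0 : h 0 = 1 := by rw [hh.self_of_nhds, hG.metric_zero hκ0]
  rw [IsMultipoleMoment, h0]
  refine eq_smul_stfPart_axisPower_iff ?_ (fun α => ?_) m
  -- In rank `0` no projection is applied, and the symmetry and trace conditions are vacuous.
  · match n with
    | 0 => exact ⟨fun σ i => congrArg _ (Subsingleton.elim _ _), fun p => p.elim0⟩
    | 1 =>
      simp only [multipoleTensor, h0]
      exact (isFrame_one.isSTFPart_stfPart _).1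
    | n + 2 =>
      simp only [multipoleTensor, h0]
      exact (isFrame_one.isSTFPart_stfPart _).1
  · have := (hB.multipoleTensor_equivariant (isUnit_det_rotation α) (hG.isometry hh α) hφ
      (hφs.mono fun x hx => (hx α).symm) n).self_of_nhds
    rw [Matrix.mulVec_zero] at this
    exact this.symm

theorem AxialGeometry.analyticAt_radial (hG : AxialGeometry κ β b) :
    AnalyticAt ℝ (radial β κ) 0 :=
  analyticAt_id.mul ((analyticAt_leadR hG.analytic_κ).sub (analyticAt_leadR hG.analytic_β)).rexp'

theorem radial_zero (β κ : Chart 3 → ℝ) : radial β κ 0 = 0 := by simp [radial]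

theorem AxialGeometry.deriv_radial_ne_zero (hG : AxialGeometry κ β b)
    (hκ : IsSpecialExponent β κ C) : deriv (radial β κ) 0 ≠ 0 := by
  rw [(hG.hasDerivAt_radial hκ).self_of_nhds.deriv]
  exact (Real.exp_pos _).ne'

theorem AxialGeometry.analyticAt_momentFunction (hG : AxialGeometry κ β b)
    (hκ : IsSpecialExponent β κ C) {φ : Chart 3 → ℂ} (hφ : AnalyticAt ℝ φ 0) {rr : ℝ → ℝ}
    (hrr : IsLocalInverse (radial β κ) rr) : AnalyticAt ℝ (momentFunction κ φ rr) 0 := by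
  have ha := hrr.analyticAt hG.analyticAt_radial (radial_zero β κ) (hG.deriv_radial_ne_zero hκ)
  have hk : AnalyticAt ℝ (fun r => Real.exp (-leadR κ r / 2)) (rr 0) := by
    rw [hrr.1]
    exact ((analyticAt_leadR hG.analytic_κ).neg.div_const (c := 2)).rexp'
  have hl : AnalyticAt ℝ (leadC φ) (rr 0) := by
    rw [hrr.1]
    exact analyticAt_leadC hφ
  exact ((Complex.ofRealCLM.analyticAt _).comp (hk.comp ha)).mul (hl.comp ha)

/-- The general formula for the derivatives carries a factor `e^{-2nκ_L}`, which is `1` at `ρ = 0`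
because `r(0) = 0` and `κ(Λ) = 0`. -/
theorem AxialGeometry.iteratedDeriv_momentFunction (hG : AxialGeometry κ β b) (hκ0 : κ 0 = 0)
    (hκ : IsSpecialExponent β κ C) {h : MetricField 3} (hh : h =ᶠ[𝓝 0] hG.metric)
    {φ : Chart 3 → ℂ} (hφ : AnalyticAt ℝ φ 0) {rr : ℝ → ℝ}
    (hrr : IsLocalInverse (radial β κ) rr) (n : ℕ) :
    iteratedDeriv n (momentFunction κ φ rr) 0
      = nullComponent h (rescaledPotential κ φ) n 0 := by
  have ha := hrr.analyticAt hG.analyticAt_radial (radial_zero β κ) (hG.deriv_radial_ne_zero hκ)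
  have hp := analyticAt_rescaledPotential hG.analytic_κ hφ
  have hF := hG.analyticAt_nullComponent hh hp
  have hk := analyticAt_leadR hG.analytic_κ
  have hd := hrr.hasDerivAt ha (hG.hasDerivAt_radial hκ)
  have h0 : nullComponent h (rescaledPotential κ φ) 0 = rescaledPotential κ φ := by
    funext x
    simp [nullComponent, evalDiag, multipoleTensor]
  have key := iteratedDeriv_eventuallyEq (k := leadR κ) (rr := rr)
    (L := fun n => leadC (nullComponent h (rescaledPotential κ φ) n))
    (y := momentFunction κ φ rr) hk (fun n => analyticAt_leadC (hF n)) (fun n => by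
      filter_upwards [hG.leadC_nullComponent hh hp (hG.leadC_nullRicci_eq_zero hκ hh) n,
        eventually_deriv_ofReal hk (hG.axisymmetric_κ.leadC_eq hG.analytic_κ)] with r h1 h2
      rw [h1, h2]) hrr.tendsto
    (hd.mono fun s hs => by
      rwa [neg_mul, Real.exp_neg])
    (by
      filter_upwards [hrr.tendsto.eventually
        (leadC_rescaledPotential hG.analytic_κ hG.axisymmetric_κ hφ)] with s hs
      rw [h0, hs, momentFunction]) n
  rw [key.self_of_nhds]
  beta_reduce
  rw [hrr.1, leadR_zero hG.analytic_κ, hκ0, leadC_zero (hF n)]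
  simp

end RealLeads

/-! ### Existence of the conformal factor -/

theorem exists_contDiff_eventuallyEq {f : ℝ → ℝ} (hf : AnalyticAt ℝ f 0) :
    ∃ m : ℝ → ℝ, ContDiff ℝ ∞ m ∧ m =ᶠ[𝓝 0] f := by
  obtain ⟨ε, hε, h⟩ := Metric.eventually_nhds_iff_ball.1 hf.eventually_analyticAt
  let χ : ContDiffBump (0 : ℝ) := ⟨ε / 4, ε / 2, by positivity, by linarith⟩
  refine ⟨fun r => χ r * f r, contDiff_iff_contDiffAt.2 fun r => ?_, ?_⟩
  · by_cases hr : r ∈ Metric.ball (0 : ℝ) ε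
    · exact χ.contDiffAt.mul (h r hr).contDiffAt
    · have hs : r ∉ tsupport χ := by
        rw [χ.tsupport_eq]
        intro h2
        exact hr (Metric.closedBall_subset_ball (by change ε / 2 < ε; linarith) h2)
      refine contDiffAt_const.congr_of_eventuallyEq (f := fun _ => (0 : ℝ)) ?_
      filter_upwards [notMem_tsupport_iff_eventuallyEq.1 hs] with s hs
      simp [hs]
  · filter_upwards [χ.eventuallyEq_one] with r hr
    simp [hr]

/-- A function of `z` alone has an extension that does not depend on the second variable, so its
leading order is the function itself. -/
theorem isLead_comp_fst {f : ℝ → ℝ} (hf : AnalyticAt ℝ f 0) :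
    IsLead (fun p => (f p.1 : ℂ)) (fun r => f r) := by
  have ha : AnalyticAt ℝ (fun p : ℝ × ℝ => (f p.1 : ℂ)) 0 :=
    (Complex.ofRealCLM.analyticAt _).comp (AnalyticAt.comp (g := f) hf analyticAt_fst)
  obtain ⟨G, hG, hGe⟩ := exists_isComplexExtension ha
  have hline : ∀ᶠ r : ℝ in 𝓝 0, G ((r : ℂ), 0) = f r := by
    have ht : Tendsto (fun r : ℝ => (r, (0 : ℝ))) (𝓝 0) (𝓝 0) :=
      (by fun_prop : Continuous fun r : ℝ => (r, (0 : ℝ))).tendsto' _ _ rfl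
    filter_upwards [ht.eventually hGe] with r hr
    simpa using hr
  refine ⟨fun q => G (q.1, 0), ⟨?_, ?_⟩, ?_⟩
  · exact AnalyticAt.fun_comp (g := G) hG (analyticAt_fst.prod analyticAt_const)
  · exact (continuous_fst.tendsto' (0 : ℝ × ℝ) 0 rfl).eventually hline
  · filter_upwards [hline] with r hr
    exact hr.symm

/-- Take `κ` to depend on `z` only. Its leading order is then the same function of one variable, so
the required `κ_L` is used directly as `κ(z)` near `0` and cut off to be smooth everywhere.
Axisymmetry is automatic. -/
theorem AxialGeometry.exists_specialExponent {κ β b : Chart 3 → ℝ} (hG : AxialGeometry κ β b)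
    (U : Set (Chart 3)) (C : ℝ) : ∃ κ, IsConformalExponent U κ ∧ IsSpecialExponent β κ C := by
  obtain ⟨E, hE, h⟩ := hG.exists_leadR_quotient
  have hβ := analyticAt_leadR hG.analytic_β
  have ha : AnalyticAt ℝ (fun r : ℝ => -Real.log (1 - r * (∫ s in (0 : ℝ)..r, E s) - r * C)
      + leadR β r) 0 := by
    have h1 : AnalyticAt ℝ (fun r : ℝ => 1 - r * (∫ s in (0 : ℝ)..r, E s) - r * C) 0 :=
      (analyticAt_const.sub (analyticAt_id.mul (analyticAt_primitive hE))).sub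
        (analyticAt_id.mul analyticAt_const)
    exact (h1.log (by simp)).neg.add hβ
  obtain ⟨m, hm, hme⟩ := exists_contDiff_eventuallyEq ha
  have hma : AnalyticAt ℝ m 0 := ha.congr hme.symm
  have hκa : AnalyticAt ℝ (fun x : Chart 3 => m (x 2)) 0 :=
    AnalyticAt.fun_comp (g := m) hma (analyticAt_coord 2 0)
  refine ⟨fun x => m (x 2), ⟨?_, ?_, ?_, hκa⟩, ?_⟩
  · exact (hm.comp (contDiff_apply ℝ ℝ 2)).contDiffOn
  · intro α x _
    simp [rotation, Matrix.mulVec, dotProduct, Fin.sum_univ_three]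
  · have := hme.self_of_nhds
    simp [this, leadR_zero hG.analytic_β, hG.β_zero]
  · filter_upwards [(isLead_leadC (analyticAt_ofReal hκa)).unique (isLead_comp_fst hma), hme,
      eventually_integral_quotient h] with r h1 h2 h3
    rw [leadR, h1, Complex.ofReal_re, h2, h3]

/-! ### The geometry of the completion -/

section Completion

variable {S : StationaryAxisymmetricSpacetime}

theorem StationaryAxisymmetricSpacetime.U_mem_nhds (S : StationaryAxisymmetricSpacetime) :
    S.U ∈ 𝓝 (0 : Chart 3) :=
  S.isOpen_U.mem_nhds S.zero_mem

theorem StationaryAxisymmetricSpacetime.axisymmetricNear {F : Type*} {f : Chart 3 → F}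
    (S : StationaryAxisymmetricSpacetime) (h : IsAxisymmetricOn S.U f) : AxisymmetricNear f := by
  filter_upwards [S.U_mem_nhds] with x hx α
  exact h α x hx

theorem AxialCompletion.continuousAt_hhat (K : AxialCompletion S) {x : Chart 3} (hx : x ∈ S.U)
    (i j : Fin 3) : ContinuousAt (fun x => K.hhat x i j) x :=
  (K.smooth_hhat i j).continuousOn.continuousAt (S.isOpen_U.mem_nhds hx)

/-- The component `ĥ_xx` equals `1` on the plane `y = 0` off the axis and `e^{-2β}` on the plane `x
= 0` off the axis. Both limits at an axis point agree by continuity of `ĥ`, so `e^{-2β} = 1` there.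
-/
theorem AxialCompletion.β_axis (K : AxialCompletion S) (hβ : AnalyticAt ℝ K.β 0) :
    ∀ᶠ x in 𝓝 0, K.β (killCoords {0, 1} x) = 0 := by
  have hd : Dense {p : ℝ × ℝ | p.2 ≠ 0} :=
    (dense_compl_singleton (0 : ℝ)).preimage isOpenMap_snd
  have c1 : Continuous fun p : ℝ × ℝ => (![p.2, 0, p.1] : Chart 3) := by fun_prop
  have c2 : Continuous fun p : ℝ × ℝ => (![0, p.2, p.1] : Chart 3) := by fun_prop
  have t1 : Tendsto (fun p : ℝ × ℝ => (![p.2, 0, p.1] : Chart 3)) (𝓝 0) (𝓝 0) :=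
    c1.tendsto' _ _ (by ext i; fin_cases i <;> simp)
  have t2 : Tendsto (fun p : ℝ × ℝ => (![0, p.2, p.1] : Chart 3)) (𝓝 0) (𝓝 0) :=
    c2.tendsto' _ _ (by ext i; fin_cases i <;> simp)
  have h1 : ∀ᶠ p : ℝ × ℝ in 𝓝 0, K.hhat ![p.2, 0, p.1] 0 0 = 1 := by
    refine eventually_eq_of_dense hd ?_ (Eventually.of_forall fun _ => continuousAt_const) ?_
    · filter_upwards [t1.eventually S.U_mem_nhds] with p hp
      exact ContinuousAt.comp' (g := fun x => K.hhat x 0 0) (K.continuousAt_hhat hp 0 0)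
        c1.continuousAt
    · filter_upwards [t1.eventually S.U_mem_nhds] with p hp hp2
      have hp2' : p.2 ≠ 0 := hp2
      rw [K.hhat_form _ hp (by simpa using hp2')]
      simp [cylindricalMetric]
  have h2 : ∀ᶠ p : ℝ × ℝ in 𝓝 0, K.hhat ![0, p.2, p.1] 0 0
      = Real.exp (-2 * K.β ![0, p.2, p.1]) := by
    refine eventually_eq_of_dense hd ?_ ?_ ?_
    · filter_upwards [t2.eventually S.U_mem_nhds] with p hp
      exact ContinuousAt.comp' (g := fun x => K.hhat x 0 0) (K.continuousAt_hhat hp 0 0)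
        c2.continuousAt
    · filter_upwards [t2.eventually hβ.eventually_analyticAt] with p hp
      exact ContinuousAt.comp' (g := fun x => Real.exp (-2 * K.β x))
        (hp.continuousAt.const_mul _).rexp c2.continuousAt
    · filter_upwards [t2.eventually S.U_mem_nhds] with p hp hp2
      have hp2' : p.2 ≠ 0 := hp2
      rw [K.hhat_form _ hp (by simpa using hp2')]
      simp [cylindricalMetric]
      field_simp
      ring
  have t3 : Tendsto (fun x : Chart 3 => (x 2, (0 : ℝ))) (𝓝 0) (𝓝 0) :=
    (by fun_prop : Continuous fun x : Chart 3 => (x 2, (0 : ℝ))).tendsto' _ _ rfl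
  filter_upwards [t3.eventually h1, t3.eventually h2] with x h3 h4
  have e : killCoords {0, 1} x = ![0, 0, x 2] := by
    ext i
    fin_cases i <;> simp [killCoords_apply]
  rw [e]
  rw [h3, eq_comm, Real.exp_eq_one_iff] at h4
  linarith

theorem AxialCompletion.exists_axialGeometry (K : AxialCompletion S) (hβ : AnalyticAt ℝ K.β 0) :
    ∃ b, ∀ κ : Chart 3 → ℝ, AnalyticAt ℝ κ 0 → AxisymmetricNear κ → AxialGeometry κ K.β b := by
  have hs := S.axisymmetricNear K.β_axisymmetric
  obtain ⟨b, hb, h⟩ := exists_analytic_quotient hβ (hs.eventually_pd hβ) (K.β_axis hβ)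
  exact ⟨b, fun κ hκ hκs => ⟨hκ, hβ, hb, hκs, hs, h⟩⟩

/-- The cylindrical form is available only off the axis. Continuity of `ĥ` identifies it there with
the analytic model, so the smooth `ĥ` is in fact analytic near `Λ`. -/
theorem AxialCompletion.rescaledMetric_eventuallyEq (K : AxialCompletion S)
    {κ b : Chart 3 → ℝ} (hG : AxialGeometry κ K.β b) :
    rescaledMetric κ K.hhat =ᶠ[𝓝 0] hG.metric := by
  have h : ∀ i j, ∀ᶠ x in 𝓝 0, K.hhat x i j = axialMetric (fun _ => 1) hG.s x i j := by
    intro i j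
    refine eventually_eq_of_dense (dense_coord_ne 0) ?_
      (eventually_continuousAt_of_analyticAt
        (analyticAt_axialMetric analyticAt_const hG.analytic_s i j)) ?_
    · filter_upwards [S.U_mem_nhds] with x hx
      exact K.continuousAt_hhat hx i j
    · filter_upwards [S.U_mem_nhds, hG.s_eq] with x hx h1 hx0
      have hx0' : x 0 ≠ 0 := hx0
      have hne : x 0 ^ 2 + x 1 ^ 2 ≠ 0 := by positivity
      rw [K.hhat_form x hx hne, cylindricalMetric, axialMetric, Matrix.of_apply, Matrix.of_apply,
        ← h1, rotVec]
      field_simp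
  filter_upwards [eventually_all.2 fun i => eventually_all.2 (h i)] with x hx
  ext i j
  rw [rescaledMetric, Matrix.smul_apply, hx, AxialGeometry.metric, axialMetric, axialMetric,
    Matrix.of_apply, Matrix.of_apply, smul_eq_mul]
  ring

/-! ### Axisymmetry of the potential -/

theorem rotation4_mulVec_atTimeZero (α : ℝ) (x : Chart 3) :
    (rotation4 α).mulVec (atTimeZero x) = atTimeZero ((rotation α).mulVec x) := by
  have h1 : ∀ y : Chart 3, atTimeZero y = ![0, y 0, y 1, y 2] := by
    intro y
    ext i
    fin_cases i <;> rfl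
  rw [h1, h1]
  ext i
  fin_cases i <;> simp [rotation4, rotation, Matrix.mulVec, dotProduct,
    Fin.sum_univ_four, Fin.sum_univ_three]

theorem rotation4_mul_transpose (α : ℝ) : rotation4 α * (rotation4 α).transpose = 1 := by
  have h := Real.sin_sq_add_cos_sq α
  ext i j
  fin_cases i <;> fin_cases j <;>
    simp [rotation4, Matrix.mul_apply, Fin.sum_univ_four] <;> linarith

theorem StationaryAxisymmetricSpacetime.g_rotation (S : StationaryAxisymmetricSpacetime) (α : ℝ)
    {x : Chart 3} (hx : x ∈ S.U) (hx0 : x ≠ 0) :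
    S.g (atTimeZero ((rotation α).mulVec x))
      = rotation4 α * S.g (atTimeZero x) * (rotation4 α).transpose := by
  have h1 := S.axisymmetric α (atTimeZero x) ⟨hx, hx0⟩
  rw [rotation4_mulVec_atTimeZero] at h1
  have h2 := rotation4_mul_transpose α
  rw [← h1]
  calc _ = (rotation4 α * (rotation4 α).transpose) * S.g (atTimeZero ((rotation α).mulVec x))
        * (rotation4 α * (rotation4 α).transpose) := by rw [h2, one_mul, mul_one]
    _ = _ := by simp only [Matrix.mul_assoc]

theorem StationaryAxisymmetricSpacetime.lam_rotation (S : StationaryAxisymmetricSpacetime) (α : ℝ)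
    {x : Chart 3} (hx : x ∈ S.U) (hx0 : x ≠ 0) : S.lam ((rotation α).mulVec x) = S.lam x := by
  rw [lam, lam, S.g_rotation α hx hx0]
  simp [rotation4, Matrix.mul_apply, Matrix.vecMul, dotProduct, Fin.sum_univ_four]

theorem StationaryAxisymmetricSpacetime.trace_h_rotation (S : StationaryAxisymmetricSpacetime)
    (α : ℝ) {x : Chart 3} (hx : x ∈ S.U) (hx0 : x ≠ 0) :
    (S.h ((rotation α).mulVec x)).trace = (S.h x).trace := by
  have hs : ∀ y, (S.h y).trace = S.lam y * (S.g (atTimeZero y) 1 1 + S.g (atTimeZero y) 2 2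
      + S.g (atTimeZero y) 3 3) + S.g (atTimeZero y) 1 0 ^ 2 + S.g (atTimeZero y) 2 0 ^ 2
      + S.g (atTimeZero y) 3 0 ^ 2 := by
    intro y
    rw [Matrix.trace, Fin.sum_univ_three]
    simp only [Matrix.diag_apply, StationaryAxisymmetricSpacetime.h, Matrix.of_apply]
    change S.lam y * S.g (atTimeZero y) 1 1 + S.g (atTimeZero y) 1 0 * S.g (atTimeZero y) 1 0
      + (S.lam y * S.g (atTimeZero y) 2 2 + S.g (atTimeZero y) 2 0 * S.g (atTimeZero y) 2 0)
      + (S.lam y * S.g (atTimeZero y) 3 3 + S.g (atTimeZero y) 3 0 * S.g (atTimeZero y) 3 0) = _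
    ring
  rw [hs, hs, S.lam_rotation α hx hx0, S.g_rotation α hx hx0]
  simp [rotation4, Matrix.mul_apply, Matrix.vecMul, dotProduct, Fin.sum_univ_four]
  linear_combination (S.lam x * (S.g (atTimeZero x) 1 1 + S.g (atTimeZero x) 2 2)
    + S.g (atTimeZero x) 1 0 ^ 2 + S.g (atTimeZero x) 2 0 ^ 2) * Real.sin_sq_add_cos_sq α

theorem rotation_mulVec_ne_zero (α : ℝ) {x : Chart 3} (hx : x ≠ 0) :
    (rotation α).mulVec x ≠ 0 := fun h =>
  hx (Matrix.eq_zero_of_mulVec_eq_zero (isUnit_det_rotation α).ne_zero h)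

theorem AxialCompletion.trace_hhat (K : AxialCompletion S) {x : Chart 3} (hx : x ∈ S.U)
    (hr : x 0 ^ 2 + x 1 ^ 2 ≠ 0) : (K.hhat x).trace = 2 + Real.exp (-2 * K.β x) := by
  rw [K.hhat_form x hx hr, Matrix.trace, Fin.sum_univ_three]
  simp [cylindricalMetric]
  field_simp
  ring

/-- The axisymmetry of `Ω` has to be derived. In `tr ĥ = Ω² tr h` the Cartesian traces are rotation
invariant: that of `h` because rotations are orthogonal isometries, that of `ĥ` because it is `2 +
e^{-2β}`. This is positive, so `Ω²` is invariant, and so is the positive `Ω`. -/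
theorem AxialCompletion.Ω_rotation (K : AxialCompletion S) (α : ℝ) {x : Chart 3} (hx : x ∈ S.U)
    (hr : x 0 ^ 2 + x 1 ^ 2 ≠ 0) : K.Ω ((rotation α).mulVec x) = K.Ω x := by
  have hx0 : x ≠ 0 := by
    rintro rfl
    simp at hr
  have hRx := S.rotation_mem α x hx
  have hRx0 := rotation_mulVec_ne_zero α hx0
  have t1 := K.trace_hhat hx hr
  have t2 := K.trace_hhat hRx (by rwa [rotation_radius])
  rw [K.hhat_eq _ hx hx0, Matrix.trace_smul, smul_eq_mul] at t1
  rw [K.hhat_eq _ hRx hRx0, Matrix.trace_smul, smul_eq_mul, S.trace_h_rotation α hx hx0,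
    K.β_axisymmetric α x hx, ← t1] at t2
  have hne : (S.h x).trace ≠ 0 := by
    intro h0
    rw [h0, mul_zero] at t1
    have := Real.exp_pos (-2 * K.β x)
    linarith
  exact (pow_left_inj₀ (K.Ω_pos _ hRx hRx0).le (K.Ω_pos _ hx hx0).le two_ne_zero).1
    (mul_right_cancel₀ hne t2)

theorem AxialCompletion.phihat_axisymmetric (K : AxialCompletion S) :
    IsAxisymmetricOn S.U K.phihat := by
  intro α x hx
  by_cases hr : x 0 ^ 2 + x 1 ^ 2 = 0
  · have h0 : x 0 = 0 := by nlinarith [sq_nonneg (x 0), sq_nonneg (x 1)]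
    have h1 : x 1 = 0 := by nlinarith [sq_nonneg (x 0), sq_nonneg (x 1)]
    congr 1
    ext i
    fin_cases i <;> simp [rotation, Matrix.mulVec, dotProduct, Fin.sum_univ_three, h0, h1]
  · have hx0 : x ≠ 0 := by
      rintro rfl
      simp at hr
    rw [K.phihat_eq _ (S.rotation_mem α x hx) (rotation_mulVec_ne_zero α hx0),
      K.phihat_eq _ hx hx0, K.Ω_rotation α hx hr, StationaryAxisymmetricSpacetime.potential,
      StationaryAxisymmetricSpacetime.potential, S.lam_rotation α hx hx0,
      S.twist_axisymmetric α x ⟨hx, hx0⟩]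

theorem AxisymmetricNear.rescaledPotential {κ : Chart 3 → ℝ} {φ : Chart 3 → ℂ}
    (hκ : AxisymmetricNear κ) (hφ : AxisymmetricNear φ) :
    AxisymmetricNear (rescaledPotential κ φ) := by
  filter_upwards [hκ, hφ] with x h1 h2 α
  rw [Multipole.rescaledPotential, Multipole.rescaledPotential, h1 α, h2 α]

end Completion

end Multipole

theorem mainTheorem3 (S : StationaryAxisymmetricSpacetime) (K : AxialCompletion S)
    (hφ : AnalyticAt ℝ K.phihat 0) (hβ : AnalyticAt ℝ K.β 0) (C : ℝ) :
    -- a conformal factor of the required form can be chosen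
    (∃ κ, IsConformalExponent S.U κ ∧ IsSpecialExponent K.β κ C) ∧
    ∀ κ, IsConformalExponent S.U κ → IsSpecialExponent K.β κ C →
      -- the leading order functions of `β` and `κ` are real near `0`
      (∀ᶠ r in 𝓝 (0 : ℝ), leadC (fun x => (K.β x : ℂ)) r = leadR K.β r) ∧
      (∀ᶠ r in 𝓝 (0 : ℝ), leadC (fun x => (κ x : ℂ)) r = leadR κ r) ∧
      -- `M = 0`
      (∀ᶠ r in 𝓝[≠] (0 : ℝ), curvatureM K.β κ r = 0) ∧
      -- the leading order function of the rescaled potential is `e^{-κ_L/2} φ̂_L`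
      (∀ᶠ r in 𝓝 (0 : ℝ), leadC (rescaledPotential κ K.phihat) r =
        (Real.exp (-leadR κ r / 2) : ℂ) * leadC K.phihat r) ∧
      -- `r(ρ)` exists, and the moments are the derivatives of `y` at `0`
      (∃ rr, IsLocalInverse (radial K.β κ) rr) ∧
      ∀ rr, IsLocalInverse (radial K.β κ) rr →
        AnalyticAt ℝ (momentFunction κ K.phihat rr) 0 ∧
        ∀ (n : ℕ) (m : ℂ),
          IsMultipoleMoment (rescaledMetric κ K.hhat) (rescaledPotential κ K.phihat) n m ↔
            m = iteratedDeriv n (momentFunction κ K.phihat rr) 0 := by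
  obtain ⟨b, hb⟩ := K.exists_axialGeometry hβ
  -- The geometry with `κ = 0` only supplies the facts about `β` from which the required exponent is
  -- constructed.
  refine ⟨(hb (fun _ => 0) analyticAt_const
    (Eventually.of_forall fun _ _ => rfl)).exists_specialExponent S.U C, fun κ hκ hκC => ?_⟩
  have hκs := S.axisymmetricNear hκ.axisymmetric
  have hφs := S.axisymmetricNear K.phihat_axisymmetric
  have hG := hb κ hκ.analytic hκs
  have hh := K.rescaledMetric_eventuallyEq hG
  refine ⟨hG.axisymmetric_β.leadC_eq hβ, hκs.leadC_eq hκ.analytic, hG.curvatureM_eq_zero hκC,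
    leadC_rescaledPotential hκ.analytic hκs hφ,
    exists_isLocalInverse hG.analyticAt_radial (radial_zero _ _) (hG.deriv_radial_ne_zero hκC),
    fun rr hrr => ⟨hG.analyticAt_momentFunction hκC hφ hrr, fun n m => ?_⟩⟩
  rw [hG.isMultipoleMoment_iff hκ.zero hh (analyticAt_rescaledPotential hκ.analytic hφ)
      (hκs.rescaledPotential hφs),
    hG.iteratedDeriv_momentFunction hκ.zero hκC hh hφ hrr]
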